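/- Theorem ($\mathsf{RCA_0}$: $\mathsf{STAR}$ implies the SCT criterion). The system $\mathsf{RCA_0}$ of second-order arithmetic (basic axioms of first-order arithmetic for $0,1,+,\cdot,<$, induction for $\Sigma^0_1$ formulas, comprehension for $\Delta^0_1$ formulas) proves that the Triangle Ramsey theorem implies the SCT criterion; equivalently (by Gödel's completeness theorem), the implication holds in every model of $\mathsf{RCA_0}$. Here: The \emph{Triangle Ramsey theorem} ($\mathsf{STAR}$) says: for every $k\in\mathbb N$ and every coloring $c:[\mathbb N]^2\to k$ there are $i<k$ and $t\in\mathbb N$ such that for every $n$ there are $l>m>n$ with $m>t$ and $c(t,m)=c(t,l)=c(m,l)=i$. Every function identifier $f$ comes with a finite set $\mathrm{Var}(f)$ of parameters, whose size is the arity of $f$. A \emph{size-change graph} $G:f\to g$ (with source $f$ and target $g$) is given by a set of edges contained in $\mathrm{Var}(f)\times\{\downarrow,\Downarrow\}\times\mathrm{Var}(g)$ with at most one edge from $x$ to $y$ for each $x\in\mathrm{Var}(f)$, $y\in\mathrm{Var}(g)$; edges labelled $\downarrow$ are strict (decreasing), edges labelled $\Downarrow$ are non-strict. The \emph{composition} of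 $G_0:f\to g$ and $G_1:g\to h$ is the graph $G_0;G_1:f\to h$ that has a strict edge from $x$ to $z$ iff there are edges from $x$ to some $y$ in $G_0$ and from $y$ to $z$ in $G_1$ at least one of which is strict, and a non-strict edge from $x$ to $z$ iff there is such a pair of edges but no such pair contains a strict edge. $G$ is \emph{idempotent} if $G;G=G$. For a set $\mathcal G$ of size-change graphs, $\mathrm{cl}(\mathcal G)$ is the smallest set that contains $\mathcal G$ and is closed under composition. A \emph{multipath} of $\mathcal G$ is an infinite sequence $G_0,G_1,\dots$ of elements of $\mathcal G$ in which the target of each $G_n$ is the source of $G_{n+1}$; it has an \emph{infinite descent} if there are $t$ and parameters $x_0,x_1,\dots$ such that $G_{t+n}$ has an edge from $x_n$ to $x_{n+1}$ for every $n$, and this edge is strict for infinitely many $n$. $\mathcal G$ is \emph{SCT} (size-change terminating) if every multipath of $\mathcal G$ has an infinite descent. The \emph{SCT criterion} says: for every finite set $\mathcal G$ of size-change graphs, $\mathcal G$ is SCT if and only if every idempotent $G\in\mathrm{cl}(\mathcal G)$ has a strict edge from some parameter $x$ to itself. -/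

import Mathlib

universe u

/-- A structure for the language of second-order arithmetic: a first-order part `Num` with
`0, 1, +, *, <`, and a collection `sets` of subsets of `Num` over which the set variables range. -/
structure L2Structure where
  Num : Type u
  [instZero : Zero Num]
  [instOne : One Num]
  [instAdd : Add Num]
  [instMul : Mul Num]
  [instLT : LT Num]
  sets : Set (Set Num)

attribute [instance] L2Structure.instZero L2Structure.instOne L2Structure.instAdd
  L2Structure.instMul L2Structure.instLT

namespace L2Structure

/-! ### Formulas and the axioms of `RCA₀` -/

/-- Numerical terms in `n` free number variables, with number parameters from `𝔐`. -/
inductive Term (𝔐 : L2Structure.{u}) (n : ℕ) : Type u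
  | var : Fin n → Term 𝔐 n
  | param : 𝔐.Num → Term 𝔐 n
  | zero : Term 𝔐 n
  | one : Term 𝔐 n
  | add : Term 𝔐 n → Term 𝔐 n → Term 𝔐 n
  | mul : Term 𝔐 n → Term 𝔐 n → Term 𝔐 n

/-- The value of a term at an assignment `v` of the free variables. -/
def Term.val {𝔐 : L2Structure.{u}} {n : ℕ} (v : Fin n → 𝔐.Num) : Term 𝔐 n → 𝔐.Num
  | .var i => v i
  | .param a => a
  | .zero => 0
  | .one => 1
  | .add s t => s.val v + t.val v
  | .mul s t => s.val v * t.val v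

/-- Bounded (`Σ⁰₀`) formulas in `n` free number variables, with number and set parameters
from `𝔐`. In `ball t φ` and `bex t φ`, the bound variable is variable `0` of `φ`, and the other
variables of `φ` are those of `t`, shifted by one. -/
inductive BoundedFormula (𝔐 : L2Structure.{u}) : ℕ → Type u
  | eq {n : ℕ} : Term 𝔐 n → Term 𝔐 n → BoundedFormula 𝔐 n
  | lt {n : ℕ} : Term 𝔐 n → Term 𝔐 n → BoundedFormula 𝔐 n
  | mem {n : ℕ} : Term 𝔐 n → 𝔐.sets → BoundedFormula 𝔐 n
  | not {n : ℕ} : BoundedFormula 𝔐 n → BoundedFormula 𝔐 n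
  | and {n : ℕ} : BoundedFormula 𝔐 n → BoundedFormula 𝔐 n → BoundedFormula 𝔐 n
  | or {n : ℕ} : BoundedFormula 𝔐 n → BoundedFormula 𝔐 n → BoundedFormula 𝔐 n
  | ball {n : ℕ} : Term 𝔐 n → BoundedFormula 𝔐 (n + 1) → BoundedFormula 𝔐 n
  | bex {n : ℕ} : Term 𝔐 n → BoundedFormula 𝔐 (n + 1) → BoundedFormula 𝔐 n

/-- Tarskian truth of a bounded formula at an assignment of its free variables. -/
def BoundedFormula.Sat {𝔐 : L2Structure.{u}} :
    {n : ℕ} → BoundedFormula 𝔐 n → (Fin n → 𝔐.Num) → Prop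
  | _, .eq s t, v => s.val v = t.val v
  | _, .lt s t, v => s.val v < t.val v
  | _, .mem t X, v => t.val v ∈ (X : Set 𝔐.Num)
  | _, .not φ, v => ¬ φ.Sat v
  | _, .and φ ψ, v => φ.Sat v ∧ ψ.Sat v
  | _, .or φ ψ, v => φ.Sat v ∨ ψ.Sat v
  | _, .ball t φ, v => ∀ a : 𝔐.Num, a < t.val v → φ.Sat (Matrix.vecCons a v)
  | _, .bex t φ, v => ∃ a : 𝔐.Num, a < t.val v ∧ φ.Sat (Matrix.vecCons a v)

/-- `𝔐` is a model of `RCA₀`: the basic axioms of arithmetic, induction for all `Σ⁰₁` formulas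
`∃ y, θ(y, x)`, and comprehension for all `Δ⁰₁` formulas, that is, for all `Σ⁰₁` formulas
`∃ y, θ(y, x)` that are equivalent in `𝔐` to some `Π⁰₁` formula `∀ y, η(y, x)`. -/
structure IsModelRCA0 (𝔐 : L2Structure.{u}) : Prop where
  succ_ne_zero : ∀ a : 𝔐.Num, a + 1 ≠ 0
  succ_inj : ∀ a b : 𝔐.Num, a + 1 = b + 1 → a = b
  add_zero : ∀ a : 𝔐.Num, a + 0 = a
  add_succ : ∀ a b : 𝔐.Num, a + (b + 1) = (a + b) + 1
  mul_zero : ∀ a : 𝔐.Num, a * 0 = 0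
  mul_succ : ∀ a b : 𝔐.Num, a * (b + 1) = a * b + a
  not_lt_zero : ∀ a : 𝔐.Num, ¬ a < 0
  lt_succ : ∀ a b : 𝔐.Num, a < b + 1 ↔ a < b ∨ a = b
  sigma1_induction : ∀ θ : BoundedFormula 𝔐 2,
    (∃ y, θ.Sat ![y, 0]) →
    (∀ x, (∃ y, θ.Sat ![y, x]) → ∃ y, θ.Sat ![y, x + 1]) →
    ∀ x, ∃ y, θ.Sat ![y, x]
  delta1_comprehension : ∀ θ η : BoundedFormula 𝔐 2,
    (∀ x, (∃ y, θ.Sat ![y, x]) ↔ ∀ y, η.Sat ![y, x]) →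
    ∃ X ∈ 𝔐.sets, ∀ x, x ∈ X ↔ ∃ y, θ.Sat ![y, x]

/-! Everything below is arithmetic *inside* `𝔐`: all quantifiers range over the numbers of `𝔐`
or over the members of `𝔐.sets`. -/

variable {𝔐 : L2Structure.{u}}

/-! ### Coding of pairs, functions and finite sets -/

/-- The usual code of the ordered pair `(a, b)` in second-order arithmetic. -/
def pair (a b : 𝔐.Num) : 𝔐.Num := (a + b) * (a + b) + a

/-- `F` is (the graph of) a function from the numbers of `𝔐` to the numbers of `𝔐`. -/
def IsFun (F : Set 𝔐.Num) : Prop := ∀ x : 𝔐.Num, ∃! y : 𝔐.Num, pair x y ∈ F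

/-- `X` is finite in the sense of `𝔐`, that is, bounded. -/
def IsFin (X : Set 𝔐.Num) : Prop := ∃ b : 𝔐.Num, ∀ x ∈ X, x < b

/-- `e` codes a triple `(k, m, n)` of numbers. -/
def IsTriple (e : 𝔐.Num) : Prop := ∃ k m n : 𝔐.Num, e = pair k (pair m n)

/-- `i` is in the finite set coded by `e = (k, m, n)`, namely the set of all `i < k` such that
`m * (i + 1) + 1` divides `n`. -/
def MemCode (i e : 𝔐.Num) : Prop :=
  ∃ k m n : 𝔐.Num, e = pair k (pair m n) ∧ i < k ∧ ∃ q : 𝔐.Num, n = (m * (i + 1) + 1) * q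

/-- `e` is the code of a finite set: the least triple that codes this set. Hence every finite set
has exactly one code. -/
def IsFinCode (e : 𝔐.Num) : Prop :=
  IsTriple e ∧
    ∀ e' : 𝔐.Num, IsTriple e' → (∀ i : 𝔐.Num, MemCode i e' ↔ MemCode i e) → ¬ e' < e

/-! ### The Triangle Ramsey theorem -/

/-- `c` is (the graph of) a coloring of the pairs `m < n` in `k` many colors. -/
def IsColoring (k : 𝔐.Num) (c : Set 𝔐.Num) : Prop :=
  ∀ m n : 𝔐.Num, m < n →
    (∃! i : 𝔐.Num, pair (pair m n) i ∈ c) ∧ ∀ i : 𝔐.Num, pair (pair m n) i ∈ c → i < k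

variable (𝔐) in
/-- The Triangle Ramsey theorem: every coloring of pairs in finitely many colors has a vertex `t`
and a color `i` such that `t` is the first vertex of triangles `t < m < l` homogeneous in color
`i`, with `m` arbitrarily large. -/
def STAR : Prop :=
  ∀ k : 𝔐.Num, ∀ c ∈ 𝔐.sets, IsColoring k c →
    ∃ i : 𝔐.Num, i < k ∧ ∃ t : 𝔐.Num, ∀ b : 𝔐.Num, ∃ m l : 𝔐.Num,
      b < m ∧ t < m ∧ m < l ∧
        pair (pair t m) i ∈ c ∧ pair (pair t l) i ∈ c ∧ pair (pair m l) i ∈ c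

/-! ### Size-change graphs

Function identifiers are numbers. A function `ar` gives the arity of each of them, and
`Var(f) = {0, …, ar(f) - 1}`. -/

/-- `x` is a parameter of the function identifier `f`. -/
def IsVar (ar : Set 𝔐.Num) (f x : 𝔐.Num) : Prop := ∃ n : 𝔐.Num, pair f n ∈ ar ∧ x < n

/-- The label `↓` of decreasing edges (strict arcs). -/
def dec : 𝔐.Num := 0

/-- The label `⇓` of weakly-decreasing edges (non-strict arcs). -/
def wdec : 𝔐.Num := 1

/-- The triple `(x, r, y)`, that is, the edge from `x` to `y` with label `r`. -/
def edge (x r y : 𝔐.Num) : 𝔐.Num := pair x (pair r y)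

/-- The graph with source function `f`, target function `g` and edge set coded by `e`. -/
def graph (f g e : 𝔐.Num) : 𝔐.Num := pair f (pair g e)

/-- `G` is a size-change graph `f → g`. -/
def IsGraphFrom (ar : Set 𝔐.Num) (G f g : 𝔐.Num) : Prop :=
  ∃ e : 𝔐.Num, G = graph f g e ∧ IsFinCode e ∧
    (∀ d : 𝔐.Num, MemCode d e → ∃ x r y : 𝔐.Num, d = edge x r y ∧
      IsVar ar f x ∧ (r = dec ∨ r = wdec) ∧ IsVar ar g y) ∧
    ∀ x y r r' : 𝔐.Num, MemCode (edge x r y) e → MemCode (edge x r' y) e → r = r'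

/-- `(x, r, y)` is an edge of the graph `G`. -/
def HasEdge (G x r y : 𝔐.Num) : Prop :=
  ∃ f g e : 𝔐.Num, G = graph f g e ∧ MemCode (edge x r y) e

/-- `H` is the composition `G₀;G₁` of the size-change graphs `G₀ : f → g` and `G₁ : g → h`. -/
def IsComp (ar : Set 𝔐.Num) (G₀ G₁ H : 𝔐.Num) : Prop :=
  (∃ f g h : 𝔐.Num, IsGraphFrom ar G₀ f g ∧ IsGraphFrom ar G₁ g h ∧ IsGraphFrom ar H f h) ∧
  (∀ x z : 𝔐.Num, HasEdge H x dec z ↔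
    ∃ y r : 𝔐.Num, (HasEdge G₀ x dec y ∧ HasEdge G₁ y r z) ∨
      (HasEdge G₀ x r y ∧ HasEdge G₁ y dec z)) ∧
  (∀ x z : 𝔐.Num, HasEdge H x wdec z ↔
    (∃ y : 𝔐.Num, HasEdge G₀ x wdec y ∧ HasEdge G₁ y wdec z) ∧
      ∀ y r r' : 𝔐.Num, HasEdge G₀ x r y → HasEdge G₁ y r' z → r = wdec ∧ r' = wdec)

/-- `G;G = G`. -/
def IsIdempotent (ar : Set 𝔐.Num) (G : 𝔐.Num) : Prop := IsComp ar G G G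

/-- The set `C` of graphs contains `𝒢` and is closed under composition. -/
def IsClosedOver (ar 𝒢 C : Set 𝔐.Num) : Prop :=
  𝒢 ⊆ C ∧ ∀ G₀ G₁ H : 𝔐.Num, G₀ ∈ C → G₁ ∈ C → IsComp ar G₀ G₁ H → H ∈ C

/-- `C = cl(𝒢)` is the smallest set that contains `𝒢` and is closed under composition. -/
def IsClosureOf (ar 𝒢 C : Set 𝔐.Num) : Prop :=
  C ∈ 𝔐.sets ∧ IsClosedOver ar 𝒢 C ∧ ∀ D ∈ 𝔐.sets, IsClosedOver ar 𝒢 D → C ⊆ D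

/-- `p` is an infinite multipath `G₀, G₁, …` of graphs from `𝒢`: the target function of each graph
is the source function of the next one. -/
def IsMultipath (ar 𝒢 p : Set 𝔐.Num) : Prop :=
  IsFun p ∧ (∀ n G : 𝔐.Num, pair n G ∈ p → G ∈ 𝒢) ∧
    ∀ n G H : 𝔐.Num, pair n G ∈ p → pair (n + 1) H ∈ p →
      ∃ f g h : 𝔐.Num, IsGraphFrom ar G f g ∧ IsGraphFrom ar H g h

/-- `θ` is the sequence of parameters `x₀, x₁, …` along an infinite thread of the multipath `p`
that starts at the `t`-th graph: there is an edge from `xₙ` to `xₙ₊₁` in the `(t + n)`-th graph. -/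
def IsThread (p : Set 𝔐.Num) (t : 𝔐.Num) (θ : Set 𝔐.Num) : Prop :=
  IsFun θ ∧ ∀ n x y G : 𝔐.Num, pair n x ∈ θ → pair (n + 1) y ∈ θ → pair (t + n) G ∈ p →
    ∃ r : 𝔐.Num, HasEdge G x r y

/-- Some thread of the multipath `p` contains infinitely many decreasing edges. -/
def HasInfiniteDescent (p : Set 𝔐.Num) : Prop :=
  ∃ t : 𝔐.Num, ∃ θ ∈ 𝔐.sets, IsThread p t θ ∧
    ∀ b : 𝔐.Num, ∃ n x y G : 𝔐.Num, b < n ∧ pair n x ∈ θ ∧ pair (n + 1) y ∈ θ ∧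
      pair (t + n) G ∈ p ∧ HasEdge G x dec y

/-- `𝒢` is size-change terminating: every infinite multipath of graphs from `𝒢` has an infinite
descent. -/
def IsSCT (ar 𝒢 : Set 𝔐.Num) : Prop :=
  ∀ p ∈ 𝔐.sets, IsMultipath ar 𝒢 p → HasInfiniteDescent p

variable (𝔐) in
/-- The SCT criterion for graphs: for every finite set `𝒢` of size-change graphs, `𝒢` is SCT if
and only if every idempotent `G ∈ cl(𝒢)` has a strict arc from some `x` to itself. (That the set
`cl(𝒢)` exists in `𝔐` is part of the assertion.) -/
def SCTCriterion : Prop :=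
  ∀ ar ∈ 𝔐.sets, IsFun ar → ∀ 𝒢 ∈ 𝔐.sets, IsFin 𝒢 →
    (∀ G ∈ 𝒢, ∃ f g : 𝔐.Num, IsGraphFrom ar G f g) →
    ∃ C : Set 𝔐.Num, IsClosureOf ar 𝒢 C ∧
      (IsSCT ar 𝒢 ↔ ∀ G ∈ C, IsIdempotent ar G → ∃ x : 𝔐.Num, HasEdge G x dec x)

end L2Structure

/-! The argument runs inside a fixed model of `RCA₀`, so every induction must be for a `Σ⁰₁`
predicate and every set must come from `Δ⁰₁` comprehension. Definability is handled semantically: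
`Sigma0`, `Sigma1`, `Delta1` and `Delta1Fun` are type classes on predicates and functions, with
closure properties as instances, so that instance search checks the complexity of each induction and
comprehension. On this basis the usual tools are developed: ordered semiring arithmetic, collection,
least elements, uniformization, Gödel coding of finite sets, and primitive recursion
(`exists_primrec`).

The closure of `𝒢` is the set `Reach` of composites of finite sequences from `𝒢`. It is `Σ⁰₁`; since
only boundedly many graphs exist between the functions that occur (`exists_graph_bound`), bounded
`Σ⁰₁` comprehension makes it a set of the model (`isClosureOf_reach`).

SCT gives loops (`exists_strict_loop_of_isSCT`): if the idempotent `G` is the composite of `q 0, …,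
q n`, then repeating these graphs periodically gives a multipath, which has an infinite descent.
Strong `Σ⁰₁` collection gives a `u` such that every parameter that the thread visits at the start of
a period is already visited at the start of a period before `u`. Take a strict edge of the thread
beyond `u` and the start `k'` of a later period. The parameter at `k'` equals that at some earlier
period start `k < u`, and the composite from `k` to `k'` is a power of `G`, hence `G`; so `G` has a
strict loop there. No infinite pigeonhole principle is needed.

`STAR` gives descents (`STAR.isSCT`): colour `m < n` with the composite of the graphs from `m` to `n
- 1`. There are boundedly many colours, so `STAR` yields a vertex `t` and a graph `H` with
arbitrarily late triangles `t < m < l` of colour `H`. One triangle shows `H;H = H`, so `H` has a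
strict loop at some `x`. If `t < m < l` and `t < m' < l'` are such triangles with `l < m'`, then the
composite from `m` to `m'` is `H` followed by the composite from `l` to `m'`, and so is the
composite from `t` to `m'`, which is `H`. Hence the multipath splits into consecutive blocks with
composite `H` (`IsComposite.exists_blocks`). Unfolding the loop at `x` in each block gives finite
threads from `x` to `x` with a strict edge, and these are concatenated (`exists_thread_of_blocks`).
-/

namespace L2Structure

variable {𝔐 : L2Structure.{u}}

/-! ### Terms and bounded formulas, semantically -/

/-- `f` is the value function of a term. -/
class TermFun {n : ℕ} (f : (Fin n → 𝔐.Num) → 𝔐.Num) : Prop where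
  out : ∃ t : Term 𝔐 n, ∀ v, t.val v = f v

/-- `P` is the truth predicate of a bounded formula. -/
class Sigma0 {n : ℕ} (P : (Fin n → 𝔐.Num) → Prop) : Prop where
  out : ∃ φ : BoundedFormula 𝔐 n, ∀ v, φ.Sat v ↔ P v

section closure

variable {n m : ℕ}

instance TermFun.var (i : Fin n) : TermFun (fun v : Fin n → 𝔐.Num => v i) :=
  ⟨.var i, fun _ => rfl⟩

instance TermFun.const (a : 𝔐.Num) : TermFun (fun _ : Fin n → 𝔐.Num => a) :=
  ⟨.param a, fun _ => rfl⟩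

instance TermFun.add (f g : (Fin n → 𝔐.Num) → 𝔐.Num) [hf : TermFun f] [hg : TermFun g] :
    TermFun (fun v => f v + g v) := by
  obtain ⟨s, hs⟩ := hf.out
  obtain ⟨t, ht⟩ := hg.out
  exact ⟨.add s t, fun v => by simp [Term.val, hs, ht]⟩

instance TermFun.mul (f g : (Fin n → 𝔐.Num) → 𝔐.Num) [hf : TermFun f] [hg : TermFun g] :
    TermFun (fun v => f v * g v) := by
  obtain ⟨s, hs⟩ := hf.out
  obtain ⟨t, ht⟩ := hg.out
  exact ⟨.mul s t, fun v => by simp [Term.val, hs, ht]⟩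

theorem TermFun.subst {f : (Fin n → 𝔐.Num) → 𝔐.Num} (hf : TermFun f)
    (t : Fin n → (Fin m → 𝔐.Num) → 𝔐.Num) (ht : ∀ i, TermFun (t i)) :
    TermFun (fun v => f fun i => t i v) := by
  obtain ⟨s, hs⟩ := hf.out
  have key : ∀ s : Term 𝔐 n, TermFun (fun v => s.val fun i => t i v) := by
    intro s
    induction s with
    | var i => exact ht i
    | param a => exact TermFun.const a
    | zero => exact TermFun.const 0
    | one => exact TermFun.const 1
    | add s t hs ht => exact TermFun.add _ _
    | mul s t hs ht => exact TermFun.mul _ _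
  simpa only [hs] using key s

instance Sigma0.eq (f g : (Fin n → 𝔐.Num) → 𝔐.Num) [hf : TermFun f] [hg : TermFun g] :
    Sigma0 (fun v => f v = g v) := by
  obtain ⟨s, hs⟩ := hf.out
  obtain ⟨t, ht⟩ := hg.out
  exact ⟨.eq s t, fun v => by simp [BoundedFormula.Sat, hs, ht]⟩

instance Sigma0.lt (f g : (Fin n → 𝔐.Num) → 𝔐.Num) [hf : TermFun f] [hg : TermFun g] :
    Sigma0 (fun v => f v < g v) := by
  obtain ⟨s, hs⟩ := hf.out
  obtain ⟨t, ht⟩ := hg.out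
  exact ⟨.lt s t, fun v => by simp [BoundedFormula.Sat, hs, ht]⟩

theorem Sigma0.mem (f : (Fin n → 𝔐.Num) → 𝔐.Num) [hf : TermFun f] {X : Set 𝔐.Num}
    (hX : X ∈ 𝔐.sets) : Sigma0 (fun v => f v ∈ X) := by
  obtain ⟨s, hs⟩ := hf.out
  exact ⟨.mem s ⟨X, hX⟩, fun v => by simp [BoundedFormula.Sat, hs]⟩

instance Sigma0.not (P : (Fin n → 𝔐.Num) → Prop) [hP : Sigma0 P] :
    Sigma0 (fun v => ¬ P v) := by
  obtain ⟨φ, hφ⟩ := hP.out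
  exact ⟨.not φ, fun v => by simp [BoundedFormula.Sat, hφ]⟩

instance Sigma0.and (P Q : (Fin n → 𝔐.Num) → Prop) [hP : Sigma0 P] [hQ : Sigma0 Q] :
    Sigma0 (fun v => P v ∧ Q v) := by
  obtain ⟨φ, hφ⟩ := hP.out
  obtain ⟨ψ, hψ⟩ := hQ.out
  exact ⟨.and φ ψ, fun v => by simp [BoundedFormula.Sat, hφ, hψ]⟩

instance Sigma0.or (P Q : (Fin n → 𝔐.Num) → Prop) [hP : Sigma0 P] [hQ : Sigma0 Q] :
    Sigma0 (fun v => P v ∨ Q v) := by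
  obtain ⟨φ, hφ⟩ := hP.out
  obtain ⟨ψ, hψ⟩ := hQ.out
  exact ⟨.or φ ψ, fun v => by simp [BoundedFormula.Sat, hφ, hψ]⟩

theorem Sigma0.congr {P Q : (Fin n → 𝔐.Num) → Prop} (hP : Sigma0 P) (h : ∀ v, P v ↔ Q v) :
    Sigma0 Q := by
  rwa [show Q = P from funext fun v => propext (h v).symm]

instance Sigma0.imp (P Q : (Fin n → 𝔐.Num) → Prop) [Sigma0 P] [Sigma0 Q] :
    Sigma0 (fun v => P v → Q v) :=
  Sigma0.congr (P := fun v => ¬ P v ∨ Q v) inferInstance fun _ => imp_iff_not_or.symm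

instance Sigma0.ball (f : (Fin n → 𝔐.Num) → 𝔐.Num) (P : 𝔐.Num → (Fin n → 𝔐.Num) → Prop)
    [hf : TermFun f] [hP : Sigma0 (fun w : Fin (n + 1) → 𝔐.Num => P (w 0) fun i => w i.succ)] :
    Sigma0 (fun v => ∀ a, a < f v → P a v) := by
  obtain ⟨t, ht⟩ := hf.out
  obtain ⟨φ, hφ⟩ := hP.out
  exact ⟨.ball t φ, fun v => by simp [BoundedFormula.Sat, hφ, ht]⟩

instance Sigma0.bex (f : (Fin n → 𝔐.Num) → 𝔐.Num) (P : 𝔐.Num → (Fin n → 𝔐.Num) → Prop)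
    [hf : TermFun f] [hP : Sigma0 (fun w : Fin (n + 1) → 𝔐.Num => P (w 0) fun i => w i.succ)] :
    Sigma0 (fun v => ∃ a, a < f v ∧ P a v) := by
  obtain ⟨t, ht⟩ := hf.out
  obtain ⟨φ, hφ⟩ := hP.out
  exact ⟨.bex t φ, fun v => by simp [BoundedFormula.Sat, hφ, ht]⟩

theorem Sigma0.subst {P : (Fin n → 𝔐.Num) → Prop} (hP : Sigma0 P)
    (t : Fin n → (Fin m → 𝔐.Num) → 𝔐.Num) (ht : ∀ i, TermFun (t i)) :
    Sigma0 (fun v => P fun i => t i v) := by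
  obtain ⟨φ, hφ⟩ := hP.out
  suffices key : ∀ (n : ℕ) (φ : BoundedFormula 𝔐 n) (m : ℕ)
      (t : Fin n → (Fin m → 𝔐.Num) → 𝔐.Num), (∀ i, TermFun (t i)) →
      Sigma0 (fun v => φ.Sat fun i => t i v) from by
    simpa only [hφ] using key n φ m t ht
  clear! P
  -- Under a bounded quantifier the substitution fixes the new variable `0` and shifts the variables
  -- of all other terms.
  have lift : ∀ (n m : ℕ) (t : Fin n → (Fin m → 𝔐.Num) → 𝔐.Num), (∀ i, TermFun (t i)) →
      ∀ i, TermFun (fun w : Fin (m + 1) → 𝔐.Num =>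
        (Matrix.vecCons (w 0) (fun j => t j fun i => w i.succ) : Fin (n + 1) → 𝔐.Num) i) := by
    intro n m t ht i
    refine Fin.cases ?_ (fun j => ?_) i
    · exact TermFun.var 0
    · exact TermFun.subst (ht j) (fun i w => w i.succ) fun i => TermFun.var _
  have tm : ∀ (n : ℕ) (s : Term 𝔐 n), TermFun (fun v => s.val v) := fun n s => ⟨s, fun _ => rfl⟩
  intro n φ
  induction φ with
  | eq s s' =>
    intro m t ht
    have := TermFun.subst (tm _ s) t ht
    have := TermFun.subst (tm _ s') t ht
    exact Sigma0.eq _ _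
  | lt s s' =>
    intro m t ht
    have := TermFun.subst (tm _ s) t ht
    have := TermFun.subst (tm _ s') t ht
    exact Sigma0.lt _ _
  | mem s X =>
    intro m t ht
    have := TermFun.subst (tm _ s) t ht
    exact Sigma0.mem _ X.2
  | not φ ih =>
    intro m t ht
    have := ih m t ht
    exact Sigma0.not _
  | and φ ψ ih ih' =>
    intro m t ht
    have := ih m t ht
    have := ih' m t ht
    exact Sigma0.and _ _
  | or φ ψ ih ih' =>
    intro m t ht
    have := ih m t ht
    have := ih' m t ht
    exact Sigma0.or _ _
  | ball s φ ih =>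
    intro m t ht
    have := TermFun.subst (tm _ s) t ht
    have := ih (m + 1) _ (lift _ _ t ht)
    exact Sigma0.ball (fun v => s.val fun i => t i v)
      (fun a v => φ.Sat (Matrix.vecCons a fun i => t i v))
  | bex s φ ih =>
    intro m t ht
    have := TermFun.subst (tm _ s) t ht
    have := ih (m + 1) _ (lift _ _ t ht)
    exact Sigma0.bex (fun v => s.val fun i => t i v)
      (fun a v => φ.Sat (Matrix.vecCons a fun i => t i v))

theorem Sigma0.subst_cons {Q : 𝔐.Num → (Fin n → 𝔐.Num) → Prop}
    (hQ : Sigma0 (fun w : Fin (n + 1) → 𝔐.Num => Q (w 0) fun i => w i.succ))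
    (f : (Fin m → 𝔐.Num) → 𝔐.Num) (g : Fin n → (Fin m → 𝔐.Num) → 𝔐.Num)
    (hf : TermFun f) (hg : ∀ i, TermFun (g i)) :
    Sigma0 (fun v => Q (f v) fun i => g i v) := by
  refine Sigma0.subst hQ (Fin.cases f g) fun i => ?_
  refine Fin.cases ?_ (fun j => ?_) i
  · exact hf
  · exact hg j

end closure

/-! ### Ordered semiring arithmetic from the basic axioms and bounded induction. -/

section arithmetic

variable [h𝔐 : Fact 𝔐.IsModelRCA0]

/-- A bounded predicate is `Σ⁰₁` with a dummy witness: variable `0` is the unused witness and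
variable `1` the induction variable. -/
theorem sigma0_induction {P : 𝔐.Num → Prop} (hP : Sigma0 (fun v : Fin 1 → 𝔐.Num => P (v 0)))
    (h0 : P 0) (hs : ∀ x, P x → P (x + 1)) (x : 𝔐.Num) : P x := by
  have h2 : Sigma0 (fun v : Fin 2 → 𝔐.Num => P (v 1)) :=
    Sigma0.subst hP (fun _ v => v 1) fun _ => TermFun.var 1
  obtain ⟨φ, hφ⟩ := h2.out
  have := h𝔐.out.sigma1_induction φ
  simp only [hφ, Matrix.cons_val_one, Matrix.cons_val_zero, exists_const_iff] at this
  exact (this ⟨⟨0⟩, h0⟩ (fun x hx => ⟨⟨0⟩, hs x hx.2⟩) x).2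

namespace Arith

theorem add_zero (a : 𝔐.Num) : a + 0 = a := h𝔐.out.add_zero a
theorem add_succ (a b : 𝔐.Num) : a + (b + 1) = (a + b) + 1 := h𝔐.out.add_succ a b
theorem mul_zero (a : 𝔐.Num) : a * 0 = 0 := h𝔐.out.mul_zero a
theorem mul_succ (a b : 𝔐.Num) : a * (b + 1) = a * b + a := h𝔐.out.mul_succ a b
theorem not_lt_zero (a : 𝔐.Num) : ¬ a < 0 := h𝔐.out.not_lt_zero a
theorem lt_succ (a b : 𝔐.Num) : a < b + 1 ↔ a < b ∨ a = b := h𝔐.out.lt_succ a b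

theorem zero_add (a : 𝔐.Num) : 0 + a = a :=
  sigma0_induction (P := fun a => 0 + a = a) inferInstance (add_zero 0)
    (fun x hx => by rw [add_succ, hx]) a

theorem add_assoc (a b c : 𝔐.Num) : a + b + c = a + (b + c) :=
  sigma0_induction (P := fun c => a + b + c = a + (b + c)) inferInstance
    (by rw [add_zero, add_zero]) (fun x hx => by rw [add_succ, hx, add_succ, add_succ]) c

theorem succ_add (a b : 𝔐.Num) : a + 1 + b = a + b + 1 :=
  sigma0_induction (P := fun b => a + 1 + b = a + b + 1) inferInstance
    (by rw [add_zero, add_zero]) (fun x hx => by rw [add_succ, hx, add_succ]) b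

theorem add_comm (a b : 𝔐.Num) : a + b = b + a :=
  sigma0_induction (P := fun b => a + b = b + a) inferInstance
    (by rw [add_zero, zero_add]) (fun x hx => by rw [add_succ, hx, succ_add]) b

theorem zero_mul (a : 𝔐.Num) : 0 * a = 0 :=
  sigma0_induction (P := fun a => 0 * a = 0) inferInstance (mul_zero 0)
    (fun x hx => by rw [mul_succ, hx, add_zero]) a

theorem succ_mul (a b : 𝔐.Num) : (a + 1) * b = a * b + b :=
  sigma0_induction (P := fun b => (a + 1) * b = a * b + b) inferInstance
    (by rw [mul_zero, mul_zero, add_zero])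
    (fun x hx => by
      rw [mul_succ, hx, mul_succ, add_assoc, add_assoc, ← add_assoc x, add_comm x a, add_assoc]) b

theorem mul_comm (a b : 𝔐.Num) : a * b = b * a :=
  sigma0_induction (P := fun b => a * b = b * a) inferInstance
    (by rw [mul_zero, zero_mul]) (fun x hx => by rw [mul_succ, hx, succ_mul]) b

theorem mul_add (a b c : 𝔐.Num) : a * (b + c) = a * b + a * c :=
  sigma0_induction (P := fun c => a * (b + c) = a * b + a * c) inferInstance
    (by rw [mul_zero, add_zero, add_zero])
    (fun x hx => by rw [add_succ, mul_succ, hx, mul_succ, add_assoc]) c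

theorem mul_assoc (a b c : 𝔐.Num) : a * b * c = a * (b * c) :=
  sigma0_induction (P := fun c => a * b * c = a * (b * c)) inferInstance
    (by rw [mul_zero, mul_zero, mul_zero])
    (fun x hx => by rw [mul_succ, hx, mul_succ, mul_add]) c

theorem mul_one (a : 𝔐.Num) : a * 1 = a := by
  rw [← zero_add 1, mul_succ, mul_zero, zero_add]

theorem lt_succ_self (a : 𝔐.Num) : a < a + 1 := (lt_succ a a).2 (.inr rfl)

theorem lt_trans {a b c : 𝔐.Num} (hab : a < b) (hbc : b < c) : a < c :=
  sigma0_induction (P := fun c => b < c → a < c) inferInstance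
    (fun h => (not_lt_zero _ h).elim)
    (fun _ hx h => (lt_succ _ _).2 (.inl (((lt_succ _ _).1 h).elim hx fun h => h ▸ hab))) c hbc

theorem lt_irrefl (a : 𝔐.Num) : ¬ a < a :=
  sigma0_induction (P := fun a => ¬ a < a) inferInstance (not_lt_zero 0)
    (fun x hx h => ((lt_succ _ _).1 h).elim (fun h => hx (lt_trans (lt_succ_self x) h))
      fun h => hx (by simpa only [h] using lt_succ_self x)) a

theorem zero_or_pos (a : 𝔐.Num) : 0 = a ∨ 0 < a :=
  sigma0_induction (P := fun a => 0 = a ∨ 0 < a) inferInstance (.inl rfl)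
    (fun _ hx => .inr ((lt_succ _ _).2 hx.symm)) a

theorem succ_le_of_lt {a b : 𝔐.Num} (hab : a < b) : a + 1 < b ∨ a + 1 = b :=
  sigma0_induction (P := fun b => a < b → a + 1 < b ∨ a + 1 = b) inferInstance
    (fun h => (not_lt_zero _ h).elim)
    (fun _ hx h => ((lt_succ _ _).1 h).elim (fun h => .inl ((lt_succ _ _).2 (hx h)))
      fun h => .inr (h ▸ rfl)) b hab

theorem trichotomy (a b : 𝔐.Num) : a < b ∨ a = b ∨ b < a :=
  sigma0_induction (P := fun a => a < b ∨ a = b ∨ b < a) inferInstance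
    ((zero_or_pos b).elim (fun h => .inr (.inl h)) .inl)
    (fun x hx => by
      rcases hx with h | h | h
      · exact (succ_le_of_lt h).imp_right .inl
      · exact .inr (.inr (h ▸ lt_succ_self x))
      · exact .inr (.inr (lt_trans h (lt_succ_self x)))) a

theorem succ_lt_succ {a b : 𝔐.Num} (h : a < b) : a + 1 < b + 1 :=
  (lt_succ _ _).2 (succ_le_of_lt h)

theorem add_lt_add_right {a b : 𝔐.Num} (h : a < b) (c : 𝔐.Num) : a + c < b + c :=
  sigma0_induction (P := fun c => a + c < b + c) inferInstance (by rwa [add_zero, add_zero])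
    (fun x hx => by rw [add_succ, add_succ]; exact succ_lt_succ hx) c

theorem eq_zero_or_succ (a : 𝔐.Num) : a = 0 ∨ ∃ b, b < a ∧ a = b + 1 :=
  sigma0_induction (P := fun a => a = 0 ∨ ∃ b, b < a ∧ a = b + 1) inferInstance (.inl rfl)
    (fun x _ => .inr ⟨x, lt_succ_self x, rfl⟩) a

/-- The induction carries the bound `c < b` only to keep the predicate bounded. -/
theorem exists_add_of_lt {a b : 𝔐.Num} (hab : a < b) : ∃ c, b = a + (c + 1) := by
  have := sigma0_induction (P := fun b => a < b → ∃ c, c < b ∧ b = a + (c + 1)) inferInstance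
    (fun h => (not_lt_zero _ h).elim)
    (fun x hx h => by
      rcases (lt_succ _ _).1 h with h | h
      · obtain ⟨c, hc, e⟩ := hx h
        exact ⟨c + 1, succ_lt_succ hc, by rw [add_succ, ← e]⟩
      · refine ⟨0, (lt_succ _ _).2 ((zero_or_pos x).elim (fun h => .inr h) .inl), ?_⟩
        rw [zero_add, h]) b hab
  obtain ⟨c, -, h⟩ := this
  exact ⟨c, h⟩

theorem mul_pos {a b : 𝔐.Num} (ha : 0 < a) (hb : 0 < b) : 0 < a * b := by
  rcases eq_zero_or_succ b with rfl | ⟨b, -, rfl⟩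
  · exact (lt_irrefl _ hb).elim
  · rw [mul_succ]
    have h := add_lt_add_right ha (a * b)
    rw [zero_add, add_comm] at h
    exact (zero_or_pos (a * b)).elim (fun e => e ▸ h) fun h' => lt_trans h' h

end Arith

noncomputable instance instLinearOrder : LinearOrder 𝔐.Num where
  le a b := a < b ∨ a = b
  lt a b := a < b
  le_refl _ := .inr rfl
  le_trans a b c h h' := by
    rcases h with h | rfl
    · rcases h' with h' | rfl
      · exact .inl (Arith.lt_trans h h')
      · exact .inl h
    · exact h'
  le_antisymm a b h h' := by
    rcases h with h | rfl
    · rcases h' with h' | rfl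
      · exact (Arith.lt_irrefl _ (Arith.lt_trans h h')).elim
      · rfl
    · rfl
  lt_iff_le_not_ge a b := by
    constructor
    · intro h
      refine ⟨.inl h, ?_⟩
      rintro (h' | rfl)
      · exact Arith.lt_irrefl _ (Arith.lt_trans h h')
      · exact Arith.lt_irrefl _ h
    · rintro ⟨h | rfl, h'⟩
      · exact h
      · exact (h' (.inr rfl)).elim
  le_total a b := by
    rcases Arith.trichotomy a b with h | h | h
    · exact .inl (.inl h)
    · exact .inl (.inr h)
    · exact .inr (.inl h)
  toDecidableLE := Classical.decRel _

instance instCommSemiring : CommSemiring 𝔐.Num where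
  add_assoc := Arith.add_assoc
  zero_add := Arith.zero_add
  add_zero := Arith.add_zero
  add_comm := Arith.add_comm
  left_distrib := Arith.mul_add
  right_distrib a b c := by
    rw [Arith.mul_comm, Arith.mul_add, Arith.mul_comm c a, Arith.mul_comm c b]
  zero_mul := Arith.zero_mul
  mul_zero := Arith.mul_zero
  mul_assoc := Arith.mul_assoc
  one_mul a := by rw [Arith.mul_comm, Arith.mul_one]
  mul_one := Arith.mul_one
  mul_comm := Arith.mul_comm
  nsmul := nsmulRec

theorem lt_add_one_iff' {a b : 𝔐.Num} : a < b + 1 ↔ a ≤ b := Arith.lt_succ a b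

theorem add_one_le_iff' {a b : 𝔐.Num} : a + 1 ≤ b ↔ a < b :=
  ⟨fun h => (Arith.lt_succ_self a).trans_le h, Arith.succ_le_of_lt⟩

instance instIsStrictOrderedRing : IsStrictOrderedRing 𝔐.Num := by
  have add_lt : ∀ a b c : 𝔐.Num, a < b → a + c < b + c :=
    fun a b c h => Arith.add_lt_add_right h c
  have mul_lt : ∀ a b c : 𝔐.Num, 0 < a → b < c → a * b < a * c := by
    intro a b c ha h
    obtain ⟨d, rfl⟩ := Arith.exists_add_of_lt h
    have := add_lt _ _ (a * b) (Arith.mul_pos ha ((Arith.zero_or_pos d).elim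
      (fun e => e ▸ Arith.lt_succ_self _) fun h => h.trans (Arith.lt_succ_self _)))
    rwa [_root_.zero_add, ← _root_.mul_add, _root_.add_comm] at this
  have zlo : (0 : 𝔐.Num) < 1 := by simpa using Arith.lt_succ_self (0 : 𝔐.Num)
  exact
  { add_le_add_left := fun a b h c => by
      rcases h with h | rfl
      · exact (add_lt a b c h).le
      · exact le_rfl
    le_of_add_le_add_left := fun a b c h => by
      by_contra hc
      have := add_lt _ _ a (not_le.1 hc)
      rw [_root_.add_comm c, _root_.add_comm b] at this
      exact (this.trans_le h).false
    zero_le_one := zlo.le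
    exists_pair_ne := ⟨0, 1, zlo.ne⟩
    mul_lt_mul_of_pos_left := fun a ha b c h => mul_lt a b c ha h
    mul_lt_mul_of_pos_right := fun a ha b c h => by
      have := mul_lt a b c ha h
      rwa [_root_.mul_comm a, _root_.mul_comm a] at this }

instance instCanonicallyOrderedAdd : CanonicallyOrderedAdd 𝔐.Num where
  exists_add_of_le {a b} h := by
    rcases h with h | rfl
    · exact (Arith.exists_add_of_lt h).imp' (· + 1) fun _ h => h
    · exact ⟨0, (_root_.add_zero a).symm⟩
  le_self_add a b := le_add_of_nonneg_right ((Arith.zero_or_pos b).elim Or.inr Or.inl)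
  le_add_self a b := le_add_of_nonneg_left ((Arith.zero_or_pos b).elim Or.inr Or.inl)

end arithmetic

set_option synthInstance.maxSize 4096
set_option synthInstance.maxHeartbeats 200000
set_option linter.unusedSectionVars false

/-! ### `Σ⁰₁` and `Δ⁰₁` predicates, and functions with a `Δ⁰₁` graph -/

/-- `P` is definable by a `Σ⁰₁` formula. -/
class Sigma1 {n : ℕ} (P : (Fin n → 𝔐.Num) → Prop) : Prop where
  out : ∃ Q : 𝔐.Num → (Fin n → 𝔐.Num) → Prop,
    Sigma0 (fun w : Fin (n + 1) → 𝔐.Num => Q (w 0) fun i => w i.succ) ∧ ∀ v, P v ↔ ∃ y, Q y v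

/-- `P` and its complement are definable by `Σ⁰₁` formulas. -/
class Delta1 {n : ℕ} (P : (Fin n → 𝔐.Num) → Prop) : Prop where
  sigma1 : Sigma1 P
  sigma1_not : Sigma1 (fun v => ¬ P v)

/-- The graph of `f` is definable by a `Σ⁰₁` formula. -/
class Delta1Fun {n : ℕ} (f : (Fin n → 𝔐.Num) → 𝔐.Num) : Prop where
  out : Sigma1 (fun w : Fin (n + 1) → 𝔐.Num => w 0 = f fun i => w i.succ)

variable {n m : ℕ}

theorem Sigma1.congr {P Q : (Fin n → 𝔐.Num) → Prop} (hP : Sigma1 P) (h : ∀ v, P v ↔ Q v) :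
    Sigma1 Q := by
  rwa [show Q = P from funext fun v => propext (h v).symm]

theorem Delta1.congr {P Q : (Fin n → 𝔐.Num) → Prop} (hP : Delta1 P) (h : ∀ v, P v ↔ Q v) :
    Delta1 Q := by
  rwa [show Q = P from funext fun v => propext (h v).symm]

theorem Sigma1.of_sigma0 {P : (Fin n → 𝔐.Num) → Prop} (hP : Sigma0 P) : Sigma1 P :=
  ⟨fun _ v => P v, Sigma0.subst hP (fun i w => w i.succ) fun _ => TermFun.var _,
    fun _ => ⟨fun h => ⟨0, h⟩, fun ⟨_, h⟩ => h⟩⟩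

theorem Delta1.of_sigma0 {P : (Fin n → 𝔐.Num) → Prop} (hP : Sigma0 P) : Delta1 P :=
  ⟨.of_sigma0 hP, .of_sigma0 inferInstance⟩

theorem Sigma1.subst {P : (Fin n → 𝔐.Num) → Prop} (hP : Sigma1 P)
    (t : Fin n → (Fin m → 𝔐.Num) → 𝔐.Num) (ht : ∀ i, TermFun (t i)) :
    Sigma1 (fun v => P fun i => t i v) := by
  obtain ⟨Q, hQ, h⟩ := hP.out
  exact ⟨fun y v => Q y fun i => t i v, Sigma0.subst_cons hQ _ _ (TermFun.var 0)
    fun i => TermFun.subst (ht i) _ fun _ => TermFun.var _, fun v => h _⟩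

theorem Sigma1.subst_cons {P : 𝔐.Num → (Fin n → 𝔐.Num) → Prop}
    (hP : Sigma1 (fun w : Fin (n + 1) → 𝔐.Num => P (w 0) fun i => w i.succ))
    (f : (Fin m → 𝔐.Num) → 𝔐.Num) (g : Fin n → (Fin m → 𝔐.Num) → 𝔐.Num)
    (hf : TermFun f) (hg : ∀ i, TermFun (g i)) :
    Sigma1 (fun v => P (f v) fun i => g i v) := by
  refine Sigma1.subst hP (Fin.cases f g) fun i => ?_
  refine Fin.cases ?_ (fun j => ?_) i
  · exact hf
  · exact hg j

theorem Delta1Fun.subst {f : (Fin n → 𝔐.Num) → 𝔐.Num} (hf : Delta1Fun f)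
    (t : Fin n → (Fin m → 𝔐.Num) → 𝔐.Num) (ht : ∀ i, TermFun (t i)) :
    Delta1Fun (fun v => f fun i => t i v) :=
  ⟨Sigma1.subst_cons (P := fun y v => y = f v) hf.out (fun w => w 0)
    (fun i w => t i fun j => w j.succ) (TermFun.var _)
    fun i => TermFun.subst (ht i) _ fun _ => TermFun.var _⟩

theorem Delta1Fun.succ {f : (Fin n → 𝔐.Num) → 𝔐.Num} (hf : Delta1Fun f) :
    Delta1Fun (fun w : Fin (n + 1) → 𝔐.Num => f fun i => w i.succ) :=
  hf.subst (fun i w => w i.succ) fun _ => TermFun.var _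

theorem Delta1Fun.of_termFun {f : (Fin n → 𝔐.Num) → 𝔐.Num} (hf : TermFun f) : Delta1Fun f :=
  ⟨have := TermFun.subst hf (fun i (w : Fin (n + 1) → 𝔐.Num) => w i.succ) fun _ => TermFun.var _
  .of_sigma0 inferInstance⟩

instance Delta1Fun.var (i : Fin n) : Delta1Fun (fun v : Fin n → 𝔐.Num => v i) :=
  .of_termFun inferInstance

instance Delta1Fun.const (a : 𝔐.Num) : Delta1Fun (fun _ : Fin n → 𝔐.Num => a) :=
  .of_termFun inferInstance

theorem Delta1.subst {l : ℕ} {P : (Fin n → 𝔐.Num) → Prop} (hP : Delta1 P)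
    (t : Fin n → (Fin l → 𝔐.Num) → 𝔐.Num) (ht : ∀ i, TermFun (t i)) :
    Delta1 (fun v => P fun i => t i v) :=
  ⟨hP.sigma1.subst t ht, Sigma1.subst (P := fun v => ¬ P v) hP.sigma1_not t ht⟩

section closure

variable [h𝔐 : Fact 𝔐.IsModelRCA0]

instance Sigma1.and (P Q : (Fin n → 𝔐.Num) → Prop) [hP : Sigma1 P] [hQ : Sigma1 Q] :
    Sigma1 (fun v => P v ∧ Q v) := by
  obtain ⟨P', hP', hP⟩ := hP.out
  obtain ⟨Q', hQ', hQ⟩ := hQ.out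
  -- Closure under substitution is put in the context as a local instance, so that instance search
  -- can treat `P'` and `Q'` like atomic formulas. The same device recurs for every locally given
  -- predicate or function below.
  have h1 : ∀ {k : ℕ} (f : (Fin k → 𝔐.Num) → 𝔐.Num) (g : Fin n → (Fin k → 𝔐.Num) → 𝔐.Num)
    [TermFun f] [∀ i, TermFun (g i)], Sigma0 (fun v => P' (f v) fun i => g i v) :=
    fun f g _ _ => Sigma0.subst_cons hP' f g inferInstance inferInstance
  have h2 : ∀ {k : ℕ} (f : (Fin k → 𝔐.Num) → 𝔐.Num) (g : Fin n → (Fin k → 𝔐.Num) → 𝔐.Num)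
    [TermFun f] [∀ i, TermFun (g i)], Sigma0 (fun v => Q' (f v) fun i => g i v) :=
    fun f g _ _ => Sigma0.subst_cons hQ' f g inferInstance inferInstance
  -- A single `w` bounding both witnesses merges the two unbounded quantifiers without any pairing.
  refine ⟨fun w v => (∃ y, y < w ∧ P' y v) ∧ ∃ y, y < w ∧ Q' y v, inferInstance, fun v => ?_⟩
  rw [hP, hQ]
  constructor
  · rintro ⟨⟨a, ha⟩, b, hb⟩
    exact ⟨a + b + 1, ⟨a, lt_add_one_iff'.2 le_self_add, ha⟩,
      b, lt_add_one_iff'.2 le_add_self, hb⟩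
  · rintro ⟨w, ⟨a, -, ha⟩, b, -, hb⟩
    exact ⟨⟨a, ha⟩, b, hb⟩

instance Sigma1.ex (P : 𝔐.Num → (Fin n → 𝔐.Num) → Prop)
    [hP : Sigma1 (fun w : Fin (n + 1) → 𝔐.Num => P (w 0) fun i => w i.succ)] :
    Sigma1 (fun v => ∃ a, P a v) := by
  obtain ⟨Q, hQ, h⟩ := hP.out
  have h1 : ∀ {k : ℕ} (f : (Fin k → 𝔐.Num) → 𝔐.Num)
    (g : Fin (n + 1) → (Fin k → 𝔐.Num) → 𝔐.Num)
    [TermFun f] [∀ i, TermFun (g i)], Sigma0 (fun v => Q (f v) fun i => g i v) :=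
    fun f g _ _ => Sigma0.subst_cons hQ f g inferInstance inferInstance
  have h2 : ∀ {k : ℕ} (f f' : (Fin k → 𝔐.Num) → 𝔐.Num)
    (g : Fin n → (Fin k → 𝔐.Num) → 𝔐.Num) [TermFun f] [TermFun f'] [∀ i, TermFun (g i)],
    Sigma0 (fun v => Q (f v) (Fin.cons (f' v) fun i => g i v)) := by
    intro k f f' g _ _ hg
    have := fun i : Fin (n + 1) => (Fin.cases (motive := fun i =>
      TermFun ((Fin.cons f' g : Fin (n + 1) → (Fin k → 𝔐.Num) → 𝔐.Num) i)) ‹_› hg i)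
    refine (h1 f (Fin.cons f' g)).congr fun v => ?_
    rw [show (fun i => (Fin.cons f' g : Fin (n + 1) → (Fin k → 𝔐.Num) → 𝔐.Num) i v) =
      Fin.cons (f' v) fun i => g i v from funext (Fin.cases rfl fun _ => rfl)]
  refine ⟨fun u v => ∃ a, a < u ∧ ∃ y, y < u ∧ Q y (Fin.cons a v), inferInstance, fun v => ?_⟩
  have h' : ∀ a, P a v ↔ ∃ y, Q y (Fin.cons a v) := fun a => h (Fin.cons a v)
  simp only [h']
  constructor
  · rintro ⟨a, b, hb⟩
    exact ⟨a + b + 1, a, lt_add_one_iff'.2 le_self_add, b, lt_add_one_iff'.2 le_add_self, hb⟩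
  · rintro ⟨w, a, -, b, -, hb⟩
    exact ⟨a, b, hb⟩

instance Sigma1.or (P Q : (Fin n → 𝔐.Num) → Prop) [hP : Sigma1 P] [hQ : Sigma1 Q] :
    Sigma1 (fun v => P v ∨ Q v) := by
  obtain ⟨P', hP', hP⟩ := hP.out
  obtain ⟨Q', hQ', hQ⟩ := hQ.out
  refine ⟨fun w v => P' w v ∨ Q' w v, inferInstance, fun v => ?_⟩
  rw [hP, hQ, exists_or]

/-- Since `f` is total with a `Σ⁰₁` graph, its value can be introduced by an existential quantifier.
Applied to `P` and to its negation, this makes `Δ⁰₁` closed under substitution of such functions. -/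
theorem Sigma1.comp {P : 𝔐.Num → (Fin n → 𝔐.Num) → Prop}
    (hP : Sigma1 (fun w : Fin (n + 1) → 𝔐.Num => P (w 0) fun i => w i.succ))
    (f : (Fin n → 𝔐.Num) → 𝔐.Num) [hf : Delta1Fun f] : Sigma1 (fun v => P (f v) v) := by
  have := hf.out
  exact Sigma1.congr (P := fun v => ∃ y, y = f v ∧ P y v) inferInstance fun v => by simp

theorem sigma1_induction {P : 𝔐.Num → Prop} [hP : Sigma1 (fun v : Fin 1 → 𝔐.Num => P (v 0))]
    (h0 : P 0) (hs : ∀ x, P x → P (x + 1)) (x : 𝔐.Num) : P x := by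
  obtain ⟨Q, hQ, h⟩ := hP.out
  obtain ⟨φ, hφ⟩ := hQ.out
  have key : ∀ x, P x ↔ ∃ y, φ.Sat ![y, x] := fun x => by
    simp only [hφ]
    exact h ![x]
  simp only [key] at h0 hs ⊢
  exact h𝔐.out.sigma1_induction φ h0 hs x

/-- Collection, by `Σ⁰₁` induction on the length `c` of the initial segment already bounded. The
clause `a < b` makes the induction step trivial once `c` has passed `b`. -/
theorem Sigma0.exists_bound {Q : 𝔐.Num → 𝔐.Num → Prop}
    (hQ : Sigma0 (fun v : Fin 2 → 𝔐.Num => Q (v 0) (v 1))) (b : 𝔐.Num)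
    (h : ∀ a, a < b → ∃ y, Q y a) : ∃ u, ∀ a, a < b → ∃ y, y < u ∧ Q y a := by
  have hQ' : ∀ {k : ℕ} (f g : (Fin k → 𝔐.Num) → 𝔐.Num) [TermFun f] [TermFun g],
      Sigma0 (fun v => Q (f v) (g v)) := fun f g _ _ =>
    Sigma0.subst_cons (n := 1) (Q := fun a v => Q a (v 0)) hQ f (fun _ => g)
      inferInstance inferInstance
  have key : ∀ c, ∃ u, ∀ a, a < c → a < b → ∃ y, y < u ∧ Q y a := by
    refine sigma1_induction (hP := ⟨fun u v => ∀ a, a < v 0 → a < b → ∃ y, y < u ∧ Q y a,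
      inferInstance, fun _ => Iff.rfl⟩) ⟨0, fun a ha => (not_lt_zero ha).elim⟩ ?_
    rintro x ⟨u, hu⟩
    by_cases hx : x < b
    · obtain ⟨y, hy⟩ := h x hx
      refine ⟨u + y + 1, fun a ha hab => ?_⟩
      rcases (lt_add_one_iff'.1 ha).lt_or_eq with ha | rfl
      · obtain ⟨z, hz, h'⟩ := hu a ha hab
        exact ⟨z, hz.trans_le (le_self_add.trans le_self_add), h'⟩
      · exact ⟨y, lt_add_one_iff'.2 le_add_self, hy⟩
    · refine ⟨u, fun a ha hab => hu a ?_ hab⟩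
      have := lt_add_one_iff'.1 ha
      grind
  obtain ⟨u, hu⟩ := key b
  exact ⟨u, fun a ha => hu a ha ha⟩

/-- Collection bounds the witnesses for all `a` below the bound simultaneously, which pulls the
existential quantifier to the front. -/
instance Sigma1.ball (f : (Fin n → 𝔐.Num) → 𝔐.Num) (P : 𝔐.Num → (Fin n → 𝔐.Num) → Prop)
    [hf : Delta1Fun f] [hP : Sigma1 (fun w : Fin (n + 1) → 𝔐.Num => P (w 0) fun i => w i.succ)] :
    Sigma1 (fun v => ∀ a, a < f v → P a v) := by
  refine Sigma1.comp (P := fun b v => ∀ a, a < b → P a v) ?_ f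
  obtain ⟨Q, hQ, h⟩ := hP.out
  have h2 : ∀ {k : ℕ} (f f' : (Fin k → 𝔐.Num) → 𝔐.Num)
    (g : Fin n → (Fin k → 𝔐.Num) → 𝔐.Num) [TermFun f] [TermFun f'] [∀ i, TermFun (g i)],
    Sigma0 (fun v => Q (f v) (Fin.cons (f' v) fun i => g i v)) := by
    intro k f f' g _ _ hg
    have := fun i : Fin (n + 1) => (Fin.cases (motive := fun i =>
      TermFun ((Fin.cons f' g : Fin (n + 1) → (Fin k → 𝔐.Num) → 𝔐.Num) i)) ‹_› hg i)
    refine (Sigma0.subst_cons hQ f (Fin.cons f' g) inferInstance inferInstance).congr fun v => ?_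
    rw [show (fun i => (Fin.cons f' g : Fin (n + 1) → (Fin k → 𝔐.Num) → 𝔐.Num) i v) =
      Fin.cons (f' v) fun i => g i v from funext (Fin.cases rfl fun _ => rfl)]
  refine ⟨fun u w => ∀ a, a < w 0 → ∃ y, y < u ∧ Q y (Fin.cons a fun i => w i.succ),
    inferInstance, fun w => ?_⟩
  have h' : ∀ a, P a (fun i => w i.succ) ↔ ∃ y, Q y (Fin.cons a fun i => w i.succ) :=
    fun a => h (Fin.cons a fun i => w i.succ)
  simp only [h']
  constructor
  · exact Sigma0.exists_bound (Q := fun y a => Q y (Fin.cons a fun i => w i.succ)) inferInstance _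
  · exact fun ⟨u, hu⟩ a ha => (hu a ha).imp fun y hy => hy.2

theorem Sigma1.comp₁ {R : 𝔐.Num → Prop} (hR : Sigma1 (fun v : Fin 1 → 𝔐.Num => R (v 0)))
    (f : (Fin n → 𝔐.Num) → 𝔐.Num) [Delta1Fun f] : Sigma1 (fun v => R (f v)) :=
  Sigma1.comp (P := fun x _ => R x) (Sigma1.subst hR (fun _ v => v 0) fun _ => TermFun.var _) f

theorem Sigma1.comp₂ {R : 𝔐.Num → 𝔐.Num → Prop}
    (hR : Sigma1 (fun v : Fin 2 → 𝔐.Num => R (v 0) (v 1)))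
    (f g : (Fin n → 𝔐.Num) → 𝔐.Num) [Delta1Fun f] [hg : Delta1Fun g] :
    Sigma1 (fun v => R (f v) (g v)) := by
  refine Sigma1.comp (P := fun x v => R x (g v)) ?_ f
  have := hg.succ
  refine Sigma1.comp (P := fun y w => R (w 0) y) ?_ _
  exact Sigma1.subst hR ![fun w => w 1, fun w => w 0]
    fun i => by fin_cases i <;> exact TermFun.var _

theorem Sigma1.comp₃ {R : 𝔐.Num → 𝔐.Num → 𝔐.Num → Prop}
    (hR : Sigma1 (fun v : Fin 3 → 𝔐.Num => R (v 0) (v 1) (v 2)))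
    (f g h : (Fin n → 𝔐.Num) → 𝔐.Num) [Delta1Fun f] [hg : Delta1Fun g] [hh : Delta1Fun h] :
    Sigma1 (fun v => R (f v) (g v) (h v)) := by
  refine Sigma1.comp (P := fun x v => R x (g v) (h v)) ?_ f
  have := hg.succ
  have := hh.succ.succ
  refine Sigma1.comp (P := fun y w => R (w 0) y (h fun i => w i.succ)) ?_ _
  refine Sigma1.comp (P := fun y w => R (w 1) (w 0) y) ?_ _
  exact Sigma1.subst hR ![fun w => w 2, fun w => w 1, fun w => w 0]
    fun i => by fin_cases i <;> exact TermFun.var _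

theorem Sigma1.comp₄ {R : 𝔐.Num → 𝔐.Num → 𝔐.Num → 𝔐.Num → Prop}
    (hR : Sigma1 (fun v : Fin 4 → 𝔐.Num => R (v 0) (v 1) (v 2) (v 3)))
    (f g h k : (Fin n → 𝔐.Num) → 𝔐.Num) [Delta1Fun f] [hg : Delta1Fun g] [hh : Delta1Fun h]
    [hk : Delta1Fun k] : Sigma1 (fun v => R (f v) (g v) (h v) (k v)) := by
  refine Sigma1.comp (P := fun x v => R x (g v) (h v) (k v)) ?_ f
  have := hg.succ
  have := hh.succ.succ
  have := hk.succ.succ.succ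
  refine Sigma1.comp (P := fun y w => R (w 0) y (h fun i => w i.succ) (k fun i => w i.succ)) ?_ _
  refine Sigma1.comp (P := fun y w => R (w 1) (w 0) y (k fun i => w i.succ.succ)) ?_ _
  refine Sigma1.comp (P := fun y w => R (w 2) (w 1) (w 0) y) ?_ _
  exact Sigma1.subst hR ![fun w => w 3, fun w => w 2, fun w => w 1, fun w => w 0]
    fun i => by fin_cases i <;> exact TermFun.var _

theorem Delta1.comp₁ {R : 𝔐.Num → Prop} (hR : Delta1 (fun v : Fin 1 → 𝔐.Num => R (v 0)))
    (f : (Fin n → 𝔐.Num) → 𝔐.Num) [Delta1Fun f] : Delta1 (fun v => R (f v)) :=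
  ⟨hR.sigma1.comp₁ f, Sigma1.comp₁ (R := fun x => ¬ R x) hR.sigma1_not f⟩

theorem Delta1.comp₂ {R : 𝔐.Num → 𝔐.Num → Prop}
    (hR : Delta1 (fun v : Fin 2 → 𝔐.Num => R (v 0) (v 1)))
    (f g : (Fin n → 𝔐.Num) → 𝔐.Num) [Delta1Fun f] [Delta1Fun g] :
    Delta1 (fun v => R (f v) (g v)) :=
  ⟨hR.sigma1.comp₂ f g, Sigma1.comp₂ (R := fun x y => ¬ R x y) hR.sigma1_not f g⟩

theorem Delta1.comp₃ {R : 𝔐.Num → 𝔐.Num → 𝔐.Num → Prop}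
    (hR : Delta1 (fun v : Fin 3 → 𝔐.Num => R (v 0) (v 1) (v 2)))
    (f g h : (Fin n → 𝔐.Num) → 𝔐.Num) [Delta1Fun f] [Delta1Fun g] [Delta1Fun h] :
    Delta1 (fun v => R (f v) (g v) (h v)) :=
  ⟨hR.sigma1.comp₃ f g h, Sigma1.comp₃ (R := fun x y z => ¬ R x y z) hR.sigma1_not f g h⟩

theorem Delta1.comp₄ {R : 𝔐.Num → 𝔐.Num → 𝔐.Num → 𝔐.Num → Prop}
    (hR : Delta1 (fun v : Fin 4 → 𝔐.Num => R (v 0) (v 1) (v 2) (v 3)))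
    (f g h k : (Fin n → 𝔐.Num) → 𝔐.Num) [Delta1Fun f] [Delta1Fun g] [Delta1Fun h]
    [Delta1Fun k] : Delta1 (fun v => R (f v) (g v) (h v) (k v)) :=
  ⟨hR.sigma1.comp₄ f g h k,
    Sigma1.comp₄ (R := fun x y z w => ¬ R x y z w) hR.sigma1_not f g h k⟩

theorem Delta1Fun.comp₁ {F : 𝔐.Num → 𝔐.Num}
    (hF : Delta1Fun (fun v : Fin 1 → 𝔐.Num => F (v 0)))
    (f : (Fin n → 𝔐.Num) → 𝔐.Num) [hf : Delta1Fun f] : Delta1Fun (fun v => F (f v)) :=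
  ⟨have := hf.succ
  Sigma1.comp₂ (R := fun y x => y = F x) hF.out _ _⟩

theorem Delta1Fun.comp₂ {F : 𝔐.Num → 𝔐.Num → 𝔐.Num}
    (hF : Delta1Fun (fun v : Fin 2 → 𝔐.Num => F (v 0) (v 1)))
    (f g : (Fin n → 𝔐.Num) → 𝔐.Num) [hf : Delta1Fun f] [hg : Delta1Fun g] :
    Delta1Fun (fun v => F (f v) (g v)) :=
  ⟨have := hf.succ
  have := hg.succ
  Sigma1.comp₃ (R := fun z x y => z = F x y) hF.out _ _ _⟩

theorem Delta1Fun.comp₃ {F : 𝔐.Num → 𝔐.Num → 𝔐.Num → 𝔐.Num}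
    (hF : Delta1Fun (fun v : Fin 3 → 𝔐.Num => F (v 0) (v 1) (v 2)))
    (f g h : (Fin n → 𝔐.Num) → 𝔐.Num) [hf : Delta1Fun f] [hg : Delta1Fun g] [hh : Delta1Fun h] :
    Delta1Fun (fun v => F (f v) (g v) (h v)) :=
  ⟨have := hf.succ
  have := hg.succ
  have := hh.succ
  Sigma1.comp₄ (R := fun w x y z => w = F x y z) hF.out _ _ _ _⟩

instance Delta1Fun.add (f g : (Fin n → 𝔐.Num) → 𝔐.Num) [Delta1Fun f] [Delta1Fun g] :
    Delta1Fun (fun v => f v + g v) :=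
  Delta1Fun.comp₂ (F := fun x y => x + y) (.of_termFun inferInstance) f g

instance Delta1Fun.mul (f g : (Fin n → 𝔐.Num) → 𝔐.Num) [Delta1Fun f] [Delta1Fun g] :
    Delta1Fun (fun v => f v * g v) :=
  Delta1Fun.comp₂ (F := fun x y => x * y) (.of_termFun inferInstance) f g

instance Delta1Fun.pair (f g : (Fin n → 𝔐.Num) → 𝔐.Num) [Delta1Fun f] [Delta1Fun g] :
    Delta1Fun (fun v => pair (f v) (g v)) := by
  unfold L2Structure.pair
  infer_instance

instance Delta1.eq (f g : (Fin n → 𝔐.Num) → 𝔐.Num) [Delta1Fun f] [Delta1Fun g] :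
    Delta1 (fun v => f v = g v) :=
  Delta1.comp₂ (R := fun x y => x = y) (.of_sigma0 inferInstance) f g

instance Delta1.lt (f g : (Fin n → 𝔐.Num) → 𝔐.Num) [Delta1Fun f] [Delta1Fun g] :
    Delta1 (fun v => f v < g v) :=
  Delta1.comp₂ (R := fun x y => x < y) (.of_sigma0 inferInstance) f g

instance Delta1.mem (f : (Fin n → 𝔐.Num) → 𝔐.Num) (X : Set 𝔐.Num) [hX : Fact (X ∈ 𝔐.sets)]
    [Delta1Fun f] : Delta1 (fun v => f v ∈ X) :=
  Delta1.comp₁ (R := fun x => x ∈ X) (.of_sigma0 (.mem _ hX.out)) f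

/-- Truth in the metatheory decides `p`, so a proposition without free variables is replaced by `0 =
0` or by its negation, whatever its quantifier complexity. -/
instance Delta1.const (p : Prop) : Delta1 (fun _ : Fin n → 𝔐.Num => p) := by
  by_cases h : p
  · exact .of_sigma0 (Sigma0.congr (P := fun _ => (0 : 𝔐.Num) = 0) inferInstance fun _ => by simp [h])
  · exact .of_sigma0 (Sigma0.congr (P := fun _ => ¬ (0 : 𝔐.Num) = 0) inferInstance
      fun _ => by simp [h])

instance Delta1.not (P : (Fin n → 𝔐.Num) → Prop) [hP : Delta1 P] : Delta1 (fun v => ¬ P v) :=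
  ⟨hP.sigma1_not, by simpa only [not_not] using hP.sigma1⟩

instance Delta1.and (P Q : (Fin n → 𝔐.Num) → Prop) [hP : Delta1 P] [hQ : Delta1 Q] :
    Delta1 (fun v => P v ∧ Q v) := by
  have := hP.sigma1
  have := hQ.sigma1
  have := hP.sigma1_not
  have := hQ.sigma1_not
  exact ⟨inferInstance, Sigma1.congr (P := fun v => ¬ P v ∨ ¬ Q v) inferInstance
    fun v => not_and_or.symm⟩

instance Delta1.or (P Q : (Fin n → 𝔐.Num) → Prop) [Delta1 P] [Delta1 Q] :
    Delta1 (fun v => P v ∨ Q v) :=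
  Delta1.congr (P := fun v => ¬ (¬ P v ∧ ¬ Q v)) inferInstance fun v => by tauto

instance Delta1.imp (P Q : (Fin n → 𝔐.Num) → Prop) [Delta1 P] [Delta1 Q] :
    Delta1 (fun v => P v → Q v) :=
  Delta1.congr (P := fun v => ¬ P v ∨ Q v) inferInstance fun v => by tauto

instance Delta1.iff (P Q : (Fin n → 𝔐.Num) → Prop) [Delta1 P] [Delta1 Q] :
    Delta1 (fun v => P v ↔ Q v) :=
  Delta1.congr (P := fun v => (P v → Q v) ∧ (Q v → P v)) inferInstance fun v => by tauto

instance (priority := 900) Sigma1.of_delta1 (P : (Fin n → 𝔐.Num) → Prop) [hP : Delta1 P] :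
    Sigma1 P := hP.sigma1

instance Sigma1.imp (P Q : (Fin n → 𝔐.Num) → Prop) [Delta1 P] [Sigma1 Q] :
    Sigma1 (fun v => P v → Q v) :=
  Sigma1.congr (P := fun v => ¬ P v ∨ Q v) inferInstance fun v => by tauto

instance Sigma1.ball_le (f : (Fin n → 𝔐.Num) → 𝔐.Num) (P : 𝔐.Num → (Fin n → 𝔐.Num) → Prop)
    [Delta1Fun f] [Sigma1 (fun w : Fin (n + 1) → 𝔐.Num => P (w 0) fun i => w i.succ)] :
    Sigma1 (fun v => ∀ a, a ≤ f v → P a v) :=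
  Sigma1.congr (P := fun v => ∀ a, a < f v + 1 → P a v) inferInstance
    fun v => by simp only [lt_add_one_iff']

instance Delta1.ball (f : (Fin n → 𝔐.Num) → 𝔐.Num) (P : 𝔐.Num → (Fin n → 𝔐.Num) → Prop)
    [hf : Delta1Fun f] [hP : Delta1 (fun w : Fin (n + 1) → 𝔐.Num => P (w 0) fun i => w i.succ)] :
    Delta1 (fun v => ∀ a, a < f v → P a v) := by
  have := hf.succ
  have := hP.sigma1_not
  refine ⟨inferInstance, Sigma1.congr (P := fun v => ∃ a, a < f v ∧ ¬ P a v) ?_ fun v => ?_⟩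
  · infer_instance
  · simp

instance Delta1.bex (f : (Fin n → 𝔐.Num) → 𝔐.Num) (P : 𝔐.Num → (Fin n → 𝔐.Num) → Prop)
    [Delta1Fun f] [Delta1 (fun w : Fin (n + 1) → 𝔐.Num => P (w 0) fun i => w i.succ)] :
    Delta1 (fun v => ∃ a, a < f v ∧ P a v) :=
  Delta1.congr (P := fun v => ¬ ∀ a, a < f v → ¬ P a v) inferInstance fun v => by simp

instance Delta1.ball_le (f : (Fin n → 𝔐.Num) → 𝔐.Num) (P : 𝔐.Num → (Fin n → 𝔐.Num) → Prop)
    [Delta1Fun f] [Delta1 (fun w : Fin (n + 1) → 𝔐.Num => P (w 0) fun i => w i.succ)] :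
    Delta1 (fun v => ∀ a, a ≤ f v → P a v) :=
  Delta1.congr (P := fun v => ∀ a, a < f v + 1 → P a v) inferInstance
    fun v => by simp only [lt_add_one_iff']

instance Delta1.bex_le (f : (Fin n → 𝔐.Num) → 𝔐.Num) (P : 𝔐.Num → (Fin n → 𝔐.Num) → Prop)
    [Delta1Fun f] [Delta1 (fun w : Fin (n + 1) → 𝔐.Num => P (w 0) fun i => w i.succ)] :
    Delta1 (fun v => ∃ a, a ≤ f v ∧ P a v) :=
  Delta1.congr (P := fun v => ∃ a, a < f v + 1 ∧ P a v) inferInstance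
    fun v => by simp only [lt_add_one_iff']

end closure

/-! ### Comprehension, least elements and uniformization. -/

section principles

variable [h𝔐 : Fact 𝔐.IsModelRCA0]

theorem mem_sets_of_delta1 {P : 𝔐.Num → Prop} (hP : Delta1 (fun v : Fin 1 → 𝔐.Num => P (v 0))) :
    {x | P x} ∈ 𝔐.sets := by
  obtain ⟨Q, hQ, h⟩ := hP.sigma1.out
  obtain ⟨φ, hφ⟩ := hQ.out
  obtain ⟨Q', hQ', h'⟩ := hP.sigma1_not.out
  obtain ⟨φ', hφ'⟩ := hQ'.out
  have key : ∀ x, P x ↔ ∃ y, φ.Sat ![y, x] := fun x => by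
    simp only [hφ]
    exact h ![x]
  have key' : ∀ x, ¬ P x ↔ ∃ y, φ'.Sat ![y, x] := fun x => by
    simp only [hφ']
    exact h' ![x]
  obtain ⟨X, hX, hXP⟩ := h𝔐.out.delta1_comprehension φ (.not φ') fun x => by
    rw [← key, ← not_iff_not, key']
    simp [BoundedFormula.Sat]
  rwa [show {x | P x} = X from Set.ext fun x => by rw [hXP, ← key]; rfl]

/-- If there were no least element, then `Σ⁰₁` induction on `x` would show that nothing below `x`
satisfies `P`; this predicate is `Σ⁰₁` because `¬ P` is. -/
theorem exists_least {P : 𝔐.Num → Prop} (hP : Sigma1 (fun v : Fin 1 → 𝔐.Num => ¬ P (v 0)))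
    (h : ∃ x, P x) : ∃ x, P x ∧ ∀ y, y < x → ¬ P y := by
  by_contra! hc
  obtain ⟨x, hx⟩ := h
  have hP' : ∀ {k : ℕ} (f : (Fin k → 𝔐.Num) → 𝔐.Num) [Delta1Fun f],
      Sigma1 (fun v => ¬ P (f v)) := fun f _ => Sigma1.comp₁ (R := fun x => ¬ P x) hP f
  have key : ∀ x, ∀ y, y < x → ¬ P y := by
    refine sigma1_induction (fun y hy => (not_lt_zero hy).elim) fun x ih y hy hPy => ?_
    rcases (lt_add_one_iff'.1 hy).lt_or_eq with hy | rfl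
    · exact ih y hy hPy
    · obtain ⟨z, hz, hPz⟩ := hc y hPy
      exact ih z hz hPz
  exact key (x + 1) x (lt_add_one_iff'.2 le_rfl) hx

/-- `Σ⁰₁` uniformization. -/
theorem exists_delta1Fun {R : 𝔐.Num → (Fin n → 𝔐.Num) → Prop}
    (hR : Sigma1 (fun w : Fin (n + 1) → 𝔐.Num => R (w 0) fun i => w i.succ))
    (h : ∀ v, ∃ y, R y v) :
    ∃ F : (Fin n → 𝔐.Num) → 𝔐.Num, Delta1Fun F ∧ ∀ v, R (F v) v := by
  obtain ⟨Q, hQ, hRQ⟩ := hR.out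
  have h2 : ∀ {k : ℕ} (f f' : (Fin k → 𝔐.Num) → 𝔐.Num)
    (g : Fin n → (Fin k → 𝔐.Num) → 𝔐.Num) [TermFun f] [TermFun f'] [∀ i, TermFun (g i)],
    Sigma0 (fun v => Q (f v) (Fin.cons (f' v) fun i => g i v)) := by
    intro k f f' g _ _ hg
    have := fun i : Fin (n + 1) => (Fin.cases (motive := fun i =>
      TermFun ((Fin.cons f' g : Fin (n + 1) → (Fin k → 𝔐.Num) → 𝔐.Num) i)) ‹_› hg i)
    refine (Sigma0.subst_cons hQ f (Fin.cons f' g) inferInstance inferInstance).congr fun v => ?_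
    rw [show (fun i => (Fin.cons f' g : Fin (n + 1) → (Fin k → 𝔐.Num) → 𝔐.Num) i v) =
      Fin.cons (f' v) fun i => g i v from funext (Fin.cases rfl fun _ => rfl)]
  have hRQ' : ∀ y v, R y v ↔ ∃ z, Q z (Fin.cons y v) := fun y v => hRQ (Fin.cons y v)
  -- Two minimizations make the choice unique: `u` is the least bound below which some value and its
  -- witness both lie, and `y` is the least value with a witness below `u`. All quantifiers in `S`
  -- are bounded, so `∃ u, S u v y` is a `Σ⁰₁` definition of the graph.
  let S : 𝔐.Num → (Fin n → 𝔐.Num) → 𝔐.Num → Prop := fun u v y =>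
    (∃ y, y < u ∧ ∃ z, z < u ∧ Q z (Fin.cons y v)) ∧
    (∀ u', u' < u → ¬ ∃ y, y < u' ∧ ∃ z, z < u' ∧ Q z (Fin.cons y v)) ∧
    (∃ z, z < u ∧ Q z (Fin.cons y v)) ∧ ∀ y', y' < y → ¬ ∃ z, z < u ∧ Q z (Fin.cons y' v)
  have hS : ∀ v, ∃ y, ∃ u, S u v y := by
    intro v
    obtain ⟨u, hu, hul⟩ := exists_least (P := fun u => ∃ y, y < u ∧ ∃ z, z < u ∧ Q z (Fin.cons y v))
      (.of_sigma0 inferInstance) (by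
        obtain ⟨y, hy⟩ := h v
        obtain ⟨z, hz⟩ := (hRQ' y v).1 hy
        exact ⟨y + z + 1, y, lt_add_one_iff'.2 le_self_add, z, lt_add_one_iff'.2 le_add_self, hz⟩)
    obtain ⟨y, hy, hyl⟩ := exists_least (P := fun y => ∃ z, z < u ∧ Q z (Fin.cons y v))
      (.of_sigma0 inferInstance) (hu.imp fun _ h => h.2)
    exact ⟨y, u, hu, hul, hy, hyl⟩
  have huniq : ∀ v y y' u u', S u v y → S u' v y' → y = y' := by
    rintro v y y' u u' ⟨h1, h2, h3, h4⟩ ⟨h1', h2', h3', h4'⟩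
    obtain rfl : u = u' := le_antisymm (not_lt.1 fun h => h2 _ h h1') (not_lt.1 fun h => h2' _ h h1)
    exact le_antisymm (not_lt.1 fun h => h4 _ h h3') (not_lt.1 fun h => h4' _ h h3)
  choose F u hF using hS
  refine ⟨F, ⟨Sigma1.congr (P := fun w => ∃ u, S u (fun i => w i.succ) (w 0)) ?_ fun w => ?_⟩,
    fun v => (hRQ' _ _).2 ((hF v).2.2.1.imp fun _ h => h.2)⟩
  · exact Sigma1.ex (fun u w => S u (fun i => w i.succ) (w 0)) (hP := .of_sigma0 inferInstance)
  · constructor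
    · rintro ⟨u', hu'⟩
      exact huniq _ _ _ _ _ hu' (hF _)
    · intro h
      exact ⟨u _, by rw [h]; exact hF _⟩

end principles

/-! ### Pairs, divisibility and codes of finite sets -/

section coding

variable [h𝔐 : Fact 𝔐.IsModelRCA0] {n : ℕ}

theorem le_mul_self' (x : 𝔐.Num) : x ≤ x * x := by
  rcases eq_zero_or_pos x with rfl | h
  · simp
  · exact le_mul_of_one_le_left (zero_le) (by simpa using add_one_le_iff'.2 h)

theorem le_pair_left (a b : 𝔐.Num) : a ≤ pair a b := le_add_self

theorem le_pair_right (a b : 𝔐.Num) : b ≤ pair a b :=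
  le_add_self.trans ((le_mul_self' (a + b)).trans le_self_add)

theorem pair_le_pair {a b c d : 𝔐.Num} (h : a ≤ c) (h' : b ≤ d) : pair a b ≤ pair c d := by
  unfold pair
  gcongr

/-- With `s = a + b`, the code lies between `s * s` and `(s + 1) * (s + 1)`, the upper end excluded,
and hence determines `s`. -/
theorem add_eq_of_pair_eq {a b c d : 𝔐.Num} (h : pair a b = pair c d) : a + b = c + d := by
  have key : ∀ a b c d : 𝔐.Num, a + b < c + d → pair a b < pair c d := by
    intro a b c d h
    have h1 : a + b + 1 ≤ c + d := add_one_le_iff'.2 h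
    unfold pair
    calc (a + b) * (a + b) + a ≤ (a + b) * (a + b) + (a + b) := by
          gcongr; exact (le_self_add : a ≤ a + b)
      _ < (a + b) * (a + b) + (a + b) + (a + b + 1) :=
        lt_add_of_pos_right _ (lt_add_one_iff'.2 zero_le)
      _ = (a + b + 1) * (a + b + 1) := by ring
      _ ≤ (c + d) * (c + d) := by gcongr
      _ ≤ _ := le_self_add
  rcases lt_trichotomy (a + b) (c + d) with h' | h' | h'
  · exact absurd h (key _ _ _ _ h').ne
  · exact h'
  · exact absurd h (key _ _ _ _ h').ne'

@[simp]
theorem pair_inj {a b c d : 𝔐.Num} : pair a b = pair c d ↔ a = c ∧ b = d := by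
  refine ⟨fun h => ?_, fun ⟨h, h'⟩ => h ▸ h' ▸ rfl⟩
  have hs := add_eq_of_pair_eq h
  unfold pair at h
  rw [hs] at h
  obtain rfl := add_left_cancel h
  exact ⟨rfl, add_left_cancel hs⟩

theorem dvd_of_dvd_add {p a b : 𝔐.Num} (h : p ∣ a + b) (ha : p ∣ a) : p ∣ b := by
  obtain ⟨x, hx⟩ := h
  obtain ⟨y, rfl⟩ := ha
  rcases le_total y x with hxy | hxy
  · obtain ⟨z, rfl⟩ := exists_add_of_le hxy
    rw [mul_add] at hx
    exact ⟨z, add_left_cancel hx⟩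
  · obtain ⟨z, rfl⟩ := exists_add_of_le hxy
    rw [mul_add, add_assoc, add_eq_left] at hx
    exact ⟨0, by simpa using (add_eq_zero.1 hx).2⟩

/-- Coprimality of the Gödel moduli. Two of them differ by `m * (d + 1)` with `d < k`, so the
modulus `m * (i + 1) + 1` divides `m * (d + 1) * n`, hence `m * m * n` because `d + 1` divides `m`.
As `m * (i + 1)` is `-1` modulo it, both factors `m` cancel. -/
theorem dvd_of_dvd_mul_of_ne {m k i j n : 𝔐.Num} (hm : ∀ i, i < k → i + 1 ∣ m) (hi : i < k)
    (hj : j < k) (hij : i ≠ j) (h : m * (i + 1) + 1 ∣ (m * (j + 1) + 1) * n) :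
    m * (i + 1) + 1 ∣ n := by
  have key : ∀ d, d < k → m * (i + 1) + 1 ∣ m * (d + 1) * n → m * (i + 1) + 1 ∣ n := by
    intro d hd h
    obtain ⟨e, he⟩ := hm d hd
    have h1 : m * (i + 1) + 1 ∣ m * m * n := by
      have := h.mul_left e
      rwa [show e * (m * (d + 1) * n) = m * ((d + 1) * e) * n by ring, ← he] at this
    have h2 : m * (i + 1) + 1 ∣ m * n := by
      refine dvd_of_dvd_add (a := (i + 1) * (m * m * n)) ?_ (h1.mul_left _)
      exact ⟨m * n, by ring⟩
    refine dvd_of_dvd_add (a := (i + 1) * (m * n)) ?_ (h2.mul_left _)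
    exact ⟨n, by ring⟩
  rcases lt_or_gt_of_ne hij with hlt | hlt
  · obtain ⟨d, rfl⟩ := Arith.exists_add_of_lt hlt
    refine key d (lt_of_lt_of_le ?_ (le_of_lt hj)) ?_
    · exact (Arith.lt_succ_self d).trans_le le_add_self
    · refine dvd_of_dvd_add (a := (m * (i + 1) + 1) * n) ?_ (dvd_mul_right _ _)
      exact (show _ = _ by ring : (m * (i + (d + 1) + 1) + 1) * n =
        (m * (i + 1) + 1) * n + m * (d + 1) * n) ▸ h
  · obtain ⟨d, rfl⟩ := Arith.exists_add_of_lt hlt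
    refine key d (lt_of_lt_of_le ?_ (le_of_lt hi)) ?_
    · exact (Arith.lt_succ_self d).trans_le le_add_self
    · refine dvd_of_dvd_add ?_ h
      exact ⟨n, by ring⟩

instance Delta1.dvd (f g : (Fin n → 𝔐.Num) → 𝔐.Num) [Delta1Fun f] [Delta1Fun g] :
    Delta1 (fun v => f v ∣ g v) :=
  Delta1.comp₂ (R := fun x y => x ∣ y)
    (Delta1.congr (P := fun v => ∃ q, q ≤ v 1 ∧ v 1 = v 0 * q) inferInstance fun v => by
      constructor
      · rintro ⟨q, -, h⟩
        exact ⟨q, h⟩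
      · rintro ⟨q, h⟩
        rcases eq_zero_or_pos (v 0) with h0 | h0
        -- For divisor `0` a cofactor need not be bounded by the dividend, so it is replaced by `0`.
        · exact ⟨0, zero_le, by rw [h, h0, zero_mul, zero_mul]⟩
        · refine ⟨q, ?_, h⟩
          rw [h]
          exact le_mul_of_one_le_left zero_le (by simpa using add_one_le_iff'.2 h0)) f g

/-- Stands in for the factorial as the base of the Gödel moduli. -/
theorem exists_common_multiple (k : 𝔐.Num) : ∃ m : 𝔐.Num, 0 < m ∧ ∀ i, i < k → i + 1 ∣ m := by
  refine sigma1_induction (P := fun k => ∃ m : 𝔐.Num, 0 < m ∧ ∀ i, i < k → i + 1 ∣ m)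
    ⟨1, one_pos, fun i hi => (not_lt_zero hi).elim⟩ ?_ k
  rintro k ⟨m, hm, h⟩
  refine ⟨m * (k + 1), mul_pos hm (Arith.zero_or_pos _ |>.elim
    (fun h => absurd h (h𝔐.out.succ_ne_zero k).symm) id), fun i hi => ?_⟩
  rcases (lt_add_one_iff'.1 hi).lt_or_eq with hi | rfl
  · exact (h i hi).mul_right _
  · exact dvd_mul_left _ _

/-- Codes for the `Σ⁰₁` subsets of `{i | i < k}`. -/
theorem exists_dvd_iff (k : 𝔐.Num) : ∃ m B : 𝔐.Num, ∀ X : 𝔐.Num → Prop,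
    Sigma1 (fun v : Fin 1 → 𝔐.Num => X (v 0)) →
    ∃ n, n ≤ B ∧ ∀ i, i < k → (m * (i + 1) + 1 ∣ n ↔ X i) := by
  obtain ⟨m, hm0, hm⟩ := exists_common_multiple k
  have hpos : ∀ x : 𝔐.Num, 0 < x + 1 := fun x => lt_add_one_iff'.2 zero_le
  -- `B` is a common multiple of all moduli. It depends on `k` only and so bounds the codes of all
  -- subsets `X` uniformly.
  obtain ⟨B, hB0, hB⟩ : ∃ B : 𝔐.Num, 0 < B ∧ ∀ i, i < k → m * (i + 1) + 1 ∣ B := by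
    refine sigma1_induction
      (P := fun k => ∃ B : 𝔐.Num, 0 < B ∧ ∀ i, i < k → m * (i + 1) + 1 ∣ B)
      ⟨1, one_pos, fun i hi => (not_lt_zero hi).elim⟩ ?_ k
    rintro k ⟨B, hB, h⟩
    refine ⟨B * (m * (k + 1) + 1), mul_pos hB (hpos _), fun i hi => ?_⟩
    rcases (lt_add_one_iff'.1 hi).lt_or_eq with hi | rfl
    · exact (h i hi).mul_right _
    · exact dvd_mul_left _ _
  refine ⟨m, B, fun X hX => ?_⟩
  have hX' : ∀ {l : ℕ} (f : (Fin l → 𝔐.Num) → 𝔐.Num) [Delta1Fun f],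
      Sigma1 (fun v => X (f v)) := fun f _ => Sigma1.comp₁ hX f
  have hsig : Sigma1 (fun v : Fin 1 → 𝔐.Num =>
    ¬ 0 < v 0 ∨ ∃ i, i < k ∧ X i ∧ ¬ m * (i + 1) + 1 ∣ v 0) := inferInstance
  -- The code is the least positive number divisible by the moduli of the elements of `X`. The
  -- complement of this condition is `Σ⁰₁`, so a least one exists even though `X` is only `Σ⁰₁`.
  obtain ⟨n, ⟨hn0, hn⟩, hmin⟩ := exists_least
    (P := fun n => 0 < n ∧ ∀ i, i < k → X i → m * (i + 1) + 1 ∣ n)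
    (hsig.congr fun v => by rw [not_and_or]; push Not; rfl)
    ⟨B, hB0, fun i hi _ => hB i hi⟩
  refine ⟨n, not_lt.1 fun h => hmin B h ⟨hB0, fun i hi _ => hB i hi⟩, fun i hi => ?_⟩
  refine ⟨fun hd => ?_, hn i hi⟩
  by_contra hXi
  obtain ⟨q, hq⟩ := hd
  have hq0 : 0 < q := (eq_zero_or_pos q).resolve_left fun h => by simp [h, hn0.ne'] at hq
  -- If the modulus of some `i` outside `X` divided `n`, then dividing it out would leave a smaller
  -- number that, by coprimality, is still divisible by all the required moduli.
  refine hmin q ?_ ⟨hq0, fun j hj hXj => ?_⟩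
  · rw [hq, add_mul, one_mul]
    exact lt_add_of_pos_left _ (mul_pos (mul_pos hm0 (hpos i)) hq0)
  · refine dvd_of_dvd_mul_of_ne hm hj hi (fun h => hXi (h ▸ hXj)) (hq ▸ hn j hj hXj)

/-- Bounded `Σ⁰₁` comprehension. -/
theorem mem_sets_of_sigma1 {X : 𝔐.Num → Prop} (hX : Sigma1 (fun v : Fin 1 → 𝔐.Num => X (v 0)))
    (k : 𝔐.Num) : {i | i < k ∧ X i} ∈ 𝔐.sets := by
  obtain ⟨m, B, h⟩ := exists_dvd_iff k
  obtain ⟨n, -, hn⟩ := h X hX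
  rw [show {i | i < k ∧ X i} = {i | i < k ∧ m * (i + 1) + 1 ∣ n} from
    Set.ext fun i => and_congr_right fun hi => (hn i hi).symm]
  exact mem_sets_of_delta1 inferInstance

theorem Sigma1.exists_bound {R : 𝔐.Num → 𝔐.Num → Prop}
    (hR : Sigma1 (fun v : Fin 2 → 𝔐.Num => R (v 0) (v 1))) (b : 𝔐.Num)
    (h : ∀ a, a < b → ∃ y, R y a) : ∃ u, ∀ a, a < b → ∃ y, y < u ∧ R y a := by
  have hR' : ∀ {k : ℕ} (f g : (Fin k → 𝔐.Num) → 𝔐.Num) [Delta1Fun f] [Delta1Fun g],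
      Sigma1 (fun v => R (f v) (g v)) := fun f g _ _ => hR.comp₂ f g
  have key : ∀ c, ∃ u, ∀ a, a < c → a < b → ∃ y, y < u ∧ R y a := by
    refine sigma1_induction ⟨0, fun a ha => (not_lt_zero ha).elim⟩ ?_
    rintro x ⟨u, hu⟩
    by_cases hx : x < b
    · obtain ⟨y, hy⟩ := h x hx
      refine ⟨u + y + 1, fun a ha hab => ?_⟩
      rcases (lt_add_one_iff'.1 ha).lt_or_eq with ha | rfl
      · obtain ⟨z, hz, h'⟩ := hu a ha hab
        exact ⟨z, hz.trans_le (le_self_add.trans le_self_add), h'⟩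
      · exact ⟨y, lt_add_one_iff'.2 le_add_self, hy⟩
    · exact ⟨u, fun a ha hab => hu a (lt_of_lt_of_le hab (not_lt.1 hx)) hab⟩
  obtain ⟨u, hu⟩ := key b
  exact ⟨u, fun a ha => hu a ha ha⟩

/-- Strong `Σ⁰₁` collection. -/
theorem Sigma1.exists_strong_bound {R : 𝔐.Num → 𝔐.Num → Prop}
    (hR : Sigma1 (fun v : Fin 2 → 𝔐.Num => R (v 0) (v 1))) (b : 𝔐.Num) :
    ∃ u, ∀ a, a < b → (∃ y, R y a) → ∃ y, y < u ∧ R y a := by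
  have hR' : ∀ {k : ℕ} (f g : (Fin k → 𝔐.Num) → 𝔐.Num) [Delta1Fun f] [Delta1Fun g],
      Sigma1 (fun v => R (f v) (g v)) := fun f g _ _ => hR.comp₂ f g
  obtain ⟨m, B, h⟩ := exists_dvd_iff b
  -- `n` codes the set of those `a < b` that have a witness at all. This makes having a witness
  -- decidable, so ordinary collection applies to the implication below.
  obtain ⟨n, -, hn⟩ := h (fun a => ∃ y, R y a) inferInstance
  obtain ⟨u, hu⟩ := Sigma1.exists_bound (R := fun y a => m * (a + 1) + 1 ∣ n → R y a)
    inferInstance b fun a ha => by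
      by_cases hd : m * (a + 1) + 1 ∣ n
      · exact ((hn a ha).1 hd).imp fun y hy _ => hy
      · exact ⟨0, fun h => (hd h).elim⟩
  refine ⟨u, fun a ha hy => ?_⟩
  obtain ⟨y, hyu, hR⟩ := hu a ha
  exact ⟨y, hyu, hR ((hn a ha).2 hy)⟩

instance Delta1.isTriple (f : (Fin n → 𝔐.Num) → 𝔐.Num) [Delta1Fun f] :
    Delta1 (fun v => IsTriple (f v)) :=
  Delta1.comp₁ (R := fun e => IsTriple e) (Delta1.congr (P := fun v => ∃ k, k ≤ v 0 ∧ ∃ m, m ≤ v 0 ∧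
    ∃ n, n ≤ v 0 ∧ v 0 = pair k (pair m n)) inferInstance fun v => by
      constructor
      · rintro ⟨k, -, m, -, n, -, h⟩
        exact ⟨k, m, n, h⟩
      · rintro ⟨k, m, n, h⟩
        rw [h]
        exact ⟨k, le_pair_left _ _, m, (le_pair_left _ _).trans (le_pair_right _ _), n,
          (le_pair_right _ _).trans (le_pair_right _ _), rfl⟩) f

theorem memCode_triple {i k m n : 𝔐.Num} :
    MemCode i (pair k (pair m n)) ↔ i < k ∧ m * (i + 1) + 1 ∣ n := by
  constructor
  · rintro ⟨k', m', n', h, hi, hd⟩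
    simp only [pair_inj] at h
    obtain ⟨rfl, rfl, rfl⟩ := h
    exact ⟨hi, hd⟩
  · rintro ⟨hi, hd⟩
    exact ⟨k, m, n, rfl, hi, hd⟩

theorem MemCode.lt {i e : 𝔐.Num} (h : MemCode i e) : i < e := by
  obtain ⟨k, m, n, rfl, hi, -⟩ := h
  exact hi.trans_le (le_pair_left _ _)

instance Delta1.memCode (f g : (Fin n → 𝔐.Num) → 𝔐.Num) [Delta1Fun f] [Delta1Fun g] :
    Delta1 (fun v => MemCode (f v) (g v)) :=
  Delta1.comp₂ (R := fun i e => MemCode i e)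
    (Delta1.congr (P := fun v => ∃ k, k ≤ v 1 ∧ ∃ m, m ≤ v 1 ∧ ∃ n, n ≤ v 1 ∧
      v 1 = pair k (pair m n) ∧ v 0 < k ∧ m * (v 0 + 1) + 1 ∣ n) inferInstance fun v => by
      constructor
      · rintro ⟨k, -, m, -, n, -, h⟩
        exact ⟨k, m, n, h⟩
      · rintro ⟨k, m, n, h, h'⟩
        rw [h]
        exact ⟨k, le_pair_left _ _, m, (le_pair_left _ _).trans (le_pair_right _ _), n,
          (le_pair_right _ _).trans (le_pair_right _ _), rfl, h'⟩) f g

theorem IsFinCode.ext {e e' : 𝔐.Num} (he : IsFinCode e) (he' : IsFinCode e')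
    (h : ∀ i, MemCode i e ↔ MemCode i e') : e = e' :=
  le_antisymm (not_lt.1 (he.2 e' he'.1 fun i => (h i).symm)) (not_lt.1 (he'.2 e he.1 h))

/-- Members of a coded set are below its code, so a comparison with a smaller code `e'` only has to
inspect `i ≤ v 0`. -/
instance Delta1.isFinCode (f : (Fin n → 𝔐.Num) → 𝔐.Num) [Delta1Fun f] :
    Delta1 (fun v => IsFinCode (f v)) :=
  Delta1.comp₁ (R := fun e => IsFinCode e) (Delta1.congr (P := fun v => IsTriple (v 0) ∧
    ∀ e', e' < v 0 → IsTriple e' → ¬ ∀ i, i ≤ v 0 → (MemCode i e' ↔ MemCode i (v 0)))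
    inferInstance fun v => by
      refine and_congr_right fun _ => ⟨fun h e' he' hi hlt => h e' hlt he' fun i _ => hi i,
        fun h e' hlt he' hi => h e' he' (fun i => ?_) hlt⟩
      by_cases hiv : i ≤ v 0
      · exact hi i hiv
      · exact ⟨fun h' => (hiv (h'.lt.trans hlt).le).elim, fun h' => (hiv h'.lt.le).elim⟩) f

/-- The point is that `B` does not depend on `X`: only boundedly many codes are needed for subsets
of `{i | i < k}`. -/
theorem exists_isFinCode (k : 𝔐.Num) : ∃ B : 𝔐.Num, ∀ X : 𝔐.Num → Prop,
    Sigma1 (fun v : Fin 1 → 𝔐.Num => X (v 0)) →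
    ∃ e, e ≤ B ∧ IsFinCode e ∧ ∀ i, MemCode i e ↔ i < k ∧ X i := by
  obtain ⟨m, B, h⟩ := exists_dvd_iff k
  refine ⟨pair k (pair m B), fun X hX => ?_⟩
  obtain ⟨n, hnB, hn⟩ := h X hX
  have key : ∀ i, MemCode i (pair k (pair m n)) ↔ i < k ∧ X i := fun i => by
    rw [memCode_triple]
    exact and_congr_right (hn i)
  have hb : ∀ i, MemCode i (pair k (pair m n)) → i < k := fun i hi => ((key i).1 hi).1
  -- Both coded sets lie below `e + k`, so agreement up to there is full equality, while the
  -- predicate stays `Δ⁰₁` as the least number principle requires.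
  obtain ⟨e, ⟨het, he⟩, hmin⟩ := exists_least (P := fun e => IsTriple e ∧
    ∀ i, i ≤ e + k → (MemCode i e ↔ MemCode i (pair k (pair m n)))) inferInstance
    ⟨_, ⟨k, m, n, rfl⟩, fun i _ => Iff.rfl⟩
  have he' : ∀ i, MemCode i e ↔ MemCode i (pair k (pair m n)) := fun i => by
    by_cases hi : i ≤ e + k
    · exact he i hi
    · exact ⟨fun h => (hi (h.lt.le.trans le_self_add)).elim,
        fun h => (hi ((hb i h).le.trans le_add_self)).elim⟩
  refine ⟨e, ?_, ⟨het, fun e' he'' hi hlt => hmin e' hlt ⟨he'', fun i _ => ?_⟩⟩, fun i => ?_⟩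
  · refine (not_lt.1 fun h => hmin _ h ⟨⟨k, m, n, rfl⟩, fun i _ => Iff.rfl⟩).trans ?_
    exact pair_le_pair le_rfl (pair_le_pair le_rfl hnB)
  · rw [hi, he']
  · rw [he', key]

/-! ### Finite sequences and primitive recursion -/

instance Delta1Fun.ite (P : (Fin n → 𝔐.Num) → Prop) (f g : (Fin n → 𝔐.Num) → 𝔐.Num)
    [∀ v, Decidable (P v)] [hP : Delta1 P] [hf : Delta1Fun f] [hg : Delta1Fun g] :
    Delta1Fun (fun v => if P v then f v else g v) := by
  have := hf.succ
  have := hg.succ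
  have := hP.subst (fun i (w : Fin (n + 1) → 𝔐.Num) => w i.succ) fun _ => TermFun.var _
  refine ⟨Sigma1.congr (P := fun w => (P (fun i => w i.succ) ∧ w 0 = f fun i => w i.succ) ∨
    ¬ P (fun i => w i.succ) ∧ w 0 = g fun i => w i.succ) inferInstance fun w => ?_⟩
  by_cases h : P fun i => w i.succ <;> simp [h]

/-- A finite sequence is coded as the finite set of its pairs (index, value), and the decoding
function comes from uniformization. Where a code has no value at an index, the second disjunct
imposes no condition on `y` and so keeps the relation total. -/
theorem exists_seqVal : ∃ F : 𝔐.Num → 𝔐.Num → 𝔐.Num,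
    Delta1Fun (fun v : Fin 2 → 𝔐.Num => F (v 0) (v 1)) ∧
    ∀ f : 𝔐.Num → 𝔐.Num, Delta1Fun (fun v : Fin 1 → 𝔐.Num => f (v 0)) → ∀ n, ∃ e,
      ∀ i, i < n → F e i = f i := by
  obtain ⟨F, hF, h⟩ := exists_delta1Fun (n := 2) (R := fun y v =>
    MemCode (pair (v 1) y) (v 0) ∨ ∀ z, z ≤ v 0 → ¬ MemCode (pair (v 1) z) (v 0)) inferInstance
    (fun v => by
      by_cases hy : ∃ y : 𝔐.Num, MemCode (pair (v 1) y) (v 0)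
      · exact hy.imp fun _ => .inl
      · exact ⟨0, .inr fun z _ hz => hy ⟨z, hz⟩⟩)
  refine ⟨fun e i => F ![e, i], ?_, fun f hf n => ?_⟩
  · convert hF with v
    ext i
    fin_cases i <;> rfl
  · have hf' : ∀ {k : ℕ} (g : (Fin k → 𝔐.Num) → 𝔐.Num) [Delta1Fun g],
      Delta1Fun (fun v => f (g v)) := fun g _ => hf.comp₁ g
    obtain ⟨u, hu⟩ := Sigma1.exists_bound (R := fun y i => y = f i) inferInstance n
      fun i _ => ⟨_, rfl⟩
    obtain ⟨B, hB⟩ := exists_isFinCode (pair n u)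
    obtain ⟨e, -, -, he⟩ := hB (fun z => ∃ i, i < n ∧ z = pair i (f i)) inferInstance
    refine ⟨e, fun i hi => ?_⟩
    have hmem : ∀ y, MemCode (pair i y) e ↔ y = f i := by
      intro y
      rw [he]
      constructor
      · rintro ⟨-, j, -, hj⟩
        rw [pair_inj] at hj
        rw [hj.1, hj.2]
      · rintro rfl
        refine ⟨?_, i, hi, rfl⟩
        obtain ⟨_, hy, rfl⟩ := hu i hi
        refine (pair_le_pair hi.le hy.le).lt_of_ne fun hc => ?_
        exact hi.ne (pair_inj.1 hc).1
    rcases h ![e, i] with h | h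
    · exact (hmem _).1 h
    · refine absurd ((hmem _).2 rfl) (h (f i) ?_)
      exact (le_pair_right _ _).trans ((hmem _).2 rfl).lt.le

/-- The `i`-th term of the finite sequence coded by `e`. -/
noncomputable def seqVal (e i : 𝔐.Num) : 𝔐.Num := exists_seqVal.choose e i

instance Delta1Fun.seqVal (f g : (Fin n → 𝔐.Num) → 𝔐.Num) [Delta1Fun f] [Delta1Fun g] :
    Delta1Fun (fun v => seqVal (f v) (g v)) :=
  Delta1Fun.comp₂ exists_seqVal.choose_spec.1 f g

theorem exists_seqVal_eq {f : 𝔐.Num → 𝔐.Num}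
    (hf : Delta1Fun (fun v : Fin 1 → 𝔐.Num => f (v 0))) (n : 𝔐.Num) :
    ∃ e, ∀ i, i < n → seqVal e i = f i :=
  exists_seqVal.choose_spec.2 f hf n

open Classical in
theorem exists_seqVal_snoc (e n y : 𝔐.Num) :
    ∃ e', (∀ i, i ≤ n → seqVal e' i = seqVal e i) ∧ seqVal e' (n + 1) = y := by
  obtain ⟨e', he'⟩ := exists_seqVal_eq (f := fun i => if i ≤ n then seqVal e i else y)
    inferInstance (n + 1 + 1)
  refine ⟨e', fun i hi => ?_, ?_⟩
  · rw [he' i (lt_add_one_iff'.2 (hi.trans le_self_add)), if_pos hi]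
  · rw [he' _ (lt_add_one_iff'.2 le_rfl), if_neg (not_le.2 (lt_add_one_iff'.2 le_rfl))]

/-- A code `e` of the first `n + 1` values is a computation history. Histories exist by `Σ⁰₁`
induction and agree with one another by induction, so `∃ e, S e x n ∧ y = seqVal e n` defines the
graph. -/
theorem exists_primrec {b : 𝔐.Num → 𝔐.Num} {g : 𝔐.Num → 𝔐.Num → 𝔐.Num → 𝔐.Num}
    (hb : Delta1Fun (fun v : Fin 1 → 𝔐.Num => b (v 0)))
    (hg : Delta1Fun (fun v : Fin 3 → 𝔐.Num => g (v 0) (v 1) (v 2))) :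
    ∃ F : 𝔐.Num → 𝔐.Num → 𝔐.Num, Delta1Fun (fun v : Fin 2 → 𝔐.Num => F (v 0) (v 1)) ∧
      (∀ x, F x 0 = b x) ∧ ∀ x n, F x (n + 1) = g x n (F x n) := by
  have hb' : ∀ {k : ℕ} (f : (Fin k → 𝔐.Num) → 𝔐.Num) [Delta1Fun f],
      Delta1Fun (fun v => b (f v)) := fun f _ => hb.comp₁ f
  have hg' : ∀ {k : ℕ} (f f' f'' : (Fin k → 𝔐.Num) → 𝔐.Num) [Delta1Fun f] [Delta1Fun f']
      [Delta1Fun f''], Delta1Fun (fun v => g (f v) (f' v) (f'' v)) :=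
    fun f f' f'' _ _ _ => hg.comp₃ f f' f''
  let S : 𝔐.Num → 𝔐.Num → 𝔐.Num → Prop := fun e x n =>
    seqVal e 0 = b x ∧ ∀ i, i < n → seqVal e (i + 1) = g x i (seqVal e i)
  have hex : ∀ x n, ∃ e, S e x n := by
    intro x
    refine sigma1_induction ?_ ?_
    · obtain ⟨e, he⟩ := exists_seqVal_eq (f := fun _ => b x) inferInstance 1
      exact ⟨e, he 0 one_pos, fun i hi => (not_lt_zero hi).elim⟩
    · rintro n ⟨e, h0, hs⟩
      obtain ⟨e', he', hn⟩ := exists_seqVal_snoc e n (g x n (seqVal e n))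
      refine ⟨e', by rw [he' 0 zero_le, h0], fun i hi => ?_⟩
      rcases (lt_add_one_iff'.1 hi).lt_or_eq with hi | rfl
      · rw [he' _ (add_one_le_iff'.2 hi), he' _ hi.le, hs i hi]
      · rw [hn, he' _ le_rfl]
  have huniq : ∀ x n e e', S e x n → S e' x n → ∀ i, i ≤ n → seqVal e i = seqVal e' i := by
    rintro x n e e' ⟨h0, hs⟩ ⟨h0', hs'⟩
    refine sigma1_induction (fun _ => by rw [h0, h0']) fun i ih hi => ?_
    rw [hs i (add_one_le_iff'.1 hi), hs' i (add_one_le_iff'.1 hi), ih (le_self_add.trans hi)]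
  choose E hE using hex
  have key : ∀ x n e, S e x n → seqVal e n = seqVal (E x n) n :=
    fun x n e he => huniq x n _ _ he (hE x n) n le_rfl
  refine ⟨fun x n => seqVal (E x n) n,
    ⟨Sigma1.congr (P := fun w => ∃ e, S e (w 1) (w 2) ∧ w 0 = seqVal e (w 2))
      (by dsimp only [S]; infer_instance)
      fun w => ⟨?_, fun h => ⟨_, hE _ _, h⟩⟩⟩, fun x => (hE x 0).1, fun x n => ?_⟩
  · rintro ⟨e, he, h⟩
    exact h.trans (key _ _ _ he)
  · have h := hE x (n + 1)
    change seqVal (E x (n + 1)) (n + 1) = _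
    rw [h.2 n (lt_add_one_iff'.2 le_rfl),
      key x n (E x (n + 1)) ⟨h.1, fun i hi => h.2 i (hi.trans (lt_add_one_iff'.2 le_rfl))⟩]

end coding

/-! ### Size-change graphs and their composition -/

section graphs

variable [h𝔐 : Fact 𝔐.IsModelRCA0] {n : ℕ}

theorem edge_inj {x r y x' r' y' : 𝔐.Num} :
    edge x r y = edge x' r' y' ↔ x = x' ∧ r = r' ∧ y = y' := by
  simp [edge]

theorem graph_inj {f g e f' g' e' : 𝔐.Num} :
    graph f g e = graph f' g' e' ↔ f = f' ∧ g = g' ∧ e = e' := by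
  simp [graph]

theorem dec_ne_wdec : (dec : 𝔐.Num) ≠ wdec := zero_ne_one

instance Delta1Fun.edge (f g h : (Fin n → 𝔐.Num) → 𝔐.Num) [Delta1Fun f] [Delta1Fun g]
    [Delta1Fun h] : Delta1Fun (fun v => edge (f v) (g v) (h v)) :=
  inferInstanceAs (Delta1Fun fun v => L2Structure.pair (f v) (L2Structure.pair (g v) (h v)))

instance Delta1Fun.graph (f g h : (Fin n → 𝔐.Num) → 𝔐.Num) [Delta1Fun f] [Delta1Fun g]
    [Delta1Fun h] : Delta1Fun (fun v => graph (f v) (g v) (h v)) :=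
  inferInstanceAs (Delta1Fun fun v => L2Structure.pair (f v) (L2Structure.pair (g v) (h v)))

theorem le_edge (x r y : 𝔐.Num) : x ≤ edge x r y ∧ r ≤ edge x r y ∧ y ≤ edge x r y :=
  ⟨le_pair_left _ _, (le_pair_left _ _).trans (le_pair_right _ _),
    (le_pair_right _ _).trans (le_pair_right _ _)⟩

theorem edge_le_edge {x r y x' r' y' : 𝔐.Num} (hx : x ≤ x') (hr : r ≤ r') (hy : y ≤ y') :
    edge x r y ≤ edge x' r' y' :=
  pair_le_pair hx (pair_le_pair hr hy)

theorem hasEdge_graph {f g e x r y : 𝔐.Num} :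
    HasEdge (graph f g e) x r y ↔ MemCode (edge x r y) e := by
  constructor
  · rintro ⟨f', g', e', h, he⟩
    rw [graph_inj] at h
    rwa [h.2.2]
  · exact fun h => ⟨f, g, e, rfl, h⟩

/-- The function with the graph `F`. -/
theorem IsFun.exists_fun {F : Set 𝔐.Num} (hF : IsFun F) (hs : F ∈ 𝔐.sets) :
    ∃ f : 𝔐.Num → 𝔐.Num, Delta1Fun (fun v : Fin 1 → 𝔐.Num => f (v 0)) ∧
      ∀ x y, pair x y ∈ F ↔ y = f x := by
  have : Fact (F ∈ 𝔐.sets) := ⟨hs⟩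
  choose f hf hu using hF
  have key : ∀ x y, pair x y ∈ F ↔ y = f x := fun x y => ⟨hu x y, fun h => h ▸ hf x⟩
  have h1 : Sigma1 (fun w : Fin 2 → 𝔐.Num => pair (w 1) (w 0) ∈ F) := inferInstance
  exact ⟨f, ⟨h1.congr fun w => key _ _⟩, key⟩

instance Delta1.isVar (ar : Set 𝔐.Num) [hs : Fact (ar ∈ 𝔐.sets)] [hF : Fact (IsFun ar)]
    (f g : (Fin n → 𝔐.Num) → 𝔐.Num) [Delta1Fun f] [Delta1Fun g] :
    Delta1 (fun v => IsVar ar (f v) (g v)) := by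
  obtain ⟨a, ha, h⟩ := hF.out.exists_fun hs.out
  have ha' : ∀ {k : ℕ} (f : (Fin k → 𝔐.Num) → 𝔐.Num) [Delta1Fun f],
      Delta1Fun (fun v => a (f v)) := fun f _ => ha.comp₁ f
  exact Delta1.congr (P := fun v => g v < a (f v)) inferInstance fun v => by
    simp [IsVar, h]

instance Delta1.hasEdge (f g h k : (Fin n → 𝔐.Num) → 𝔐.Num) [Delta1Fun f] [Delta1Fun g]
    [Delta1Fun h] [Delta1Fun k] : Delta1 (fun v => HasEdge (f v) (g v) (h v) (k v)) := by
  refine Delta1.comp₄ (R := fun G x r y => HasEdge G x r y) ?_ f g h k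
  have h1 : Delta1 (fun v : Fin 4 → 𝔐.Num => ∃ f, f ≤ v 0 ∧ ∃ g, g ≤ v 0 ∧ ∃ e, e ≤ v 0 ∧
    v 0 = graph f g e ∧ MemCode (edge (v 1) (v 2) (v 3)) e) := inferInstance
  refine h1.congr fun v => ?_
  constructor
  · rintro ⟨f, -, g, -, e, -, h⟩
    exact ⟨f, g, e, h⟩
  · rintro ⟨f, g, e, h, h'⟩
    rw [h]
    exact ⟨f, (le_edge f g e).1, g, (le_edge f g e).2.1, e, (le_edge f g e).2.2, rfl, h'⟩

theorem HasEdge.lt {G x r y : 𝔐.Num} (h : HasEdge G x r y) : x < G ∧ r < G ∧ y < G := by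
  obtain ⟨f, g, e, rfl, he⟩ := h
  have h1 := he.lt.trans_le (le_edge f g e).2.2
  have h2 := le_edge x r y
  exact ⟨h2.1.trans_lt h1, h2.2.1.trans_lt h1, h2.2.2.trans_lt h1⟩

variable {ar : Set 𝔐.Num}

theorem IsGraphFrom.le {G f g : 𝔐.Num} (h : IsGraphFrom ar G f g) : f ≤ G ∧ g ≤ G := by
  obtain ⟨e, rfl, -⟩ := h
  exact ⟨(le_edge f g e).1, (le_edge f g e).2.1⟩

theorem IsGraphFrom.unique {G f g f' g' : 𝔐.Num} (h : IsGraphFrom ar G f g)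
    (h' : IsGraphFrom ar G f' g') : f = f' ∧ g = g' := by
  obtain ⟨e, rfl, -⟩ := h
  obtain ⟨e', he, -⟩ := h'
  rw [graph_inj] at he
  exact ⟨he.1, he.2.1⟩

theorem IsGraphFrom.isVar {G f g x r y : 𝔐.Num} (h : IsGraphFrom ar G f g)
    (hG : HasEdge G x r y) : IsVar ar f x ∧ (r = dec ∨ r = wdec) ∧ IsVar ar g y := by
  obtain ⟨e, rfl, -, h, -⟩ := h
  obtain ⟨x', r', y', hd, h⟩ := h _ (hasEdge_graph.1 hG)
  rw [edge_inj] at hd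
  obtain ⟨rfl, rfl, rfl⟩ := hd
  exact h

theorem IsGraphFrom.label_unique {G f g x y r r' : 𝔐.Num} (h : IsGraphFrom ar G f g)
    (h1 : HasEdge G x r y) (h2 : HasEdge G x r' y) : r = r' := by
  obtain ⟨e, rfl, -, -, h⟩ := h
  exact h x y r r' (hasEdge_graph.1 h1) (hasEdge_graph.1 h2)

theorem IsGraphFrom.ext {G G' f g : 𝔐.Num} (h : IsGraphFrom ar G f g)
    (h' : IsGraphFrom ar G' f g) (hE : ∀ x r y, HasEdge G x r y ↔ HasEdge G' x r y) : G = G' := by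
  obtain ⟨e, rfl, he, h1, -⟩ := h
  obtain ⟨e', rfl, he', h1', -⟩ := h'
  simp only [hasEdge_graph] at hE
  rw [graph_inj]
  refine ⟨rfl, rfl, he.ext he' fun i => ⟨fun hi => ?_, fun hi => ?_⟩⟩
  · obtain ⟨x, r, y, rfl, -⟩ := h1 i hi
    exact (hE _ _ _).1 hi
  · obtain ⟨x, r, y, rfl, -⟩ := h1' i hi
    exact (hE _ _ _).2 hi

instance Delta1.isGraphFrom [hs : Fact (ar ∈ 𝔐.sets)] [hF : Fact (IsFun ar)]
    (f g h : (Fin n → 𝔐.Num) → 𝔐.Num) [Delta1Fun f] [Delta1Fun g] [Delta1Fun h] :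
    Delta1 (fun v => IsGraphFrom ar (f v) (g v) (h v)) := by
  refine Delta1.comp₃ (R := fun G f g => IsGraphFrom ar G f g) ?_ f g h
  have h1 : Delta1 (fun v : Fin 3 → 𝔐.Num => ∃ e, e ≤ v 0 ∧ v 0 = graph (v 1) (v 2) e ∧
    IsFinCode e ∧ (∀ d, d ≤ e → MemCode d e → ∃ x, x ≤ d ∧ ∃ r, r ≤ d ∧ ∃ y, y ≤ d ∧
      d = edge x r y ∧ IsVar ar (v 1) x ∧ (r = dec ∨ r = wdec) ∧ IsVar ar (v 2) y) ∧
    ∀ x, x ≤ e → ∀ y, y ≤ e → ∀ r, r ≤ e → ∀ r', r' ≤ e →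
      MemCode (edge x r y) e → MemCode (edge x r' y) e → r = r') := inferInstance
  refine h1.congr fun v => ⟨?_, ?_⟩
  · rintro ⟨e, -, h0, h1, h2, h3⟩
    refine ⟨e, h0, h1, fun d hd => ?_, fun x y r r' h h' => ?_⟩
    · obtain ⟨x, -, r, -, y, -, h⟩ := h2 d hd.lt.le hd
      exact ⟨x, r, y, h⟩
    · have := le_edge x r y
      have := le_edge x r' y
      have := h.lt.le
      have := h'.lt.le
      exact h3 x (by order) y (by order) r (by order) r' (by order) h h'
  · rintro ⟨e, h0, h1, h2, h3⟩
    refine ⟨e, ?_, h0, h1, fun d _ hd => ?_, fun x _ y _ r _ r' _ h h' => h3 x y r r' h h'⟩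
    · rw [h0]
      exact (le_edge (v 1) (v 2) e).2.2
    · obtain ⟨x, r, y, rfl, h⟩ := h2 d hd
      have := le_edge x r y
      exact ⟨x, this.1, r, this.2.1, y, this.2.2, rfl, h⟩

/-- The vertices and labels of an edge are smaller than the code of its graph, so all quantifiers in
the definition can be bounded. The bounds on `x` and `z` are sums because an edge may be given on
either side of the equivalence. -/
instance Delta1.isComp [hs : Fact (ar ∈ 𝔐.sets)] [hF : Fact (IsFun ar)]
    (f g h : (Fin n → 𝔐.Num) → 𝔐.Num) [Delta1Fun f] [Delta1Fun g] [Delta1Fun h] :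
    Delta1 (fun v => IsComp ar (f v) (g v) (h v)) := by
  refine Delta1.comp₃ (R := fun G₀ G₁ H => IsComp ar G₀ G₁ H) ?_ f g h
  have h1 : Delta1 (fun v : Fin 3 → 𝔐.Num =>
    (∃ f, f ≤ v 0 ∧ ∃ g, g ≤ v 0 ∧ ∃ h, h ≤ v 1 ∧
      IsGraphFrom ar (v 0) f g ∧ IsGraphFrom ar (v 1) g h ∧ IsGraphFrom ar (v 2) f h)) :=
    inferInstance
  have h2 : Delta1 (fun v : Fin 3 → 𝔐.Num =>
    (∀ x, x ≤ v 0 + v 2 → ∀ z, z ≤ v 1 + v 2 → (HasEdge (v 2) x dec z ↔ ∃ y, y ≤ v 0 ∧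
      ∃ r, r ≤ v 0 + v 1 ∧ ((HasEdge (v 0) x dec y ∧ HasEdge (v 1) y r z) ∨
      (HasEdge (v 0) x r y ∧ HasEdge (v 1) y dec z))))) := inferInstance
  have h3 : Delta1 (fun v : Fin 3 → 𝔐.Num =>
    (∀ x, x ≤ v 0 + v 2 → ∀ z, z ≤ v 1 + v 2 → (HasEdge (v 2) x wdec z ↔
    (∃ y, y ≤ v 0 ∧ (HasEdge (v 0) x wdec y ∧ HasEdge (v 1) y wdec z)) ∧
      ∀ y, y ≤ v 0 → ∀ r, r ≤ v 0 → ∀ r', r' ≤ v 1 →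
        HasEdge (v 0) x r y → HasEdge (v 1) y r' z → r = wdec ∧ r' = wdec))) := inferInstance
  have h1' := h1.congr (Q := fun v => ∃ f g h, IsGraphFrom ar (v 0) f g ∧
    IsGraphFrom ar (v 1) g h ∧ IsGraphFrom ar (v 2) f h) fun v => ⟨?_, ?_⟩
  have h2' := h2.congr (Q := fun v => ∀ x z, HasEdge (v 2) x dec z ↔
    ∃ y r : 𝔐.Num, (HasEdge (v 0) x dec y ∧ HasEdge (v 1) y r z) ∨
      (HasEdge (v 0) x r y ∧ HasEdge (v 1) y dec z)) fun v => ?_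
  have h3' := h3.congr (Q := fun v => ∀ x z, HasEdge (v 2) x wdec z ↔
    (∃ y : 𝔐.Num, HasEdge (v 0) x wdec y ∧ HasEdge (v 1) y wdec z) ∧
      ∀ y r r' : 𝔐.Num, HasEdge (v 0) x r y → HasEdge (v 1) y r' z → r = wdec ∧ r' = wdec)
      fun v => ?_
  · unfold IsComp
    infer_instance
  · have e2 : ∀ x z, (∃ y : 𝔐.Num, y ≤ v 0 ∧ (HasEdge (v 0) x wdec y ∧ HasEdge (v 1) y wdec z)) ↔
        ∃ y : 𝔐.Num, HasEdge (v 0) x wdec y ∧ HasEdge (v 1) y wdec z := fun x z =>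
      ⟨fun ⟨y, _, h⟩ => ⟨y, h⟩, fun ⟨y, h⟩ => ⟨y, h.1.lt.2.2.le, h⟩⟩
    have e3 : ∀ x z, (∀ y, y ≤ v 0 → ∀ r, r ≤ v 0 → ∀ r', r' ≤ v 1 →
        HasEdge (v 0) x r y → HasEdge (v 1) y r' z → r = wdec ∧ r' = wdec) ↔
        ∀ y r r' : 𝔐.Num, HasEdge (v 0) x r y → HasEdge (v 1) y r' z → r = wdec ∧ r' = wdec :=
      fun x z => ⟨fun h y r r' h1 h2 => h y h1.lt.2.2.le r h1.lt.2.1.le r' h2.lt.2.1.le h1 h2,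
        fun h y _ r _ r' _ => h y r r'⟩
    simp only [e2, e3]
    refine ⟨fun h x z => ?_, fun h x _ z _ => h x z⟩
    by_cases hx : x ≤ v 0 + v 2 ∧ z ≤ v 1 + v 2
    · exact h x hx.1 z hx.2
    · refine ⟨fun h => (hx ?_).elim, fun ⟨⟨y, h, h'⟩, _⟩ => (hx ?_).elim⟩
      · exact ⟨h.lt.1.le.trans le_add_self, h.lt.2.2.le.trans le_add_self⟩
      · exact ⟨h.lt.1.le.trans le_self_add, h'.lt.2.2.le.trans le_self_add⟩
  · have e2 : ∀ x z, (∃ y, y ≤ v 0 ∧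
      ∃ r, r ≤ v 0 + v 1 ∧ ((HasEdge (v 0) x dec y ∧ HasEdge (v 1) y r z) ∨
      (HasEdge (v 0) x r y ∧ HasEdge (v 1) y dec z))) ↔ ∃ y r : 𝔐.Num,
      (HasEdge (v 0) x dec y ∧ HasEdge (v 1) y r z) ∨
      (HasEdge (v 0) x r y ∧ HasEdge (v 1) y dec z) := fun x z =>
      ⟨fun ⟨y, _, r, _, h⟩ => ⟨y, r, h⟩, fun ⟨y, r, h⟩ => ⟨y, h.elim (fun h => h.1.lt.2.2.le)
        fun h => h.1.lt.2.2.le, r, h.elim (fun h => h.2.lt.2.1.le.trans le_add_self)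
        fun h => h.1.lt.2.1.le.trans le_self_add, h⟩⟩
    simp only [e2]
    refine ⟨fun h x z => ?_, fun h x _ z _ => h x z⟩
    by_cases hx : x ≤ v 0 + v 2 ∧ z ≤ v 1 + v 2
    · exact h x hx.1 z hx.2
    · refine ⟨fun h => (hx ?_).elim, fun ⟨y, r, h⟩ => (hx ?_).elim⟩
      · exact ⟨h.lt.1.le.trans le_add_self, h.lt.2.2.le.trans le_add_self⟩
      · rcases h with ⟨h, h'⟩ | ⟨h, h'⟩
        · exact ⟨h.lt.1.le.trans le_self_add, h'.lt.2.2.le.trans le_self_add⟩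
        · exact ⟨h.lt.1.le.trans le_self_add, h'.lt.2.2.le.trans le_self_add⟩
  · rintro ⟨f, -, g, -, h, -, H⟩
    exact ⟨f, g, h, H⟩
  · rintro ⟨f, g, h, H⟩
    exact ⟨f, H.1.le.1, g, H.1.le.2, h, H.2.1.le.2, H⟩

/-- There is an edge from `x` to `y` in the graph `G`. -/
def Arc (G x y : 𝔐.Num) : Prop := HasEdge G x dec y ∨ HasEdge G x wdec y

instance Delta1.arc (f g h : (Fin n → 𝔐.Num) → 𝔐.Num) [Delta1Fun f] [Delta1Fun g]
    [Delta1Fun h] : Delta1 (fun v => Arc (f v) (g v) (h v)) := by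
  unfold Arc
  infer_instance

theorem HasEdge.arc {G f g x r y : 𝔐.Num} (h : HasEdge G x r y) (hG : IsGraphFrom ar G f g) :
    Arc G x y := by
  rcases (hG.isVar h).2.1 with rfl | rfl
  · exact .inl h
  · exact .inr h

theorem IsGraphFrom.hasEdge_wdec {G f g x y : 𝔐.Num} (hG : IsGraphFrom ar G f g) :
    HasEdge G x wdec y ↔ Arc G x y ∧ ¬ HasEdge G x dec y :=
  ⟨fun h => ⟨.inr h, fun h' => dec_ne_wdec (hG.label_unique h' h)⟩,
    fun h => h.1.resolve_left h.2⟩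

/-- As labels are unique, a non-strict edge is an arc that is not strict. A graph thus amounts to a
relation of arcs with a subrelation of strict edges. -/
theorem IsGraphFrom.ext_arc {G G' f g : 𝔐.Num} (h : IsGraphFrom ar G f g)
    (h' : IsGraphFrom ar G' f g) (hs : ∀ x y, HasEdge G x dec y ↔ HasEdge G' x dec y)
    (ha : ∀ x y, Arc G x y ↔ Arc G' x y) : G = G' := by
  refine h.ext h' fun x r y => ?_
  have key : HasEdge G x wdec y ↔ HasEdge G' x wdec y := by
    rw [h.hasEdge_wdec, h'.hasEdge_wdec, hs, ha]
  constructor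
  · intro hE
    rcases (h.isVar hE).2.1 with rfl | rfl
    · exact (hs _ _).1 hE
    · exact key.1 hE
  · intro hE
    rcases (h'.isVar hE).2.1 with rfl | rfl
    · exact (hs _ _).2 hE
    · exact key.2 hE

theorem IsComp.strict {G₀ G₁ H : 𝔐.Num} (h : IsComp ar G₀ G₁ H) (x z : 𝔐.Num) :
    HasEdge H x dec z ↔
      ∃ y, (HasEdge G₀ x dec y ∧ Arc G₁ y z) ∨ (Arc G₀ x y ∧ HasEdge G₁ y dec z) := by
  obtain ⟨⟨f, g, k, h0, h1, h2⟩, hs, -⟩ := h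
  rw [hs]
  constructor
  · rintro ⟨y, r, h | h⟩
    · exact ⟨y, .inl ⟨h.1, h.2.arc h1⟩⟩
    · exact ⟨y, .inr ⟨h.1.arc h0, h.2⟩⟩
  · rintro ⟨y, ⟨h, h' | h'⟩ | ⟨h | h, h'⟩⟩
    · exact ⟨y, _, .inl ⟨h, h'⟩⟩
    · exact ⟨y, _, .inl ⟨h, h'⟩⟩
    · exact ⟨y, _, .inr ⟨h, h'⟩⟩
    · exact ⟨y, _, .inr ⟨h, h'⟩⟩

/-- Together with `IsComp.strict` this reduces composition to composition of relations, without the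
priority rule for labels. -/
theorem IsComp.arc {G₀ G₁ H : 𝔐.Num} (h : IsComp ar G₀ G₁ H) (x z : 𝔐.Num) :
    Arc H x z ↔ ∃ y, Arc G₀ x y ∧ Arc G₁ y z := by
  have hs := h.strict x z
  obtain ⟨⟨f, g, k, h0, h1, h2⟩, -, hw⟩ := h
  constructor
  · rintro (h | h)
    · obtain ⟨y, h | h⟩ := hs.1 h
      · exact ⟨y, .inl h.1, h.2⟩
      · exact ⟨y, h.1, .inl h.2⟩
    · obtain ⟨⟨y, h, h'⟩, -⟩ := (hw x z).1 h
      exact ⟨y, .inr h, .inr h'⟩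
  · rintro ⟨y, h, h'⟩
    by_cases hd : HasEdge H x dec z
    · exact .inl hd
    · rw [hs] at hd
      push Not at hd
      refine .inr ((hw x z).2 ⟨⟨y, ?_, ?_⟩, fun y r r' h h' => ?_⟩)
      · exact h.resolve_left fun hh => (hd y).1 hh h'
      · exact h'.resolve_left fun hh => (hd y).2 h hh
      · refine ⟨(h0.isVar h).2.1.resolve_left ?_, (h1.isVar h').2.1.resolve_left ?_⟩
        · rintro rfl
          exact (hd y).1 h (h'.arc h1)
        · rintro rfl
          exact (hd y).2 (h.arc h0) h'

theorem isComp_of {G₀ G₁ H f g k : 𝔐.Num} (h0 : IsGraphFrom ar G₀ f g)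
    (h1 : IsGraphFrom ar G₁ g k) (h2 : IsGraphFrom ar H f k)
    (hs : ∀ x z, HasEdge H x dec z ↔
      ∃ y, (HasEdge G₀ x dec y ∧ Arc G₁ y z) ∨ (Arc G₀ x y ∧ HasEdge G₁ y dec z))
    (ha : ∀ x z, Arc H x z ↔ ∃ y, Arc G₀ x y ∧ Arc G₁ y z) : IsComp ar G₀ G₁ H := by
  refine ⟨⟨f, g, k, h0, h1, h2⟩, fun x z => ?_, fun x z => ?_⟩
  · rw [hs]
    constructor
    · rintro ⟨y, ⟨h, h' | h'⟩ | ⟨h | h, h'⟩⟩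
      · exact ⟨y, _, .inl ⟨h, h'⟩⟩
      · exact ⟨y, _, .inl ⟨h, h'⟩⟩
      · exact ⟨y, _, .inr ⟨h, h'⟩⟩
      · exact ⟨y, _, .inr ⟨h, h'⟩⟩
    · rintro ⟨y, r, h | h⟩
      · exact ⟨y, .inl ⟨h.1, h.2.arc h1⟩⟩
      · exact ⟨y, .inr ⟨h.1.arc h0, h.2⟩⟩
  · rw [h2.hasEdge_wdec, ha, hs]
    constructor
    · rintro ⟨⟨y, h, h'⟩, hd⟩
      push Not at hd
      refine ⟨⟨y, ?_, ?_⟩, fun y r r' h h' => ⟨?_, ?_⟩⟩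
      · exact h.resolve_left fun hh => (hd y).1 hh h'
      · exact h'.resolve_left fun hh => (hd y).2 h hh
      · refine (h0.isVar h).2.1.resolve_left ?_
        rintro rfl
        exact (hd y).1 h (h'.arc h1)
      · refine (h1.isVar h').2.1.resolve_left ?_
        rintro rfl
        exact (hd y).2 (h.arc h0) h'
    · rintro ⟨⟨y, h, h'⟩, hw⟩
      refine ⟨⟨y, .inr h, .inr h'⟩, ?_⟩
      rintro ⟨y, ⟨h, h' | h'⟩ | ⟨h | h, h'⟩⟩
      · exact dec_ne_wdec (hw y _ _ h h').1
      · exact dec_ne_wdec (hw y _ _ h h').1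
      · exact dec_ne_wdec (hw y _ _ h h').1
      · exact dec_ne_wdec (hw y _ _ h h').2

theorem exists_isGraphFrom [hs : Fact (ar ∈ 𝔐.sets)] [hF : Fact (IsFun ar)] (f g : 𝔐.Num)
    {S A : 𝔐.Num → 𝔐.Num → Prop} (hS : Delta1 (fun v : Fin 2 → 𝔐.Num => S (v 0) (v 1)))
    (hA : Delta1 (fun v : Fin 2 → 𝔐.Num => A (v 0) (v 1))) (hSA : ∀ x y, S x y → A x y)
    (hvar : ∀ x y, A x y → IsVar ar f x ∧ IsVar ar g y) :
    ∃ G, IsGraphFrom ar G f g ∧ (∀ x y, HasEdge G x dec y ↔ S x y) ∧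
      ∀ x y, Arc G x y ↔ A x y := by
  have hS' : ∀ {k : ℕ} (f g : (Fin k → 𝔐.Num) → 𝔐.Num) [Delta1Fun f] [Delta1Fun g],
      Delta1 (fun v => S (f v) (g v)) := fun f g _ _ => hS.comp₂ f g
  have hA' : ∀ {k : ℕ} (f g : (Fin k → 𝔐.Num) → 𝔐.Num) [Delta1Fun f] [Delta1Fun g],
      Delta1 (fun v => A (f v) (g v)) := fun f g _ _ => hA.comp₂ f g
  obtain ⟨a, -, ha⟩ := hF.out.exists_fun hs.out
  have hva : ∀ f x, IsVar ar f x ↔ x < a f := fun f x => by simp [IsVar, ha]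
  have hX : Sigma1 (fun v : Fin 1 → 𝔐.Num => ∃ x, ∃ y, (v 0 = edge x dec y ∧ S x y) ∨
    (v 0 = edge x wdec y ∧ A x y ∧ ¬ S x y)) := inferInstance
  -- Every admissible edge has `x < a f`, `y < a g` and label at most `wdec`, and so lies below this
  -- code.
  obtain ⟨B, hB⟩ := exists_isFinCode (edge (a f) wdec (a g))
  obtain ⟨e, -, he, hmem⟩ := hB (fun d => ∃ x, ∃ y, (d = edge x dec y ∧ S x y) ∨
    (d = edge x wdec y ∧ A x y ∧ ¬ S x y)) hX
  have hlt : ∀ x r y, A x y → r ≤ wdec → edge x r y < edge (a f) wdec (a g) := by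
    intro x r y h hr
    have h := hvar x y h
    rw [hva, hva] at h
    refine (edge_le_edge h.1.le hr h.2.le).lt_of_ne fun hc => ?_
    exact h.1.ne (edge_inj.1 hc).1
  have key : ∀ x r y, MemCode (edge x r y) e ↔ (r = dec ∧ S x y) ∨ (r = wdec ∧ A x y ∧ ¬ S x y) := by
    intro x r y
    rw [hmem]
    constructor
    · rintro ⟨-, x', y', ⟨h, h'⟩ | ⟨h, h'⟩⟩
      all_goals
        obtain ⟨rfl, rfl, rfl⟩ := edge_inj.1 h
      · exact .inl ⟨rfl, h'⟩
      · exact .inr ⟨rfl, h'⟩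
    · rintro (⟨rfl, h⟩ | ⟨rfl, h⟩)
      · exact ⟨hlt _ _ _ (hSA _ _ h) zero_le, x, y, .inl ⟨rfl, h⟩⟩
      · exact ⟨hlt _ _ _ h.1 le_rfl, x, y, .inr ⟨rfl, h⟩⟩
  refine ⟨graph f g e, ⟨e, rfl, he, fun d hd => ?_, fun x y r r' h h' => ?_⟩, fun x y => ?_,
    fun x y => ?_⟩
  · obtain ⟨x, y, ⟨h, h'⟩ | ⟨h, h'⟩⟩ := ((hmem d).1 hd).2
    · exact ⟨x, dec, y, h, (hvar _ _ (hSA _ _ h')).1, .inl rfl, (hvar _ _ (hSA _ _ h')).2⟩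
    · exact ⟨x, wdec, y, h, (hvar _ _ h'.1).1, .inr rfl, (hvar _ _ h'.1).2⟩
  · rw [key] at h h'
    rcases h with h | h <;> rcases h' with h' | h'
    · rw [h.1, h'.1]
    · exact absurd h.2 h'.2.2
    · exact absurd h'.2 h.2.2
    · rw [h.1, h'.1]
  · rw [hasEdge_graph, key]
    simp [dec_ne_wdec]
  · rw [Arc, hasEdge_graph, hasEdge_graph, key, key]
    have := hSA x y
    simp only [dec_ne_wdec, dec_ne_wdec.symm, true_and, false_and, or_false, false_or]
    tauto

theorem exists_isComp [hs : Fact (ar ∈ 𝔐.sets)] [hF : Fact (IsFun ar)] {G₀ G₁ f g k : 𝔐.Num}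
    (h0 : IsGraphFrom ar G₀ f g) (h1 : IsGraphFrom ar G₁ g k) :
    ∃ H, IsGraphFrom ar H f k ∧ IsComp ar G₀ G₁ H := by
  have hS : Delta1 (fun v : Fin 2 → 𝔐.Num => ∃ y, y ≤ G₀ ∧ ((HasEdge G₀ (v 0) dec y ∧
    Arc G₁ y (v 1)) ∨ (Arc G₀ (v 0) y ∧ HasEdge G₁ y dec (v 1)))) := inferInstance
  have hA : Delta1 (fun v : Fin 2 → 𝔐.Num => ∃ y, y ≤ G₀ ∧ (Arc G₀ (v 0) y ∧
    Arc G₁ y (v 1))) := inferInstance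
  have hle : ∀ x y, Arc G₀ x y → y ≤ G₀ := fun x y h => h.elim (fun h => h.lt.2.2.le)
    fun h => h.lt.2.2.le
  have hS' := hS.congr (Q := fun v => ∃ y, (HasEdge G₀ (v 0) dec y ∧
    Arc G₁ y (v 1)) ∨ (Arc G₀ (v 0) y ∧ HasEdge G₁ y dec (v 1))) fun v =>
      exists_congr fun y => and_iff_right_of_imp fun h =>
        hle (v 0) y (h.elim (fun h => .inl h.1) fun h => h.1)
  have hA' := hA.congr (Q := fun v => ∃ y, (Arc G₀ (v 0) y ∧ Arc G₁ y (v 1))) fun v =>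
      exists_congr fun y => and_iff_right_of_imp fun h => hle (v 0) y h.1
  obtain ⟨H, hH, h2, h3⟩ := exists_isGraphFrom (ar := ar) f k
    (S := fun x z => ∃ y, (HasEdge G₀ x dec y ∧ Arc G₁ y z) ∨ (Arc G₀ x y ∧ HasEdge G₁ y dec z))
    (A := fun x z => ∃ y, Arc G₀ x y ∧ Arc G₁ y z) hS' hA'
    (fun x z ⟨y, h⟩ => ⟨y, h.elim (fun h => ⟨.inl h.1, h.2⟩) fun h => ⟨h.1, .inl h.2⟩⟩)
    (fun x z ⟨y, h, h'⟩ => ⟨h.elim (fun h => (h0.isVar h).1) fun h => (h0.isVar h).1,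
      h'.elim (fun h => (h1.isVar h).2.2) fun h => (h1.isVar h).2.2⟩)
  exact ⟨H, hH, isComp_of h0 h1 hH h2 h3⟩

theorem IsComp.isGraphFrom {G₀ G₁ H f g g' k : 𝔐.Num} (h : IsComp ar G₀ G₁ H)
    (hG₀ : IsGraphFrom ar G₀ f g) (hG₁ : IsGraphFrom ar G₁ g' k) :
    g = g' ∧ IsGraphFrom ar H f k := by
  obtain ⟨⟨f', g, k', h0, h1, h2⟩, -⟩ := h
  obtain ⟨rfl, rfl⟩ := hG₀.unique h0
  obtain ⟨rfl, rfl⟩ := hG₁.unique h1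
  exact ⟨rfl, h2⟩

theorem IsComp.unique {G₀ G₁ H H' : 𝔐.Num} (h : IsComp ar G₀ G₁ H) (h' : IsComp ar G₀ G₁ H') :
    H = H' := by
  obtain ⟨f, g, k, h0, h1, h2⟩ := h.1
  refine h2.ext_arc (h'.isGraphFrom h0 h1).2 (fun x y => ?_) fun x y => ?_
  · rw [h.strict, h'.strict]
  · rw [h.arc, h'.arc]

theorem IsComp.assoc {G₀ G₁ G₂ A B C : 𝔐.Num} (hA : IsComp ar G₀ G₁ A) (hB : IsComp ar A G₂ B)
    (hC : IsComp ar G₁ G₂ C) : IsComp ar G₀ C B := by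
  obtain ⟨f, g, k, h0, h1, h2⟩ := hA.1
  obtain ⟨f', k', l, h2', h3, h4⟩ := hB.1
  obtain ⟨rfl, rfl⟩ := h2.unique h2'
  refine isComp_of h0 (hC.isGraphFrom h1 h3).2 h4 (fun x z => ?_) fun x z => ?_
  · simp only [hB.strict, hA.strict, hA.arc, hC.strict, hC.arc]
    constructor
    · rintro ⟨y, ⟨⟨w, ⟨h1, h2⟩ | ⟨h1, h2⟩⟩, h3⟩ | ⟨⟨w, h1, h2⟩, h3⟩⟩
      · exact ⟨w, .inl ⟨h1, y, h2, h3⟩⟩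
      · exact ⟨w, .inr ⟨h1, y, .inl ⟨h2, h3⟩⟩⟩
      · exact ⟨w, .inr ⟨h1, y, .inr ⟨h2, h3⟩⟩⟩
    · rintro ⟨w, ⟨h1, y, h2, h3⟩ | ⟨h1, y, ⟨h2, h3⟩ | ⟨h2, h3⟩⟩⟩
      · exact ⟨y, .inl ⟨⟨w, .inl ⟨h1, h2⟩⟩, h3⟩⟩
      · exact ⟨y, .inl ⟨⟨w, .inr ⟨h1, h2⟩⟩, h3⟩⟩
      · exact ⟨y, .inr ⟨⟨w, h1, h2⟩, h3⟩⟩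
  · simp only [hB.arc, hA.arc, hC.arc]
    constructor
    · rintro ⟨y, ⟨w, h1, h2⟩, h3⟩
      exact ⟨w, h1, y, h2, h3⟩
    · rintro ⟨w, h1, y, h2, h3⟩
      exact ⟨y, ⟨w, h1, h2⟩, h3⟩

/-- Collection bounds the arities by `u`, and all edges are then below `edge u wdec u`. The uniform
bound on codes of subsets bounds the edge sets, because recoding an edge set returns the same code.
-/
theorem exists_graph_bound [hs : Fact (ar ∈ 𝔐.sets)] [hF : Fact (IsFun ar)] (b : 𝔐.Num) :
    ∃ B : 𝔐.Num, ∀ G f g, f < b → g < b → IsGraphFrom ar G f g → G < B := by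
  obtain ⟨a, ha, h⟩ := hF.out.exists_fun hs.out
  have ha' : ∀ {k : ℕ} (f : (Fin k → 𝔐.Num) → 𝔐.Num) [Delta1Fun f],
      Delta1Fun (fun v => a (f v)) := fun f _ => ha.comp₁ f
  obtain ⟨u, hu⟩ := Sigma1.exists_bound (R := fun y f => y = a f) inferInstance b
    fun f _ => ⟨_, rfl⟩
  obtain ⟨B, hB⟩ := exists_isFinCode (edge u wdec u)
  refine ⟨graph b b B, fun G f g hf hg hG => ?_⟩
  obtain ⟨e, rfl, he, h1, -⟩ := hG
  obtain ⟨e', he'B, he', hmem⟩ := hB (fun d => MemCode d e) inferInstance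
  obtain rfl : e = e' := by
    refine he.ext he' fun i => ?_
    rw [hmem]
    refine (and_iff_right_of_imp fun hi => ?_).symm
    obtain ⟨x, r, y, rfl, ⟨n, hn, hx⟩, hr, ⟨n', hn', hy⟩⟩ := h1 i hi
    rw [h] at hn hn'
    obtain ⟨_, hn1, rfl⟩ := hu f hf
    obtain ⟨_, hn2, rfl⟩ := hu g hg
    have hxu : x < u := by rw [hn] at hx; exact hx.trans hn1
    have hyu : y < u := by rw [hn'] at hy; exact hy.trans hn2
    have hrw : r ≤ wdec := by
      rcases hr with rfl | rfl
      · exact zero_le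
      · exact le_rfl
    refine (edge_le_edge hxu.le hrw hyu.le).lt_of_ne fun hc => ?_
    exact hxu.ne (edge_inj.1 hc).1
  refine (edge_le_edge hf.le hg.le he'B).lt_of_ne fun hc => ?_
  exact hf.ne (graph_inj.1 hc).1

end graphs

/-! ### Composites of multipaths, and the closure of a set of graphs -/

section composites

variable [h𝔐 : Fact 𝔐.IsModelRCA0] {n : ℕ}

theorem exists_set_of_fun {f : 𝔐.Num → 𝔐.Num}
    (hf : Delta1Fun (fun v : Fin 1 → 𝔐.Num => f (v 0))) :
    ∃ F ∈ 𝔐.sets, IsFun F ∧ ∀ x y, pair x y ∈ F ↔ y = f x := by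
  have hf' : ∀ {k : ℕ} (g : (Fin k → 𝔐.Num) → 𝔐.Num) [Delta1Fun g],
      Delta1Fun (fun v => f (g v)) := fun g _ => hf.comp₁ g
  have key : ∀ x y, (∃ x', x' ≤ pair x y ∧ pair x y = pair x' (f x')) ↔ y = f x := by
    intro x y
    constructor
    · rintro ⟨x', -, h⟩
      rw [pair_inj] at h
      rw [h.2, h.1]
    · rintro rfl
      exact ⟨x, le_pair_left _ _, rfl⟩
  exact ⟨{z | ∃ x, x ≤ z ∧ z = pair x (f x)}, mem_sets_of_delta1 inferInstance,
    fun x => ⟨f x, (key _ _).2 rfl, fun y hy => (key _ _).1 hy⟩, key⟩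

variable {ar : Set 𝔐.Num} [hs : Fact (ar ∈ 𝔐.sets)] [hF : Fact (IsFun ar)]

theorem exists_comp_fun (ar : Set 𝔐.Num) [hs : Fact (ar ∈ 𝔐.sets)] [hF : Fact (IsFun ar)] :
    ∃ F : 𝔐.Num → 𝔐.Num → 𝔐.Num,
      Delta1Fun (fun v : Fin 2 → 𝔐.Num => F (v 0) (v 1)) ∧
      ∀ G₀ G₁ f g h, IsGraphFrom ar G₀ f g → IsGraphFrom ar G₁ g h →
        IsComp ar G₀ G₁ (F G₀ G₁) := by
  obtain ⟨F, hF, h⟩ := exists_delta1Fun (n := 2) (R := fun y v =>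
    (∃ f, f ≤ v 0 ∧ ∃ g, g ≤ v 0 ∧ ∃ h, h ≤ v 1 ∧ IsGraphFrom ar (v 0) f g ∧
      IsGraphFrom ar (v 1) g h) → IsComp ar (v 0) (v 1) y) inferInstance fun v => by
    by_cases hv : ∃ f : 𝔐.Num, f ≤ v 0 ∧ ∃ g, g ≤ v 0 ∧ ∃ h, h ≤ v 1 ∧ IsGraphFrom ar (v 0) f g ∧
      IsGraphFrom ar (v 1) g h
    · obtain ⟨f, -, g, -, h, -, h0, h1⟩ := hv
      obtain ⟨H, -, hH⟩ := exists_isComp h0 h1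
      exact ⟨H, fun _ => hH⟩
    · exact ⟨0, fun h => (hv h).elim⟩
  refine ⟨fun x y => F ![x, y], ?_, fun G₀ G₁ f g k h0 h1 => ?_⟩
  · convert hF with v
    ext i
    fin_cases i <;> rfl
  · exact h ![G₀, G₁] ⟨f, h0.le.1, g, h0.le.2, k, h1.le.2, h0, h1⟩

variable (ar) in
/-- `c m n` is the composite of the graphs `p m, …, p (n - 1)`. -/
def IsComposite (p : 𝔐.Num → 𝔐.Num) (c : 𝔐.Num → 𝔐.Num → 𝔐.Num) : Prop :=
  (∀ m, c m (m + 1) = p m) ∧ ∀ m n, m < n → IsComp ar (c m n) (p n) (c m (n + 1))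

theorem exists_isComposite {p : 𝔐.Num → 𝔐.Num}
    (hp : Delta1Fun (fun v : Fin 1 → 𝔐.Num => p (v 0)))
    (hm : ∀ n, ∃ f g h, IsGraphFrom ar (p n) f g ∧ IsGraphFrom ar (p (n + 1)) g h) :
    ∃ c : 𝔐.Num → 𝔐.Num → 𝔐.Num, Delta1Fun (fun v : Fin 2 → 𝔐.Num => c (v 0) (v 1)) ∧
      IsComposite ar p c := by
  classical
  have hp' : ∀ {k : ℕ} (g : (Fin k → 𝔐.Num) → 𝔐.Num) [Delta1Fun g],
      Delta1Fun (fun v => p (g v)) := fun g _ => hp.comp₁ g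
  obtain ⟨F, hF, hFc⟩ := exists_comp_fun ar
  have hF' : ∀ {k : ℕ} (f g : (Fin k → 𝔐.Num) → 𝔐.Num) [Delta1Fun f] [Delta1Fun g],
      Delta1Fun (fun v => F (f v) (g v)) := fun f g _ _ => hF.comp₂ f g
  -- The recursion on `n` restarts with `p n` as long as `n ≤ m`, so that the value at `m + 1` is `p
  -- m`; the values at `n ≤ m` are irrelevant.
  obtain ⟨c, hc, -, hs⟩ := exists_primrec (b := fun _ => 0)
    (g := fun m n y => if m < n then F y (p n) else p n) inferInstance inferInstance
  have h1 : ∀ m, c m (m + 1) = p m := fun m => by rw [hs, if_neg (lt_irrefl m)]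
  have hc' : ∀ {k : ℕ} (f g : (Fin k → 𝔐.Num) → 𝔐.Num) [Delta1Fun f] [Delta1Fun g],
      Delta1Fun (fun v => c (f v) (g v)) := fun f g _ _ => hc.comp₂ f g
  have h2 : ∀ m n, m < n → ∃ f g h, IsGraphFrom ar (c m n) f g ∧ IsGraphFrom ar (p n) g h := by
    intro m
    refine sigma1_induction (fun h => (not_lt_zero h).elim) fun n ih h => ?_
    obtain ⟨f, g, k, hf, hg⟩ := hm n
    rcases (lt_add_one_iff'.1 h).lt_or_eq with h | rfl
    · obtain ⟨f', g', k', hc, hn⟩ := ih h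
      obtain ⟨rfl, rfl⟩ := hf.unique hn
      refine ⟨f', g, k, ?_, hg⟩
      rw [hs, if_pos h]
      exact ((hFc _ _ _ _ _ hc hf).isGraphFrom hc hf).2
    · exact ⟨f, g, k, by rwa [h1], hg⟩
  refine ⟨c, hc, h1, fun m n h => ?_⟩
  obtain ⟨f, g, k, hf, hg⟩ := h2 m n h
  rw [hs, if_pos h]
  exact hFc _ _ _ _ _ hf hg

variable {p : 𝔐.Num → 𝔐.Num} {c : 𝔐.Num → 𝔐.Num → 𝔐.Num}

theorem IsComposite.comp (h : IsComposite ar p c)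
    (hc : Delta1Fun (fun v : Fin 2 → 𝔐.Num => c (v 0) (v 1))) {l m n : 𝔐.Num} (hlm : l < m)
    (hmn : m < n) : IsComp ar (c l m) (c m n) (c l n) := by
  have hc' : ∀ {k : ℕ} (f g : (Fin k → 𝔐.Num) → 𝔐.Num) [Delta1Fun f] [Delta1Fun g],
      Delta1Fun (fun v => c (f v) (g v)) := fun f g _ _ => hc.comp₂ f g
  suffices key : ∀ n, m < n → IsComp ar (c l m) (c m n) (c l n) from key n hmn
  refine sigma1_induction (fun h => (not_lt_zero h).elim) fun n ih hn => ?_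
  rcases (lt_add_one_iff'.1 hn).lt_or_eq with hn | rfl
  · exact (ih hn).assoc (h.2 l n (hlm.trans hn)) (h.2 m n hn)
  · rw [h.1]
    exact h.2 l m hlm

/-- The composite of the graphs along a thread has an edge from its first to its last parameter,
which is strict if some edge of the thread is. -/
theorem IsComposite.arc_of_thread (h : IsComposite ar p c)
    (hp : Delta1Fun (fun v : Fin 1 → 𝔐.Num => p (v 0)))
    (hc : Delta1Fun (fun v : Fin 2 → 𝔐.Num => c (v 0) (v 1))) {x : 𝔐.Num → 𝔐.Num}
    (hx : Delta1Fun (fun v : Fin 1 → 𝔐.Num => x (v 0))) {m : 𝔐.Num}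
    (hth : ∀ i, m ≤ i → Arc (p i) (x i) (x (i + 1))) (n : 𝔐.Num) (hmn : m < n) :
    Arc (c m n) (x m) (x n) ∧ ∀ i, i < n → m ≤ i → HasEdge (p i) (x i) dec (x (i + 1)) →
      HasEdge (c m n) (x m) dec (x n) := by
  have hp' : ∀ {k : ℕ} (g : (Fin k → 𝔐.Num) → 𝔐.Num) [Delta1Fun g],
      Delta1Fun (fun v => p (g v)) := fun g _ => hp.comp₁ g
  have hx' : ∀ {k : ℕ} (g : (Fin k → 𝔐.Num) → 𝔐.Num) [Delta1Fun g],
      Delta1Fun (fun v => x (g v)) := fun g _ => hx.comp₁ g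
  have hc' : ∀ {k : ℕ} (f g : (Fin k → 𝔐.Num) → 𝔐.Num) [Delta1Fun f] [Delta1Fun g],
      Delta1Fun (fun v => c (f v) (g v)) := fun f g _ _ => hc.comp₂ f g
  revert n
  refine sigma1_induction (fun h => (not_lt_zero h).elim) fun n ih hn => ?_
  rcases (lt_add_one_iff'.1 hn).lt_or_eq with hn | rfl
  · obtain ⟨h1, h2⟩ := ih hn
    have h3 := hth n hn.le
    refine ⟨((h.2 m n hn).arc _ _).2 ⟨_, h1, h3⟩, fun i hi hmi hs => ?_⟩
    rw [(h.2 m n hn).strict]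
    rcases (lt_add_one_iff'.1 hi).lt_or_eq with hi | rfl
    · exact ⟨_, .inl ⟨h2 i hi hmi hs, h3⟩⟩
    · exact ⟨_, .inr ⟨h1, hs⟩⟩
  · rw [h.1]
    refine ⟨hth m le_rfl, fun i hi hmi hs => ?_⟩
    obtain rfl := le_antisymm (lt_add_one_iff'.1 hi) hmi
    exact hs

theorem Arc.lt {G x y : 𝔐.Num} (h : Arc G x y) : x < G ∧ y < G :=
  h.elim (fun h => ⟨h.lt.1, h.lt.2.2⟩) fun h => ⟨h.lt.1, h.lt.2.2⟩

/-- Every strict edge of a composite comes from a finite thread with a strict edge. -/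
theorem IsComposite.exists_thread (h : IsComposite ar p c)
    (hp : Delta1Fun (fun v : Fin 1 → 𝔐.Num => p (v 0)))
    (hc : Delta1Fun (fun v : Fin 2 → 𝔐.Num => c (v 0) (v 1))) {m n x y : 𝔐.Num}
    (hmn : m < n) (hxy : HasEdge (c m n) x dec y) :
    ∃ e, (seqVal e m = x ∧ seqVal e n = y ∧
      ∀ i, i < n → m ≤ i → Arc (p i) (seqVal e i) (seqVal e (i + 1))) ∧
      ∃ i, i < n ∧ m ≤ i ∧ HasEdge (p i) (seqVal e i) dec (seqVal e (i + 1)) := by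
  have hp' : ∀ {k : ℕ} (g : (Fin k → 𝔐.Num) → 𝔐.Num) [Delta1Fun g],
      Delta1Fun (fun v => p (g v)) := fun g _ => hp.comp₁ g
  have hc' : ∀ {k : ℕ} (f g : (Fin k → 𝔐.Num) → 𝔐.Num) [Delta1Fun f] [Delta1Fun g],
      Delta1Fun (fun v => c (f v) (g v)) := fun f g _ _ => hc.comp₂ f g
  -- Arcs and strict edges are treated together, as a strict edge of a composite may consist of an
  -- arc and a strict edge. The bound `y < c m n` keeps the induction statement `Σ⁰₁`.
  suffices key : ∀ n, m < n → ∀ y, y < c m n →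
      (Arc (c m n) x y → ∃ e, (seqVal e m = x ∧ seqVal e n = y ∧
        ∀ i, i < n → m ≤ i → Arc (p i) (seqVal e i) (seqVal e (i + 1)))) ∧
      (HasEdge (c m n) x dec y → ∃ e, (seqVal e m = x ∧ seqVal e n = y ∧
        ∀ i, i < n → m ≤ i → Arc (p i) (seqVal e i) (seqVal e (i + 1))) ∧
        ∃ i, i < n ∧ m ≤ i ∧ HasEdge (p i) (seqVal e i) dec (seqVal e (i + 1))) from
    (key n hmn y hxy.lt.2.2).2 hxy
  clear hmn hxy y n
  have snoc : ∀ e n y z, m < n → seqVal e m = x → seqVal e n = y →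
      (∀ i, i < n → m ≤ i → Arc (p i) (seqVal e i) (seqVal e (i + 1))) → Arc (p n) y z →
      ∃ e', (∀ i, i ≤ n → seqVal e' i = seqVal e i) ∧ (seqVal e' m = x ∧ seqVal e' (n + 1) = z ∧
        ∀ i, i < n + 1 → m ≤ i → Arc (p i) (seqVal e' i) (seqVal e' (i + 1))) := by
    intro e n y z hmn h1 h2 h3 h4
    obtain ⟨e', he', hz⟩ := exists_seqVal_snoc e n z
    refine ⟨e', he', by rw [he' m hmn.le, h1], hz, fun i hi hmi => ?_⟩
    rcases (lt_add_one_iff'.1 hi).lt_or_eq with hi | rfl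
    · rw [he' i hi.le, he' _ (add_one_le_iff'.2 hi)]
      exact h3 i hi hmi
    · rwa [he' i le_rfl, hz, h2]
  refine sigma1_induction (fun h => (not_lt_zero h).elim) fun n ih hn z _ => ?_
  rcases (lt_add_one_iff'.1 hn).lt_or_eq with hn | rfl
  · have ih := ih hn
    rw [(h.2 m n hn).arc, (h.2 m n hn).strict]
    constructor
    · rintro ⟨y, h1, h2⟩
      obtain ⟨e, he, hey, hth⟩ := (ih y h1.lt.2).1 h1
      obtain ⟨e', -, he'⟩ := snoc e n y z hn he hey hth h2
      exact ⟨e', he'⟩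
    · rintro ⟨y, ⟨h1, h2⟩ | ⟨h1, h2⟩⟩
      · obtain ⟨e, ⟨he, hey, hth⟩, i, hi, hmi, hs⟩ := (ih y h1.lt.2.2).2 h1
        obtain ⟨e', hee, he'⟩ := snoc e n y z hn he hey hth h2
        refine ⟨e', he', i, hi.trans (lt_add_one_iff'.2 le_rfl), hmi, ?_⟩
        rwa [hee i hi.le, hee _ (add_one_le_iff'.2 hi)]
      · obtain ⟨e, he, hey, hth⟩ := (ih y h1.lt.2).1 h1
        obtain ⟨e', hee, he'⟩ := snoc e n y z hn he hey hth (.inl h2)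
        refine ⟨e', he', n, lt_add_one_iff'.2 le_rfl, hn.le, ?_⟩
        rwa [hee n le_rfl, he'.2.1, hey]
  · rw [h.1]
    have key : Arc (p m) x z → ∃ e, seqVal e m = x ∧ seqVal e (m + 1) = z ∧
        ∀ i, i < m + 1 → m ≤ i → Arc (p i) (seqVal e i) (seqVal e (i + 1)) := by
      intro ha
      obtain ⟨e, he⟩ := exists_seqVal_eq (f := fun _ => x) inferInstance (m + 1)
      obtain ⟨e', he', hz⟩ := exists_seqVal_snoc e m z
      have hx : seqVal e' m = x := by rw [he' m le_rfl, he m (lt_add_one_iff'.2 le_rfl)]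
      refine ⟨e', hx, hz, fun i hi hmi => ?_⟩
      obtain rfl := le_antisymm (lt_add_one_iff'.1 hi) hmi
      rwa [hx, hz]
    refine ⟨key, fun hd => ?_⟩
    obtain ⟨e, he⟩ := key (.inl hd)
    refine ⟨e, he, m, lt_add_one_iff'.2 le_rfl, le_rfl, ?_⟩
    rwa [he.1, he.2.1]

variable {𝒢 : Set 𝔐.Num} [hs𝒢 : Fact (𝒢 ∈ 𝔐.sets)]

variable (ar 𝒢) in
/-- `e` codes a sequence whose `i`-th term is a composite of `i + 1` graphs from `𝒢`, each term
extending the previous one by one graph, and whose last term has the index `n`. -/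
def Derivation (e n : 𝔐.Num) : Prop :=
  seqVal e 0 ∈ 𝒢 ∧ ∀ i, i < n → ∃ g, g ∈ 𝒢 ∧ IsComp ar (seqVal e i) g (seqVal e (i + 1))

variable (ar 𝒢) in
/-- `H` is a composite of finitely many graphs from `𝒢`. -/
def Reach (H : 𝔐.Num) : Prop := ∃ e n, Derivation ar 𝒢 e n ∧ seqVal e n = H

instance Sigma1.reach (f : (Fin n → 𝔐.Num) → 𝔐.Num) [Delta1Fun f] :
    Sigma1 (fun v => Reach ar 𝒢 (f v)) := by
  refine Sigma1.comp₁ (R := fun H => Reach ar 𝒢 H) ?_ f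
  unfold Reach Derivation
  infer_instance

theorem reach_of_mem {H : 𝔐.Num} (h : H ∈ 𝒢) : Reach ar 𝒢 H := by
  obtain ⟨e, he⟩ := exists_seqVal_eq (f := fun _ => H) inferInstance 1
  have := he 0 one_pos
  exact ⟨e, 0, ⟨this ▸ h, fun i hi => (not_lt_zero hi).elim⟩, this⟩

theorem Reach.snoc {H g K : 𝔐.Num} (h : Reach ar 𝒢 H) (hg : g ∈ 𝒢) (hK : IsComp ar H g K) :
    Reach ar 𝒢 K := by
  obtain ⟨e, n, ⟨h0, h1⟩, h2⟩ := h
  obtain ⟨e', he', hn⟩ := exists_seqVal_snoc e n K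
  refine ⟨e', n + 1, ⟨by rwa [he' 0 zero_le], fun i hi => ?_⟩, hn⟩
  rcases (lt_add_one_iff'.1 hi).lt_or_eq with hi | rfl
  · rw [he' i hi.le, he' _ (add_one_le_iff'.2 hi)]
    exact h1 i hi
  · exact ⟨g, hg, by rwa [he' i le_rfl, h2, hn]⟩

theorem Derivation.induction {P : 𝔐.Num → Prop}
    (hP : Sigma1 (fun v : Fin 1 → 𝔐.Num => P (v 0))) (h0 : ∀ g, g ∈ 𝒢 → P g)
    (hs : ∀ H g K, P H → g ∈ 𝒢 → IsComp ar H g K → P K) {e n : 𝔐.Num}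
    (h : Derivation ar 𝒢 e n) (i : 𝔐.Num) (hi : i ≤ n) : P (seqVal e i) := by
  have hP' : ∀ {k : ℕ} (g : (Fin k → 𝔐.Num) → 𝔐.Num) [Delta1Fun g],
      Sigma1 (fun v => P (g v)) := fun g _ => hP.comp₁ g
  revert i
  refine sigma1_induction (fun _ => h0 _ h.1) fun i ih hi => ?_
  obtain ⟨g, hg, hc⟩ := h.2 i (add_one_le_iff'.1 hi)
  exact hs _ _ _ (ih (le_self_add.trans hi)) hg hc

theorem Reach.induction {P : 𝔐.Num → Prop}
    (hP : Sigma1 (fun v : Fin 1 → 𝔐.Num => P (v 0))) (h0 : ∀ g, g ∈ 𝒢 → P g)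
    (hs : ∀ H g K, P H → g ∈ 𝒢 → IsComp ar H g K → P K) {H : 𝔐.Num}
    (h : Reach ar 𝒢 H) : P H := by
  obtain ⟨e, n, h, rfl⟩ := h
  exact h.induction hP h0 hs n le_rfl

theorem Reach.comp (hgr : ∀ G ∈ 𝒢, ∃ f g, IsGraphFrom ar G f g) {G₀ G₁ H : 𝔐.Num}
    (h0 : Reach ar 𝒢 G₀) (h1 : Reach ar 𝒢 G₁) (hc : IsComp ar G₀ G₁ H) : Reach ar 𝒢 H := by
  obtain ⟨f, g, k, hG0, hG1, hH⟩ := hc.1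
  -- Induction on the derivation of `G₁`, regrouping by associativity. Composability is expressed by
  -- the decidable condition `s = g` on the source, so that the implication remains `Σ⁰₁`.
  have key := h1.induction (P := fun G₁ => ∃ s k, IsGraphFrom ar G₁ s k ∧
    (s = g → ∃ H, IsComp ar G₀ G₁ H ∧ Reach ar 𝒢 H)) inferInstance ?_ ?_
  · obtain ⟨s, k', hs, h⟩ := key
    obtain ⟨rfl, rfl⟩ := hG1.unique hs
    obtain ⟨H', hc', hr⟩ := h rfl
    rwa [hc.unique hc']
  · intro G hG
    obtain ⟨s, k', hs⟩ := hgr G hG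
    refine ⟨s, k', hs, ?_⟩
    rintro rfl
    obtain ⟨H', -, hH'⟩ := exists_isComp hG0 hs
    exact ⟨H', hH', h0.snoc hG hH'⟩
  · rintro A G B ⟨s, k', hs, ih⟩ hG hB
    obtain ⟨s', l, l', h1, h2, h3⟩ := hB.1
    obtain ⟨rfl, rfl⟩ := hs.unique h1
    refine ⟨s, l', h3, ?_⟩
    rintro rfl
    obtain ⟨H', hH', hr⟩ := ih rfl
    obtain ⟨L, -, hL⟩ := exists_isComp (hH'.isGraphFrom hG0 hs).2 h2
    exact ⟨L, hH'.assoc hL hB, hr.snoc hG hL⟩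

theorem exists_reach_bound (hfin : IsFin 𝒢) (hgr : ∀ G ∈ 𝒢, ∃ f g, IsGraphFrom ar G f g) :
    ∃ B, ∀ H, Reach ar 𝒢 H → H < B := by
  obtain ⟨b, hb⟩ := hfin
  obtain ⟨B, hB⟩ := exists_graph_bound (ar := ar) b
  refine ⟨B, fun H hH => ?_⟩
  obtain ⟨f, hf, g, hg, h⟩ := hH.induction
    (P := fun H => ∃ f, f < b ∧ ∃ g, g < b ∧ IsGraphFrom ar H f g) inferInstance
    (fun G hG => by
      obtain ⟨f, g, h⟩ := hgr G hG
      exact ⟨f, h.le.1.trans_lt (hb G hG), g, h.le.2.trans_lt (hb G hG), h⟩)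
    (fun H G K ⟨f, hf, g, hg, h⟩ hG hK => by
      obtain ⟨f', g', k, h1, h2, h3⟩ := hK.1
      obtain ⟨rfl, rfl⟩ := h.unique h1
      exact ⟨f, hf, k, h2.le.2.trans_lt (hb G hG), h3⟩)
  exact hB H f g hf hg h

/-- `Reach` is only `Σ⁰₁`, but it is bounded, which lets bounded `Σ⁰₁` comprehension form it.
Minimality is induction along a derivation. -/
theorem isClosureOf_reach (hfin : IsFin 𝒢) (hgr : ∀ G ∈ 𝒢, ∃ f g, IsGraphFrom ar G f g) :
    IsClosureOf ar 𝒢 {H | Reach ar 𝒢 H} := by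
  obtain ⟨B, hB⟩ := exists_reach_bound hfin hgr
  refine ⟨?_, ⟨fun G hG => reach_of_mem hG, fun G₀ G₁ H h0 h1 hc => Reach.comp hgr h0 h1 hc⟩,
    fun D hD hcl H hH => ?_⟩
  · rw [show {H | Reach ar 𝒢 H} = {H | H < B ∧ Reach ar 𝒢 H} from
      Set.ext fun H => (and_iff_right_of_imp (hB H)).symm]
    exact mem_sets_of_sigma1 inferInstance B
  · have : Fact (D ∈ 𝔐.sets) := ⟨hD⟩
    exact Reach.induction (P := fun H => H ∈ D) inferInstance (fun g hg => hcl.1 hg)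
      (fun H g K hH hg hK => hcl.2 _ _ _ hH (hcl.1 hg) hK) hH

end composites

/-! ### Size-change termination gives strict loops in idempotent graphs -/

section termination

variable [h𝔐 : Fact 𝔐.IsModelRCA0] {ar : Set 𝔐.Num} [hs : Fact (ar ∈ 𝔐.sets)]
  [hF : Fact (IsFun ar)] {𝒢 : Set 𝔐.Num} [hs𝒢 : Fact (𝒢 ∈ 𝔐.sets)]

/-- The graphs composed in a derivation. -/
theorem Derivation.exists_factors {e n : 𝔐.Num} (h : Derivation ar 𝒢 e n) :
    ∃ q : 𝔐.Num → 𝔐.Num, Delta1Fun (fun v : Fin 1 → 𝔐.Num => q (v 0)) ∧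
      q 0 = seqVal e 0 ∧ (∀ i, i ≤ n → q i ∈ 𝒢) ∧
      ∀ i, i < n → IsComp ar (seqVal e i) (q (i + 1)) (seqVal e (i + 1)) := by
  have hR : Sigma1 (fun w : Fin 2 → 𝔐.Num => (w 1 = 0 → w 0 = seqVal e 0) ∧
      ∀ i, i < n → w 1 = i + 1 → w 0 ∈ 𝒢 ∧ IsComp ar (seqVal e i) (w 0) (seqVal e (i + 1))) :=
    inferInstance
  obtain ⟨F, hF, hFR⟩ := exists_delta1Fun (n := 1) (R := fun y v => (v 0 = 0 → y = seqVal e 0) ∧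
      ∀ i, i < n → v 0 = i + 1 → y ∈ 𝒢 ∧ IsComp ar (seqVal e i) y (seqVal e (i + 1))) hR
    fun v => by
      rcases Arith.eq_zero_or_succ (v 0) with h0 | ⟨i, -, hi⟩
      · refine ⟨seqVal e 0, fun _ => rfl, fun i _ hi => ?_⟩
        exact absurd (hi.symm.trans h0) (h𝔐.out.succ_ne_zero i)
      · by_cases hin : i < n
        · obtain ⟨g, hg⟩ := h.2 i hin
          refine ⟨g, fun h0 => absurd (hi.symm.trans h0) (h𝔐.out.succ_ne_zero i),
            fun j _ hj => ?_⟩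
          obtain rfl := add_right_cancel (hi.symm.trans hj)
          exact hg
        · refine ⟨0, fun h0 => absurd (hi.symm.trans h0) (h𝔐.out.succ_ne_zero i),
            fun j hjn hj => ?_⟩
          obtain rfl := add_right_cancel (hi.symm.trans hj)
          exact absurd hjn hin
  have h0 : F ![0] = seqVal e 0 := (hFR ![0]).1 rfl
  refine ⟨fun x => F ![x], ?_, h0, fun i hi => ?_, fun i hi => ((hFR ![i + 1]).2 i hi rfl).2⟩
  · convert hF with v
    ext i
    fin_cases i
    rfl
  · rcases Arith.eq_zero_or_succ i with rfl | ⟨j, -, rfl⟩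
    · change F ![0] ∈ 𝒢
      rw [h0]
      exact h.1
    · exact ((hFR ![j + 1]).2 j (add_one_le_iff'.1 hi) rfl).1

/-- `J k` is the residue of `k` modulo `n + 1`; it runs through the factors of a derivation
periodically. -/
theorem exists_cyclic_counter (n : 𝔐.Num) : ∃ J : 𝔐.Num → 𝔐.Num,
    Delta1Fun (fun v : Fin 1 → 𝔐.Num => J (v 0)) ∧ J 0 = 0 ∧
    ∀ k, J (k + 1) = if J k < n then J k + 1 else 0 := by
  have hg : Delta1Fun (fun v : Fin 3 → 𝔐.Num => if v 2 < n then v 2 + 1 else 0) := inferInstance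
  obtain ⟨F, hF, h0, hs⟩ := exists_primrec (b := fun _ : 𝔐.Num => 0)
    (g := fun _ _ y => if y < n then y + 1 else 0) inferInstance hg
  exact ⟨F 0, hF.comp₂ _ _, h0 0, hs 0⟩

theorem exists_strict_loop_of_isSCT (hfin : IsFin 𝒢)
    (hgr : ∀ G ∈ 𝒢, ∃ f g, IsGraphFrom ar G f g) (hsct : IsSCT ar 𝒢) {G : 𝔐.Num}
    (hG : Reach ar 𝒢 G) (hid : IsIdempotent ar G) : ∃ x, HasEdge G x dec x := by
  obtain ⟨e, n, hder, rfl⟩ := hG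
  obtain ⟨q, hq, hq0, hq𝒢, hqc⟩ := hder.exists_factors
  have hq' : ∀ {k : ℕ} (g : (Fin k → 𝔐.Num) → 𝔐.Num) [Delta1Fun g],
      Delta1Fun (fun v => q (g v)) := fun g _ => hq.comp₁ g
  obtain ⟨f₀, f₁, f₂, hid0, hid1, hid2⟩ := hid.1
  obtain ⟨-, rfl⟩ := hid0.unique hid2
  obtain ⟨rfl, -⟩ := hid0.unique hid1
  -- all initial composites start at the same function
  have hsrc : ∀ i, i ≤ n → ∃ s t, IsGraphFrom ar (q i) s t ∧ IsGraphFrom ar (seqVal e i) f₀ t := by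
    obtain ⟨s₀, t₀, hst⟩ := hgr _ hder.1
    have key : ∀ i, i ≤ n → ∃ t, IsGraphFrom ar (seqVal e i) s₀ t := by
      refine sigma1_induction (fun _ => ⟨t₀, hst⟩) fun i ih hi => ?_
      obtain ⟨t, ht⟩ := ih (le_self_add.trans hi)
      obtain ⟨f, g, k, h1, h2, h3⟩ := (hqc i (add_one_le_iff'.1 hi)).1
      obtain ⟨rfl, rfl⟩ := ht.unique h1
      exact ⟨k, h3⟩
    obtain ⟨t, ht⟩ := key n le_rfl
    obtain ⟨rfl, rfl⟩ := hid0.unique ht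
    intro i hi
    rcases Arith.eq_zero_or_succ i with rfl | ⟨j, -, rfl⟩
    · exact ⟨f₀, t₀, hq0 ▸ hst, hst⟩
    · obtain ⟨f, g, k, h1, h2, h3⟩ := (hqc j (add_one_le_iff'.1 hi)).1
      obtain ⟨t', ht'⟩ := key (j + 1) hi
      obtain ⟨rfl, rfl⟩ := ht'.unique h3
      exact ⟨g, t', h2, ht'⟩
  obtain ⟨J, hJ, hJ0, hJs⟩ := exists_cyclic_counter n
  have hJ' : ∀ {k : ℕ} (g : (Fin k → 𝔐.Num) → 𝔐.Num) [Delta1Fun g],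
      Delta1Fun (fun v => J (g v)) := fun g _ => hJ.comp₁ g
  have hJn : ∀ k, J k ≤ n := by
    refine sigma1_induction (by rw [hJ0]; exact zero_le) fun k ih => ?_
    rw [hJs]
    split_ifs with h
    · exact add_one_le_iff'.2 h
    · exact zero_le
  have hlast : ∀ k, J (k + 1) = 0 → J k = n := fun k h => by
    by_contra hne
    rw [hJs, if_pos ((hJn k).lt_of_ne hne)] at h
    exact h𝔐.out.succ_ne_zero _ h
  -- the periodic multipath
  have hp : Delta1Fun (fun v : Fin 1 → 𝔐.Num => q (J (v 0))) := inferInstance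
  have hnext : ∀ k, ∃ f g h, IsGraphFrom ar (q (J k)) f g ∧ IsGraphFrom ar (q (J (k + 1))) g h := by
    intro k
    obtain ⟨s, t, h1, h2⟩ := hsrc (J k) (hJn k)
    rw [hJs]
    split_ifs with h
    · obtain ⟨t', g, k', h1', h2', h3'⟩ := (hqc _ h).1
      obtain ⟨-, rfl⟩ := h2.unique h1'
      exact ⟨s, t, k', h1, h2'⟩
    · have hn := (hJn k).eq_of_not_lt h
      rw [hn] at h2
      obtain ⟨-, rfl⟩ := h2.unique hid0
      obtain ⟨s', t', h1', h2'⟩ := hsrc 0 zero_le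
      rw [← hq0] at h2'
      exact ⟨s, t, t', h1, h2'⟩
  obtain ⟨p, hps, hpF, hpe⟩ := exists_set_of_fun (f := fun k => q (J k)) hp
  obtain ⟨t, θ, hθ, ⟨hθF, hth⟩, hinf⟩ := hsct p hps ⟨hpF, fun k H hH => by
      rw [(hpe _ _).1 hH]
      exact hq𝒢 _ (hJn k), fun k H H' hH hH' => by
      rw [(hpe _ _).1 hH, (hpe _ _).1 hH']
      exact hnext k⟩
  obtain ⟨x, hx, hxe⟩ := hθF.exists_fun hθ
  have hx' : ∀ {k : ℕ} (g : (Fin k → 𝔐.Num) → 𝔐.Num) [Delta1Fun g],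
      Delta1Fun (fun v => x (g v)) := fun g _ => hx.comp₁ g
  -- composites of the shifted multipath
  have hP : Delta1Fun (fun v : Fin 1 → 𝔐.Num => q (J (t + v 0))) := inferInstance
  obtain ⟨c, hc, hcc⟩ := exists_isComposite (ar := ar) (p := fun k => q (J (t + k))) hP
    fun k => by simpa only [add_assoc] using hnext (t + k)
  have hc' : ∀ {k : ℕ} (f g : (Fin k → 𝔐.Num) → 𝔐.Num) [Delta1Fun f] [Delta1Fun g],
      Delta1Fun (fun v => c (f v) (g v)) := fun f g _ _ => hc.comp₂ f g
  have hthr : ∀ i, Arc (q (J (t + i))) (x i) (x (i + 1)) := fun i => by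
    obtain ⟨r, hr⟩ := hth i (x i) (x (i + 1)) _ ((hxe _ _).2 rfl) ((hxe _ _).2 rfl)
      ((hpe _ _).2 rfl)
    obtain ⟨f, g, -, h, -⟩ := hnext (t + i)
    exact hr.arc h
  have hstrict : ∀ b, ∃ i, b < i ∧ HasEdge (q (J (t + i))) (x i) dec (x (i + 1)) := fun b => by
    obtain ⟨i, y, z, H, hb, hy, hz, hH, hE⟩ := hinf b
    rw [(hxe _ _).1 hy, (hxe _ _).1 hz, (hpe _ _).1 hH] at hE
    exact ⟨i, hb, hE⟩
  -- From a period start `a`, the composite is an initial composite of the derivation during the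
  -- first period and `G` followed by such a composite later on. At the end of each period
  -- idempotence reduces it to `G` again.
  have hcomp : ∀ a, J (t + a) = 0 → ∀ k, a < k + 1 →
      c a (k + 1) = seqVal e (J (t + k)) ∨
      IsComp ar (seqVal e n) (seqVal e (J (t + k))) (c a (k + 1)) := by
    intro a ha
    have base : c a (a + 1) = seqVal e (J (t + a)) := by
      rw [hcc.1]
      beta_reduce
      rw [ha, hq0]
    refine sigma1_induction (fun h => ?_) fun k ih h => ?_
    · obtain rfl : a = 0 := le_antisymm (lt_add_one_iff'.1 h) zero_le
      exact .inl base
    · rcases (lt_add_one_iff'.1 h).lt_or_eq with h | rfl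
      · have hstep : IsComp ar (c a (k + 1)) (q (J (t + (k + 1)))) (c a (k + 1 + 1)) :=
          hcc.2 a (k + 1) h
        rw [← add_assoc t] at hstep ⊢
        have hJk := hJs (t + k)
        split_ifs at hJk with hlt
        · have h3 := hqc _ hlt
          rw [← hJk] at h3
          rcases ih h with h1 | h1
          · rw [h1] at hstep
            exact .inl (hstep.unique h3)
          · exact .inr (h1.assoc hstep h3)
        · have hn := (hJn _).eq_of_not_lt hlt
          have hcn : c a (k + 1) = seqVal e n := by
            rcases ih h with h1 | h1
            · rw [h1, hn]
            · rw [hn] at h1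
              exact h1.unique hid
          rw [hcn, hJk, hq0] at hstep
          rw [hJk]
          exact .inr hstep
      · exact .inl base
  have hcyc : ∀ a b, J (t + a) = 0 → J (t + b) = 0 → a < b → c a b = seqVal e n := by
    intro a b ha hb hab
    rcases Arith.eq_zero_or_succ b with rfl | ⟨k, -, rfl⟩
    · exact (not_lt_zero hab).elim
    · rw [← add_assoc] at hb
      have hn := hlast _ hb
      rcases hcomp a ha k hab with h1 | h1
      · rw [h1, hn]
      · rw [hn] at h1
        exact h1.unique hid
  have hcof : ∀ k, ∃ k', k < k' ∧ J (t + k') = 0 := by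
    intro k
    -- `d` is the number of steps before the counter reaches `n`; it resets one step later.
    obtain ⟨d, hd⟩ := exists_add_of_le (hJn (t + k))
    have key : ∀ i, i ≤ d → J (t + (k + i)) = J (t + k) + i := by
      refine sigma1_induction (fun _ => by rw [add_zero, add_zero]) fun i ih hi => ?_
      have h1 := ih (le_self_add.trans hi)
      rw [← add_assoc k, ← add_assoc t, hJs, h1, if_pos, add_assoc]
      rw [hd]
      exact add_lt_add_right (add_one_le_iff'.1 hi) _
    refine ⟨k + d + 1, lt_add_one_iff'.2 le_self_add, ?_⟩
    rw [← add_assoc, hJs, key d le_rfl, ← hd, if_neg (lt_irrefl n)]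
  -- parameters at the beginning of a period that are visited at all are visited early
  obtain ⟨b, hb⟩ := hfin
  have hxb : ∀ k, x k < b := fun k => (hthr k).lt.1.trans (hb _ (hq𝒢 _ (hJn _)))
  -- This replaces the infinite pigeonhole principle: not a parameter visited infinitely often, but
  -- one visited both before and after a late strict edge is needed.
  obtain ⟨u, hu⟩ := Sigma1.exists_strong_bound (R := fun k y => J (t + k) = 0 ∧ x k = y)
    inferInstance b
  obtain ⟨m, hum, hm⟩ := hstrict u
  obtain ⟨k', hmk, hk'⟩ := hcof m
  obtain ⟨k, hku, hk, hxk⟩ := hu (x k') (hxb k') ⟨k', hk', rfl⟩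
  have hkm := hku.trans hum
  have hE := (hcc.arc_of_thread hP hc hx (m := k) (fun i _ => hthr i) k' (hkm.trans hmk)).2 m hmk
    hkm.le hm
  rw [hcyc k k' hk hk' (hkm.trans hmk), hxk] at hE
  exact ⟨_, hE⟩

end termination

/-! ### The Triangle Ramsey theorem gives infinite descents -/

section descent

variable [h𝔐 : Fact 𝔐.IsModelRCA0]

theorem exists_delta1Fun₁ {R : 𝔐.Num → 𝔐.Num → Prop}
    (hR : Sigma1 (fun w : Fin 2 → 𝔐.Num => R (w 0) (w 1))) (h : ∀ x, ∃ y, R y x) :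
    ∃ f : 𝔐.Num → 𝔐.Num, Delta1Fun (fun v : Fin 1 → 𝔐.Num => f (v 0)) ∧ ∀ x, R (f x) x := by
  obtain ⟨F, hF, hFR⟩ := exists_delta1Fun (n := 1) (R := fun y v => R y (v 0)) hR fun v => h (v 0)
  refine ⟨fun x => F ![x], ?_, fun x => hFR ![x]⟩
  convert hF with v
  ext i
  fin_cases i
  rfl

theorem STAR.exists_color (hstar : 𝔐.STAR) {c : 𝔐.Num → 𝔐.Num → 𝔐.Num}
    (hc : Delta1Fun (fun v : Fin 2 → 𝔐.Num => c (v 0) (v 1))) {k : 𝔐.Num}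
    (hk : ∀ m n, m < n → c m n < k) :
    ∃ i t, ∀ b, ∃ m l, b < m ∧ t < m ∧ m < l ∧ c t m = i ∧ c t l = i ∧ c m l = i := by
  have hc' : ∀ {k : ℕ} (f g : (Fin k → 𝔐.Num) → 𝔐.Num) [Delta1Fun f] [Delta1Fun g],
      Delta1Fun (fun v => c (f v) (g v)) := fun f g _ _ => hc.comp₂ f g
  let X : Set 𝔐.Num := {z | ∃ m, m ≤ z ∧ ∃ n, n ≤ z ∧ z = pair (pair m n) (c m n)}
  have hX : X ∈ 𝔐.sets := mem_sets_of_delta1 inferInstance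
  have key : ∀ m n i, pair (pair m n) i ∈ X ↔ i = c m n := by
    intro m n i
    constructor
    · rintro ⟨m', -, n', -, h⟩
      simp only [pair_inj] at h
      obtain ⟨⟨rfl, rfl⟩, rfl⟩ := h
      rfl
    · rintro rfl
      exact ⟨m, (le_pair_left _ _).trans (le_pair_left _ _), n,
        (le_pair_right _ _).trans (le_pair_left _ _), rfl⟩
  obtain ⟨i, -, t, h⟩ := hstar k X hX fun m n hmn =>
    ⟨⟨c m n, (key _ _ _).2 rfl, fun i hi => (key _ _ _).1 hi⟩,
      fun i hi => (key _ _ _).1 hi ▸ hk m n hmn⟩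
  refine ⟨i, t, fun b => ?_⟩
  obtain ⟨m, l, hb, ht, hml, h1, h2, h3⟩ := h b
  exact ⟨m, l, hb, ht, hml, ((key _ _ _).1 h1).symm, ((key _ _ _).1 h2).symm,
    ((key _ _ _).1 h3).symm⟩

theorem strictMono_of_lt_succ {M : 𝔐.Num → 𝔐.Num}
    (hM : Delta1Fun (fun v : Fin 1 → 𝔐.Num => M (v 0))) (h : ∀ i, M i < M (i + 1)) :
    StrictMono M := by
  have hM' : ∀ {k : ℕ} (g : (Fin k → 𝔐.Num) → 𝔐.Num) [Delta1Fun g],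
      Delta1Fun (fun v => M (g v)) := fun g _ => hM.comp₁ g
  intro i
  refine sigma1_induction (fun h => (not_lt_zero h).elim) fun j ih hj => ?_
  rcases (lt_add_one_iff'.1 hj).lt_or_eq with hj | rfl
  · exact (ih hj).trans (h j)
  · exact h i

/-- A strictly increasing function divides the numbers into blocks. -/
theorem exists_block {M : 𝔐.Num → 𝔐.Num}
    (hM : Delta1Fun (fun v : Fin 1 → 𝔐.Num => M (v 0))) (h : ∀ i, M i < M (i + 1)) (k : 𝔐.Num)
    (hk : M 0 ≤ k) : ∃ i, M i ≤ k ∧ k < M (i + 1) := by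
  have hM' : ∀ {k : ℕ} (g : (Fin k → 𝔐.Num) → 𝔐.Num) [Delta1Fun g],
      Delta1Fun (fun v => M (g v)) := fun g _ => hM.comp₁ g
  revert k
  refine sigma1_induction (fun hk => ⟨0, hk, zero_le.trans_lt (h 0)⟩) fun k ih hk => ?_
  rcases hk.lt_or_eq with hk | hk
  · obtain ⟨i, hi, hki⟩ := ih (lt_add_one_iff'.1 hk)
    rcases (add_one_le_iff'.2 hki).lt_or_eq with hk' | hk'
    · exact ⟨i, hi.trans le_self_add, hk'⟩
    · exact ⟨i + 1, hk'.ge, hk' ▸ h (i + 1)⟩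
  · exact ⟨0, hk.le, hk ▸ h 0⟩

/-- Threads through consecutive blocks with the same first and last parameter can be joined. -/
theorem exists_thread_of_blocks {p M : 𝔐.Num → 𝔐.Num} {x : 𝔐.Num}
    (hp : Delta1Fun (fun v : Fin 1 → 𝔐.Num => p (v 0)))
    (hM : Delta1Fun (fun v : Fin 1 → 𝔐.Num => M (v 0))) (h : ∀ i, M i < M (i + 1))
    (hE : ∀ i, ∃ e, (seqVal e (M i) = x ∧ seqVal e (M (i + 1)) = x ∧
      ∀ j, j < M (i + 1) → M i ≤ j → Arc (p j) (seqVal e j) (seqVal e (j + 1))) ∧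
      ∃ j, j < M (i + 1) ∧ M i ≤ j ∧ HasEdge (p j) (seqVal e j) dec (seqVal e (j + 1))) :
    ∃ y : 𝔐.Num → 𝔐.Num, Delta1Fun (fun v : Fin 1 → 𝔐.Num => y (v 0)) ∧
      (∀ k, M 0 ≤ k → Arc (p k) (y k) (y (k + 1))) ∧
      ∀ b, ∃ k, b < k ∧ HasEdge (p k) (y k) dec (y (k + 1)) := by
  have hp' : ∀ {k : ℕ} (g : (Fin k → 𝔐.Num) → 𝔐.Num) [Delta1Fun g],
      Delta1Fun (fun v => p (g v)) := fun g _ => hp.comp₁ g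
  have hM' : ∀ {k : ℕ} (g : (Fin k → 𝔐.Num) → 𝔐.Num) [Delta1Fun g],
      Delta1Fun (fun v => M (g v)) := fun g _ => hM.comp₁ g
  have hmono := strictMono_of_lt_succ hM h
  have hRE : Sigma1 (fun w : Fin 2 → 𝔐.Num =>
      (seqVal (w 0) (M (w 1)) = x ∧ seqVal (w 0) (M (w 1 + 1)) = x ∧
      ∀ j, j < M (w 1 + 1) → M (w 1) ≤ j →
        Arc (p j) (seqVal (w 0) j) (seqVal (w 0) (j + 1))) ∧
      ∃ j, j < M (w 1 + 1) ∧ M (w 1) ≤ j ∧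
        HasEdge (p j) (seqVal (w 0) j) dec (seqVal (w 0) (j + 1))) := inferInstance
  obtain ⟨E, hEf, hE⟩ := exists_delta1Fun₁ hRE hE
  have hE' : ∀ {k : ℕ} (g : (Fin k → 𝔐.Num) → 𝔐.Num) [Delta1Fun g],
      Delta1Fun (fun v => E (g v)) := fun g _ => hEf.comp₁ g
  have hRI : Sigma1 (fun w : Fin 2 → 𝔐.Num =>
      M 0 ≤ w 1 → M (w 0) ≤ w 1 ∧ w 1 < M (w 0 + 1)) := inferInstance
  -- `I k` is the index of the block containing `k`; below `M 0` its value is arbitrary.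
  obtain ⟨I, hIf, hI⟩ := exists_delta1Fun₁ (R := fun i k => M 0 ≤ k → M i ≤ k ∧ k < M (i + 1)) hRI
    fun k => by
      by_cases hk : M 0 ≤ k
      · obtain ⟨i, hi⟩ := exists_block hM h k hk
        exact ⟨i, fun _ => hi⟩
      · exact ⟨0, fun hk' => (hk hk').elim⟩
  have hI' : ∀ {k : ℕ} (g : (Fin k → 𝔐.Num) → 𝔐.Num) [Delta1Fun g],
      Delta1Fun (fun v => I (g v)) := fun g _ => hIf.comp₁ g
  have hIeq : ∀ i k, M i ≤ k → k < M (i + 1) → I k = i := by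
    intro i k h1 h2
    obtain ⟨h3, h4⟩ := hI k ((hmono.monotone zero_le).trans h1)
    exact le_antisymm (lt_add_one_iff'.1 (hmono.lt_iff_lt.1 (h3.trans_lt h2)))
      (lt_add_one_iff'.1 (hmono.lt_iff_lt.1 (h1.trans_lt h4)))
  -- At the common end point `M (i + 1)` of two blocks both finite threads have the value `x`, so
  -- the glued thread agrees with the thread of block `i` there too.
  have hy : ∀ i k, M i ≤ k → k ≤ M (i + 1) → seqVal (E (I k)) k = seqVal (E i) k := by
    intro i k h1 h2
    rcases h2.lt_or_eq with h2 | rfl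
    · rw [hIeq i k h1 h2]
    · rw [hIeq (i + 1) _ le_rfl (h (i + 1)), (hE (i + 1)).1.1, (hE i).1.2.1]
  have hyf : Delta1Fun (fun v : Fin 1 → 𝔐.Num => seqVal (E (I (v 0))) (v 0)) := inferInstance
  refine ⟨fun k => seqVal (E (I k)) k, hyf, fun k hk => ?_, fun b => ?_⟩
  · obtain ⟨h1, h2⟩ := hI k hk
    have := (hE (I k)).1.2.2 k h2 h1
    rwa [← hy (I k) (k + 1) (h1.trans le_self_add) (add_one_le_iff'.2 h2)] at this
  · have hge : ∀ i, i ≤ M i :=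
      sigma1_induction zero_le fun i ih => add_one_le_iff'.2 (ih.trans_lt (h i))
    -- Since `i ≤ M i`, block `b + 1` lies entirely beyond `b`.
    obtain ⟨-, k, h2, h1, hk⟩ := hE (b + 1)
    refine ⟨k, add_one_le_iff'.1 ((hge _).trans h1), ?_⟩
    beta_reduce
    rw [hy (b + 1) k h1 h2.le, hy (b + 1) (k + 1) (h1.trans le_self_add) (add_one_le_iff'.2 h2)]
    exact hk

variable {ar : Set 𝔐.Num} [hs : Fact (ar ∈ 𝔐.sets)]
  [hF : Fact (IsFun ar)] {𝒢 : Set 𝔐.Num} [hs𝒢 : Fact (𝒢 ∈ 𝔐.sets)]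

/-- If there are arbitrarily late triangles with first vertex `t` whose edges are the composite
`H`, then the multipath is eventually divided into blocks with composite `H`. -/
theorem IsComposite.exists_blocks {p : 𝔐.Num → 𝔐.Num} {c : 𝔐.Num → 𝔐.Num → 𝔐.Num}
    (h : IsComposite ar p c)
    (hc : Delta1Fun (fun v : Fin 2 → 𝔐.Num => c (v 0) (v 1))) {H t : 𝔐.Num}
    (hH : ∀ b, ∃ m l, b < m ∧ t < m ∧ m < l ∧ c t m = H ∧ c t l = H ∧ c m l = H) :
    ∃ M : 𝔐.Num → 𝔐.Num, Delta1Fun (fun v : Fin 1 → 𝔐.Num => M (v 0)) ∧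
      ∀ i, M i < M (i + 1) ∧ c (M i) (M (i + 1)) = H := by
  have hc' : ∀ {k : ℕ} (f g : (Fin k → 𝔐.Num) → 𝔐.Num) [Delta1Fun f] [Delta1Fun g],
      Delta1Fun (fun v => c (f v) (g v)) := fun f g _ _ => hc.comp₂ f g
  obtain ⟨m, hmf, hm⟩ := exists_delta1Fun₁ (R := fun m b => ∃ l, b < m ∧ t < m ∧ m < l ∧
    c t m = H ∧ c t l = H ∧ c m l = H) inferInstance hH
  have hm' : ∀ {k : ℕ} (g : (Fin k → 𝔐.Num) → 𝔐.Num) [Delta1Fun g],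
      Delta1Fun (fun v => m (g v)) := fun g _ => hmf.comp₁ g
  obtain ⟨l, hlf, hl⟩ := exists_delta1Fun₁ (R := fun l b => b < m b ∧ t < m b ∧ m b < l ∧
    c t (m b) = H ∧ c t l = H ∧ c (m b) l = H) inferInstance hm
  have hl' : ∀ {k : ℕ} (g : (Fin k → 𝔐.Num) → 𝔐.Num) [Delta1Fun g],
      Delta1Fun (fun v => l (g v)) := fun g _ => hlf.comp₁ g
  -- Each triangle is chosen beyond the last vertex of the previous one, and the block boundaries
  -- are the middle vertices.
  obtain ⟨F, hF, -, hFs⟩ := exists_primrec (b := fun _ : 𝔐.Num => 0) (g := fun _ _ b => l b)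
    inferInstance inferInstance
  have hF' : ∀ {k : ℕ} (f g : (Fin k → 𝔐.Num) → 𝔐.Num) [Delta1Fun f] [Delta1Fun g],
      Delta1Fun (fun v => F (f v) (g v)) := fun f g _ _ => hF.comp₂ f g
  have hMf : Delta1Fun (fun v : Fin 1 → 𝔐.Num => m (F 0 (v 0))) := inferInstance
  refine ⟨fun i => m (F 0 i), hMf, fun i => ?_⟩
  beta_reduce
  rw [hFs]
  obtain ⟨-, ht, hml, -, h2, h3⟩ := hl (F 0 i)
  obtain ⟨hlm, -, -, h4, -, -⟩ := hl (l (F 0 i))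
  refine ⟨hml.trans hlm, ?_⟩
  -- The composites from the old `m` and from `t` to the new middle vertex are both `H` followed by
  -- the same, possibly unknown, composite from the old `l`. They coincide, and the one from `t` is
  -- `H`.
  have h5 := h.comp hc hml hlm
  have h6 := h.comp hc (ht.trans hml) hlm
  rw [h3] at h5
  rw [h2, h4] at h6
  exact h5.unique h6

theorem IsComposite.reach {p : 𝔐.Num → 𝔐.Num} {c : 𝔐.Num → 𝔐.Num → 𝔐.Num}
    (h : IsComposite ar p c) (hc : Delta1Fun (fun v : Fin 2 → 𝔐.Num => c (v 0) (v 1)))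
    (hp𝒢 : ∀ i, p i ∈ 𝒢) (m n : 𝔐.Num) (hmn : m < n) : Reach ar 𝒢 (c m n) := by
  have hc' : ∀ {k : ℕ} (f g : (Fin k → 𝔐.Num) → 𝔐.Num) [Delta1Fun f] [Delta1Fun g],
      Delta1Fun (fun v => c (f v) (g v)) := fun f g _ _ => hc.comp₂ f g
  revert n
  refine sigma1_induction (fun h => (not_lt_zero h).elim) fun n ih hn => ?_
  rcases (lt_add_one_iff'.1 hn).lt_or_eq with hn | rfl
  · exact (ih hn).snoc (hp𝒢 n) (h.2 m n hn)
  · rw [h.1]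
    exact reach_of_mem (hp𝒢 m)

/-- The colours are the codes of the composites themselves, which are bounded because they all lie
in the closure. A monochromatic triangle is literally an instance of `H;H = H`. -/
theorem STAR.isSCT (hstar : 𝔐.STAR) (hfin : IsFin 𝒢)
    (hgr : ∀ G ∈ 𝒢, ∃ f g, IsGraphFrom ar G f g)
    (hloop : ∀ G, Reach ar 𝒢 G → IsIdempotent ar G → ∃ x, HasEdge G x dec x) : IsSCT ar 𝒢 := by
  rintro P hP ⟨hPF, hP𝒢, hPm⟩
  obtain ⟨p, hp, hPp⟩ := hPF.exists_fun hP
  have hm : ∀ n, ∃ f g h, IsGraphFrom ar (p n) f g ∧ IsGraphFrom ar (p (n + 1)) g h :=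
    fun n => hPm n _ _ ((hPp _ _).2 rfl) ((hPp _ _).2 rfl)
  obtain ⟨c, hc, hcc⟩ := exists_isComposite hp hm
  have hreach := hcc.reach hc fun i => hP𝒢 i _ ((hPp _ _).2 rfl)
  obtain ⟨B, hB⟩ := exists_reach_bound hfin hgr
  obtain ⟨H, t, hH⟩ := hstar.exists_color hc fun m n hmn => hB _ (hreach m n hmn)
  obtain ⟨x, hx⟩ : ∃ x, HasEdge H x dec x := by
    obtain ⟨m, l, -, htm, hml, h1, h2, h3⟩ := hH 0
    have h4 := hcc.comp hc htm hml
    have h5 := hreach t m htm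
    rw [h1, h2, h3] at h4
    rw [h1] at h5
    exact hloop H h5 h4
  obtain ⟨M, hM, hMc⟩ := hcc.exists_blocks hc hH
  obtain ⟨y, hy, hth, hstrict⟩ := exists_thread_of_blocks hp hM (fun i => (hMc i).1)
    fun i => hcc.exists_thread hp hc (hMc i).1 ((hMc i).2.symm ▸ hx)
  have hy' : ∀ {k : ℕ} (g : (Fin k → 𝔐.Num) → 𝔐.Num) [Delta1Fun g],
      Delta1Fun (fun v => y (g v)) := fun g _ => hy.comp₁ g
  have hyM : Delta1Fun (fun v : Fin 1 → 𝔐.Num => y (M 0 + v 0)) := inferInstance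
  obtain ⟨θ, hθ, hθF, hθy⟩ := exists_set_of_fun (f := fun n => y (M 0 + n)) hyM
  refine ⟨M 0, θ, hθ, ⟨hθF, fun n a b G ha hb hG => ?_⟩, fun b => ?_⟩
  · rw [(hθy _ _).1 ha, (hθy _ _).1 hb, (hPp _ _).1 hG, ← add_assoc]
    exact (hth (M 0 + n) le_self_add).elim (fun h => ⟨_, h⟩) fun h => ⟨_, h⟩
  · obtain ⟨k, hbk, hk⟩ := hstrict (M 0 + b)
    obtain ⟨n, rfl⟩ := exists_add_of_le (le_self_add.trans hbk.le)
    rw [add_assoc] at hk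
    exact ⟨n, _, _, _, lt_of_add_lt_add_left hbk, (hθy _ _).2 rfl, (hθy _ _).2 rfl,
      (hPp _ _).2 rfl, hk⟩

end descent

end L2Structure

/-- `RCA₀` proves that the Triangle Ramsey theorem implies the SCT criterion: the implication
holds in every model of `RCA₀`. -/
theorem mainTheorem2 (𝔐 : L2Structure.{u}) (h𝔐 : 𝔐.IsModelRCA0) :
    𝔐.STAR → 𝔐.SCTCriterion := by
  intro hstar ar har hFar 𝒢 h𝒢 hfin hgr
  have : Fact 𝔐.IsModelRCA0 := ⟨h𝔐⟩
  have : Fact (ar ∈ 𝔐.sets) := ⟨har⟩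
  have : Fact (L2Structure.IsFun ar) := ⟨hFar⟩
  have : Fact (𝒢 ∈ 𝔐.sets) := ⟨h𝒢⟩
  exact ⟨{H | L2Structure.Reach ar 𝒢 H}, L2Structure.isClosureOf_reach hfin hgr,
    fun h _ hG hid => L2Structure.exists_strict_loop_of_isSCT hfin hgr h hG hid,
    fun h => hstar.isSCT hfin hgr h⟩
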